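/- Let $\beta(x,y)=x^{T}S_n y$ on $\mathbb{C}^n$, where $S_n$ is the permutation matrix with $S_n e_i=e_{n+1-i}$. Let $SO(n)=\{g\in SL(n,\mathbb{C}):\beta(gx,gy)=\beta(x,y)\ \forall x,y\}$, with Lie algebra $\mathfrak{so}(n)=\{Z:\beta(Zx,y)=-\beta(x,Zy)\ \forall x,y\}$, and let $\mathcal{B}_{\mathfrak{so}(n)}$ be the flag variety of $\mathfrak{so}(n)$, i.e. the set of all Borel (maximal solvable) subalgebras of $\mathfrak{so}(n)$, on which $SO(n)$ acts by $\mathrm{Ad}(g)Z=gZg^{-1}$. Embed $SO(n-1)$ in $SO(n)$ as the stabilizer of the vector $e_{\ell}-e_{\ell+1}$ if $n=2\ell$, and of the vector $e_{\ell+1}$ if $n=2\ell+1$. Let $B_{SO(n-1)}\subset SO(n-1)$ be its standard Borel subgroup, consisting of the elements of $SO(n-1)\subset SO(n)$ that are upper triangular $n\times n$ matrices (for $n=0$ it is the trivial group). For a finite set $A\subset\mathbb{Z}_{\ge 0}$, a signed list of $A$ is a tuple $(\lambda_1,\dots,\lambda_r)$ of elements of $\{\pm a: a\in A\}$ with $\lambda_p\ne\pm\lambda_q$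 for $p\neq q$. A SPIL (partition into signed lists) of $A$ is a set $\Sigma=\{\sigma_1,\dots,\sigma_k\}$ of nonempty signed lists of $A$ such that every element of $A$ occurs, up to sign, in exactly one of the $\sigma_i$, and such that (1) the last entry of every $\sigma_i$ is non-negative; (2) if $0$ occurs in $\sigma_i$, then $0$ is the last entry of $\sigma_i$. Write $SPIL(\ell)$ for the set of SPILs of $\{1,\dots,\ell\}$ and $SPIL(\ell\cup\{0\})$ for the set of SPILs of $\{0,1,\dots,\ell\}$. Theorem. For every integer $\ell\ge 0$ all the sets counted below are finite, and: 1. The number of $B_{SO(2\ell-1)}$-orbits on $\mathcal{B}_{\mathfrak{so}(2\ell)}$ is $|SPIL(\ell)|$. 2. The number of $B_{SO(2\ell)}$-orbits on $\mathcal{B}_{\mathfrak{so}(2\ell+1)}$ is $|SPIL(\ell\cup\{0\})|$. -/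

import Mathlib

attribute [local instance] LieRing.ofAssociativeRing

namespace OrthoCount

open Matrix

noncomputable section

/-! ### The special orthogonal group and its Lie algebra -/

/-- The permutation matrix sending `e i` to `e (n + 1 - i)` (ones on the antidiagonal). -/
def S (n : ℕ) : Matrix (Fin n) (Fin n) ℂ :=
  Matrix.of fun i j => if i = Fin.rev j then 1 else 0

/-- The nondegenerate symmetric bilinear form `β(x, y) = xᵀ S y` on `ℂⁿ`. -/
def beta {n : ℕ} (x y : Fin n → ℂ) : ℂ := x ⬝ᵥ (S n *ᵥ y)

/-- `SO(n)`, the matrices of determinant one that preserve `β`. -/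
def SO (n : ℕ) : Subgroup (Matrix.SpecialLinearGroup (Fin n) ℂ) where
  carrier := {g | ∀ x y : Fin n → ℂ,
    beta ((g : Matrix (Fin n) (Fin n) ℂ) *ᵥ x) ((g : Matrix (Fin n) (Fin n) ℂ) *ᵥ y) = beta x y}
  one_mem' := by
    intro x y
    rw [Matrix.SpecialLinearGroup.coe_one, one_mulVec, one_mulVec]
  mul_mem' := by
    intro g h hg hh x y
    rw [Matrix.SpecialLinearGroup.coe_mul, ← mulVec_mulVec, ← mulVec_mulVec]
    exact (hg _ _).trans (hh x y)
  inv_mem' := by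
    intro g hg x y
    have key : ∀ z : Fin n → ℂ, (g : Matrix (Fin n) (Fin n) ℂ) *ᵥ
        (((g⁻¹ : Matrix.SpecialLinearGroup (Fin n) ℂ) : Matrix (Fin n) (Fin n) ℂ) *ᵥ z) = z := by
      intro z
      rw [mulVec_mulVec, ← Matrix.SpecialLinearGroup.coe_mul, mul_inv_cancel,
        Matrix.SpecialLinearGroup.coe_one, one_mulVec]
    have h := hg (((g⁻¹ : Matrix.SpecialLinearGroup (Fin n) ℂ) : Matrix (Fin n) (Fin n) ℂ) *ᵥ x)
      (((g⁻¹ : Matrix.SpecialLinearGroup (Fin n) ℂ) : Matrix (Fin n) (Fin n) ℂ) *ᵥ y)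
    rw [key, key] at h
    exact h.symm

/-- The underlying matrix of an element of `SO(n)`. -/
def mat {n : ℕ} (g : SO n) : Matrix (Fin n) (Fin n) ℂ := (g : Matrix.SpecialLinearGroup (Fin n) ℂ)

theorem mat_one {n : ℕ} : mat (1 : SO n) = 1 := Matrix.SpecialLinearGroup.coe_one

theorem mat_mul {n : ℕ} (g h : SO n) : mat (g * h) = mat g * mat h :=
  Matrix.SpecialLinearGroup.coe_mul _ _

theorem mat_mul_inv {n : ℕ} (g : SO n) : mat g * mat g⁻¹ = 1 := by
  rw [← mat_mul, mul_inv_cancel, mat_one]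

theorem mat_inv_mul {n : ℕ} (g : SO n) : mat g⁻¹ * mat g = 1 := by
  rw [← mat_mul, inv_mul_cancel, mat_one]

theorem beta_mat {n : ℕ} (g : SO n) (x y : Fin n → ℂ) :
    beta (mat g *ᵥ x) (mat g *ᵥ y) = beta x y := g.2 x y

/-- `so(n)`, the Lie algebra of matrices that are skew-adjoint for `β`. -/
def so (n : ℕ) : LieSubalgebra ℂ (Matrix (Fin n) (Fin n) ℂ) where
  carrier := {Z | ∀ x y : Fin n → ℂ, beta (Z *ᵥ x) y = -beta x (Z *ᵥ y)}
  zero_mem' := by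
    intro x y
    simp [beta]
  add_mem' := by
    intro Z W hZ hW x y
    have h1 := hZ x y
    have h2 := hW x y
    simp only [beta, add_mulVec, add_dotProduct, mulVec_add, dotProduct_add] at h1 h2 ⊢
    rw [h1, h2]
    ring
  smul_mem' := by
    intro c Z hZ x y
    have h1 := hZ x y
    simp only [beta, smul_mulVec, smul_dotProduct, mulVec_smul, dotProduct_smul] at h1 ⊢
    rw [h1, smul_neg]
  lie_mem' := by
    intro Z W hZ hW x y
    have h1 := hZ (W *ᵥ x) y
    have h2 := hW x (Z *ᵥ y)
    have h3 := hW (Z *ᵥ x) y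
    have h4 := hZ x (W *ᵥ y)
    rw [Ring.lie_def]
    simp only [beta, sub_mulVec, ← mulVec_mulVec, sub_dotProduct, mulVec_sub,
      dotProduct_sub] at h1 h2 h3 h4 ⊢
    rw [h1, h2, h3, h4]
    ring

theorem conj_mem_so {n : ℕ} (g : SO n) {Z : Matrix (Fin n) (Fin n) ℂ} (hZ : Z ∈ so n) :
    mat g * Z * mat g⁻¹ ∈ so n := by
  intro x y
  have key : ∀ z : Fin n → ℂ, mat g *ᵥ (mat g⁻¹ *ᵥ z) = z := by
    intro z
    rw [mulVec_mulVec, mat_mul_inv, one_mulVec]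
  have h1 := beta_mat g (Z *ᵥ (mat g⁻¹ *ᵥ x)) (mat g⁻¹ *ᵥ y)
  have h2 := beta_mat g (mat g⁻¹ *ᵥ x) (Z *ᵥ (mat g⁻¹ *ᵥ y))
  rw [key] at h1 h2
  simp only [← mulVec_mulVec]
  rw [h1, h2]
  exact hZ _ _

/-- The adjoint action `Ad(g) Z = g Z g⁻¹` of `SO(n)` on `so(n)`. -/
def Ad {n : ℕ} (g : SO n) : so n →ₗ⁅ℂ⁆ so n where
  toFun Z := ⟨mat g * Z.1 * mat g⁻¹, conj_mem_so g Z.2⟩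
  map_add' Z W := by
    apply Subtype.ext
    simp [mul_add, add_mul]
  map_smul' c Z := by
    apply Subtype.ext
    simp
  map_lie' := by
    intro Z W
    apply Subtype.ext
    have h' : ∀ X Y : Matrix (Fin n) (Fin n) ℂ,
        mat g * X * mat g⁻¹ * (mat g * Y * mat g⁻¹) = mat g * (X * Y) * mat g⁻¹ := by
      intro X Y
      calc mat g * X * mat g⁻¹ * (mat g * Y * mat g⁻¹)
          = mat g * X * (mat g⁻¹ * mat g) * Y * mat g⁻¹ := by simp only [mul_assoc]
        _ = mat g * (X * Y) * mat g⁻¹ := by rw [mat_inv_mul]; simp only [mul_assoc, mul_one]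
    change mat g * ⁅Z.1, W.1⁆ * mat g⁻¹
      = ⁅mat g * Z.1 * mat g⁻¹, mat g * W.1 * mat g⁻¹⁆
    rw [Ring.lie_def, Ring.lie_def, h', h', mul_sub, sub_mul]

theorem Ad_one {n : ℕ} (Z : so n) : Ad (1 : SO n) Z = Z := by
  apply Subtype.ext
  change mat 1 * Z.1 * mat 1⁻¹ = Z.1
  rw [inv_one, mat_one, one_mul, mul_one]

theorem Ad_mul {n : ℕ} (g h : SO n) (Z : so n) : Ad (g * h) Z = Ad g (Ad h Z) := by
  apply Subtype.ext
  change mat (g * h) * Z.1 * mat (g * h)⁻¹ = mat g * (mat h * Z.1 * mat h⁻¹) * mat g⁻¹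
  rw [_root_.mul_inv_rev, mat_mul, mat_mul]
  simp only [mul_assoc]

/-! ### The flag variety, as the set of all Borel subalgebras -/

/-- Borel subalgebras: the subalgebras that are maximal among the solvable ones. -/
def IsBorel {n : ℕ} (b : LieSubalgebra ℂ (so n)) : Prop :=
  Maximal (fun c : LieSubalgebra ℂ (so n) => LieAlgebra.IsSolvable c) b

/-- The points of the flag variety of `so(n)`. -/
def FlagVariety (n : ℕ) : Type := {b : LieSubalgebra ℂ (so n) // IsBorel b}

theorem map_Ad_one {n : ℕ} (b : LieSubalgebra ℂ (so n)) : b.map (Ad (1 : SO n)) = b := by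
  ext Z
  simp [LieSubalgebra.mem_map, Ad_one]

theorem map_Ad_mul {n : ℕ} (g h : SO n) (b : LieSubalgebra ℂ (so n)) :
    b.map (Ad (g * h)) = (b.map (Ad h)).map (Ad g) := by
  ext Z
  simp only [LieSubalgebra.mem_map, Ad_mul]
  constructor
  · rintro ⟨W, hW, rfl⟩
    exact ⟨_, ⟨W, hW, rfl⟩, rfl⟩
  · rintro ⟨_, ⟨W, hW, rfl⟩, rfl⟩
    exact ⟨W, hW, rfl⟩

theorem map_Ad_mono {n : ℕ} (g : SO n) {b c : LieSubalgebra ℂ (so n)} (h : b ≤ c) :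
    b.map (Ad g) ≤ c.map (Ad g) := by
  intro Z hZ
  obtain ⟨W, hW, rfl⟩ := (LieSubalgebra.mem_map _ _ _).1 hZ
  exact (LieSubalgebra.mem_map _ _ _).2 ⟨W, h hW, rfl⟩

theorem isSolvable_map_Ad {n : ℕ} (g : SO n) {b : LieSubalgebra ℂ (so n)}
    (hb : LieAlgebra.IsSolvable b) : LieAlgebra.IsSolvable (b.map (Ad g)) := by
  let f : b →ₗ⁅ℂ⁆ (b.map (Ad g)) :=
    { toFun := fun Z => ⟨Ad g Z.1, LieSubalgebra.mem_map _ _ _ |>.2 ⟨Z.1, Z.2, rfl⟩⟩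
      map_add' := fun Z W => Subtype.ext (map_add (Ad g) Z.1 W.1)
      map_smul' := fun c Z => Subtype.ext (map_smul (Ad g) c Z.1)
      map_lie' := fun {Z W} => Subtype.ext (LieHom.map_lie (Ad g) Z.1 W.1) }
  have hf : Function.Surjective f := by
    rintro ⟨Z, hZ⟩
    obtain ⟨W, hW, rfl⟩ := (LieSubalgebra.mem_map _ _ _).1 hZ
    exact ⟨⟨W, hW⟩, rfl⟩
  exact hf.lieAlgebra_isSolvable

theorem isBorel_map_Ad {n : ℕ} (g : SO n) {b : LieSubalgebra ℂ (so n)} (hb : IsBorel b) :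
    IsBorel (b.map (Ad g)) := by
  refine ⟨isSolvable_map_Ad g hb.1, fun c hc hbc => ?_⟩
  have h1 : b ≤ c.map (Ad g⁻¹) := by
    have := map_Ad_mono g⁻¹ hbc
    rwa [← map_Ad_mul, inv_mul_cancel, map_Ad_one] at this
  have h2 := map_Ad_mono g (hb.2 (isSolvable_map_Ad g⁻¹ hc) h1)
  rwa [← map_Ad_mul, mul_inv_cancel, map_Ad_one] at h2

/-- `SO(n)` acts on its flag variety by `b ↦ Ad(g) b`. -/
instance (n : ℕ) : MulAction (SO n) (FlagVariety n) where
  smul g b := ⟨b.1.map (Ad g), isBorel_map_Ad g b.2⟩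
  one_smul b := Subtype.ext (map_Ad_one b.1)
  mul_smul g h b := Subtype.ext (map_Ad_mul g h b.1)

/-! ### The standard Borel subgroup of `SO(n - 1)` inside `SO(n)` -/

/-- The non-isotropic vector fixed by `SO(n - 1)`.  With rows numbered from zero it is
`e ℓ - e (-ℓ)` (rows `ℓ - 1` and `ℓ`) if `n = 2 ℓ`, and `e 0` (the middle row `ℓ`)
if `n = 2 ℓ + 1`. -/
def fixedVec (n : ℕ) : Fin n → ℂ := fun i =>
  if 2 * (i : ℕ) + 1 = n then 1
  else if 2 * (i : ℕ) + 2 = n then 1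
  else if 2 * (i : ℕ) = n then -1
  else 0

/-- `K = SO(n - 1)`, embedded in `SO(n)` as the subgroup that fixes `fixedVec n`; it acts on the
orthogonal complement of that vector as the special orthogonal group of the restricted form. -/
def K (n : ℕ) : Subgroup (SO n) where
  carrier := {g | mat g *ᵥ fixedVec n = fixedVec n}
  one_mem' := by
    change mat 1 *ᵥ fixedVec n = fixedVec n
    rw [mat_one, one_mulVec]
  mul_mem' := by
    intro g h hg hh
    change mat (g * h) *ᵥ fixedVec n = fixedVec n
    rw [mat_mul, ← mulVec_mulVec, show mat h *ᵥ fixedVec n = fixedVec n from hh]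
    exact hg
  inv_mem' := by
    intro g hg
    have h2 := congrArg (fun v => mat g⁻¹ *ᵥ v) (show mat g *ᵥ fixedVec n = fixedVec n from hg)
    simp only [mulVec_mulVec, mat_inv_mul, one_mulVec] at h2
    exact h2.symm

/-- The standard Borel subgroup of `SO(n)`: its upper triangular matrices. -/
def B (n : ℕ) : Subgroup (SO n) where
  carrier := {g | (mat g).BlockTriangular id}
  one_mem' := by
    change (mat 1).BlockTriangular id
    rw [mat_one]
    exact blockTriangular_one
  mul_mem' := by
    intro g h hg hh
    change (mat (g * h)).BlockTriangular id
    rw [mat_mul]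
    exact BlockTriangular.mul hg hh
  inv_mem' := by
    intro g hg
    change (mat g⁻¹).BlockTriangular id
    have : Invertible (mat g) := invertibleOfRightInverse _ _ (mat_mul_inv g)
    have h2 := blockTriangular_inv_of_blockTriangular (M := mat g) hg
    rwa [Matrix.inv_eq_right_inv (mat_mul_inv g)] at h2

/-- `B_{SO(n - 1)} = K ∩ B`, the standard Borel subgroup of `K = SO(n - 1)`. -/
def BorelSOPred (n : ℕ) : Subgroup (SO n) := K n ⊓ B n

/-- The set of `B_{SO(n - 1)}`-orbits on the flag variety of `so(n)`. -/
abbrev Orbits (n : ℕ) : Type :=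
  MulAction.orbitRel.Quotient (BorelSOPred n) (FlagVariety n)

end

/-! ### Partitions into signed lists -/

/-- A partition of `A` into lists: a finite set of nonempty lists without repetitions, with
entries in `A`, such that every element of `A` lies in exactly one of them. -/
def IsPIL (A : Finset ℕ) (P : Finset (List ℕ)) : Prop :=
  (∀ s ∈ P, s ≠ [] ∧ s.Nodup ∧ ∀ a ∈ s, a ∈ A) ∧ ∀ a ∈ A, ∃! s, s ∈ P ∧ a ∈ s

/-- A signed list of `A`: its entries are of the form `a` or `-a` with `a ∈ A`, and any two entries
in distinct positions satisfy `x ≠ y` and `x ≠ -y`. -/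
def IsSignedList (A : Finset ℕ) (s : List ℤ) : Prop :=
  (∀ x ∈ s, ∃ a ∈ A, x = (a : ℤ) ∨ x = -(a : ℤ)) ∧ s.Pairwise fun x y => x ≠ y ∧ x ≠ -y

/-- The list `|s|` of absolute values. -/
def absList (s : List ℤ) : List ℕ := s.map Int.natAbs

/-- A partition of `A` into signed lists `s₁, …, s_k`: the lists `|s₁|, …, |s_k|` are pairwise
distinct and form a partition of `A` into lists, the last entry of each `s_i` is non-negative, and
`0` can only occur as a last entry. -/
def IsSPIL (A : Finset ℕ) (P : Finset (List ℤ)) : Prop :=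
  (∀ s ∈ P, IsSignedList A s) ∧
  Set.InjOn absList (P : Set (List ℤ)) ∧
  IsPIL A (P.image absList) ∧
  (∀ s ∈ P, ∀ x ∈ s.getLast?, 0 ≤ x) ∧
  (∀ s ∈ P, (0 : ℤ) ∈ s → s.getLast? = some 0)

/-- The set of all partitions of `A` into signed lists. -/
def SPIL (A : Finset ℕ) : Set (Finset (List ℤ)) := {P | IsSPIL A P}

end OrthoCount

/-! Orbits and SPILs satisfy the same recursion, recorded in `orbitCount`: c(0) = c(1) = 1 and
c(n+2) = c(n+1) + 2⌊(n+1)/2⌋ c(n).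

From orbits to configurations. By Lie's theorem the Borel subalgebras of so(n) are the stabilizers
of full isotropic flags E (`exists_flag_of_isSolvable`, `isSolvable_flagStab`). The stabilizer
remembers exactly the steps of dimension below n/2 (`flagStab_eq_iff`). For even n the middle step
remains ambiguous, and requiring E to lie in the SO(n)-orbit of the standard flag removes the
ambiguity (`IsOriented.eq_of_eq`). The group B_{SO(n-1)} fixes a non-isotropic vector v and
stabilizes a full isotropic flag F of its orthogonal complement. For n > 0 the orbits therefore
correspond to isometry classes of configurations (V, v, F, E). Determinants are controlled by
`exists_BorelSOPred_of_iso` and `Config.Valid.exists_isOriented`.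

The recursion for configurations looks at the line E 1 = ⟨p⟩. If p is not orthogonal to v, then v^⊥
carries F as a full flag, the flag cut out on it by E, and a unit vector in the span of p and v; the
two flags exchange roles and the dimension drops by one (`UpRel`). If p is orthogonal to v, its
position relative to F is either the first step F (j+1) that contains p or, when no step does, the
first step not orthogonal to p. Splitting off a hyperbolic pair p, q then lowers the dimension by
two (`InsRel`). In dimension n+2 there are ⌊(n+1)/2⌋ values of j and two alternatives. Both
reductions are reversible up to isometry, so the classes are counted by `Config.Code`.

The recursion for SPILs marks one element. The block of 0 is an arbitrary signed list followed by 0.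
The block of x ≠ 0 becomes, once its overall sign is chosen so that x occurs positively, a signed
list, x, and another signed list. A signed list on l elements is empty or starts with one of 2l
entries, which gives `consCount` and the same recursion (`consCount_even`, `consCount_odd`). -/

namespace OrthoCount

open Module

/-! ### Quadratic spaces and isotropic flags -/

section QuadraticSpaces

variable {V : Type*} [AddCommGroup V] [Module ℂ V]

/-- A nondegenerate symmetric bilinear form on a complex space of dimension `n`. -/
structure IsQuad (B : LinearMap.BilinForm ℂ V) (n : ℕ) : Prop where
  fin : FiniteDimensional ℂ V
  symm : ∀ x y, B x y = B y x
  nondeg : ∀ x, (∀ y, B x y = 0) → x = 0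
  dim : finrank ℂ V = n

/-- An isotropic flag of length `l`, continued as a constant sequence. -/
structure IsFlag (B : LinearMap.BilinForm ℂ V) (E : ℕ → Submodule ℂ V) (l : ℕ) : Prop where
  mono : Monotone E
  iso : ∀ i, ∀ x ∈ E i, ∀ y ∈ E i, B x y = 0
  dim : ∀ i, finrank ℂ (E i) = min i l

/-- Rank and nullity for `f` restricted to `S`. Every dimension count for a flag cut by a hyperplane
rests on it. -/
theorem finrank_inf_ker_add_one [FiniteDimensional ℂ V] (S : Submodule ℂ V) (f : V →ₗ[ℂ] ℂ) {u : V}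
    (hu : u ∈ S) (hf : f u ≠ 0) :
    finrank ℂ (S ⊓ LinearMap.ker f : Submodule ℂ V) + 1 = finrank ℂ S := by
  have h := LinearMap.finrank_range_add_finrank_ker (f.domRestrict S)
  have hr : LinearMap.range (f.domRestrict S) = ⊤ := by
    rw [LinearMap.range_eq_top]
    apply LinearMap.surjective
    intro h0
    exact hf (by simpa using LinearMap.congr_fun h0 ⟨u, hu⟩)
  rw [hr, finrank_top, Module.finrank_self] at h
  have hk : finrank ℂ (LinearMap.ker (f.domRestrict S))
      = finrank ℂ (S ⊓ LinearMap.ker f : Submodule ℂ V) := by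
    rw [← Submodule.finrank_map_subtype_eq S (LinearMap.ker (f.domRestrict S))]
    have he : (LinearMap.ker (f.domRestrict S)).map S.subtype = S ⊓ LinearMap.ker f := by
      ext x
      simp only [Submodule.mem_map, LinearMap.mem_ker, Submodule.mem_inf]
      exact ⟨fun ⟨y, hy, hyx⟩ => hyx ▸ ⟨y.2, hy⟩, fun ⟨h1, h2⟩ => ⟨⟨x, h1⟩, h2, rfl⟩⟩
    rw [he]
  omega

theorem finrank_comap_subtype (W S : Submodule ℂ V) :
    finrank ℂ (S.comap W.subtype) = finrank ℂ (S ⊓ W : Submodule ℂ V) := by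
  rw [← Submodule.finrank_map_subtype_eq, Submodule.map_comap_subtype, inf_comm]

namespace IsQuad

variable {B : LinearMap.BilinForm ℂ V} {n : ℕ}

theorem isRefl (h : IsQuad B n) : B.IsRefl := fun x y hxy => by rw [h.symm, hxy]

theorem nondegenerate (h : IsQuad B n) : B.Nondegenerate := by
  refine ⟨fun x hx => h.nondeg x hx, fun x hx => h.nondeg x fun y => ?_⟩
  rw [h.symm]
  exact hx y

theorem finrank_orthogonal (h : IsQuad B n) (S : Submodule ℂ V) :
    finrank ℂ (B.orthogonal S) + finrank ℂ S = n := by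
  have := h.fin
  have h1 := LinearMap.BilinForm.finrank_orthogonal h.nondegenerate S
  have h2 := Submodule.finrank_le S
  rw [h.dim] at h1 h2
  omega

/-- An isotropic subspace lies in its own orthogonal complement, which has complementary dimension.
-/
theorem two_mul_finrank_le (h : IsQuad B n) {S : Submodule ℂ V}
    (hS : ∀ x ∈ S, ∀ y ∈ S, B x y = 0) : 2 * finrank ℂ S ≤ n := by
  have := h.fin
  have h1 := h.finrank_orthogonal S
  have h2 : S ≤ B.orthogonal S := fun x hx y hy => hS y hy x hx
  have h3 := Submodule.finrank_mono h2
  omega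

theorem exists_orthogonal_ne_zero (h : IsQuad B n) {S : Submodule ℂ V} {x : V} (hx : x ∉ S) :
    ∃ y, (∀ s ∈ S, B s y = 0) ∧ B x y ≠ 0 := by
  have := h.fin
  by_contra! hc
  apply hx
  rw [← LinearMap.BilinForm.orthogonal_orthogonal h.nondegenerate h.isRefl S]
  intro y hy
  exact (h.symm _ _).trans (hc y hy)

/-- A nonzero isotropic vector orthogonal to `S`, where `x ∉ S`, has an isotropic dual partner
orthogonal to `S`. -/
theorem exists_partner (h : IsQuad B n) {S : Submodule ℂ V} {p : V} (hp : p ∉ S) (hpp : B p p = 0)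
    (hS : ∀ s ∈ S, B s p = 0) : ∃ q, (∀ s ∈ S, B s q = 0) ∧ B p q = 1 ∧ B q q = 0 := by
  obtain ⟨y, hy, hpy⟩ := h.exists_orthogonal_ne_zero hp
  have h2 : B y p = B p y := h.symm _ _
  -- Scale `y` to pair to 1 with `p`, then subtract half its square times `p`; this makes the vector
  -- isotropic without changing the pairing, as `p` is isotropic.
  refine ⟨(B p y)⁻¹ • y - ((B p y)⁻¹ ^ 2 * B y y / 2) • p, fun s hs => ?_, ?_, ?_⟩
  · simp [hy s hs, hS s hs]
  · simp [hpp, hpy]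
  · simp only [map_sub, map_smul, LinearMap.sub_apply, LinearMap.smul_apply, smul_eq_mul, hpp, h2]
    field_simp
    ring

/-- If every vector were isotropic, polarization would make the whole space isotropic, against the
dimension bound. A non-isotropic vector is rescaled by a square root. -/
theorem exists_unit (h : IsQuad B (n + 1)) : ∃ v, B v v = 1 := by
  by_contra! hc
  have h0 : ∀ v, B v v = 0 := by
    intro v
    by_contra hv
    obtain ⟨c, hc2⟩ := IsAlgClosed.exists_pow_nat_eq (B v v)⁻¹ (n := 2) (by norm_num)
    apply hc (c • v)
    simp only [map_smul, LinearMap.smul_apply, smul_eq_mul]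
    rw [← mul_assoc, ← pow_two, hc2, inv_mul_cancel₀ hv]
  have h1 := h.two_mul_finrank_le (S := ⊤) (fun x _ y _ => by
    have h2 := h0 (x + y)
    have h3 := h.symm y x
    simp only [map_add, LinearMap.add_apply, h0, h3] at h2
    linear_combination h2 / 2)
  rw [finrank_top, h.dim] at h1
  omega

/-- Splitting off a unit vector. -/
theorem exists_unit_split (h : IsQuad B (n + 1)) {v : V} (hv : B v v = 1) :
    IsQuad (B.restrict (LinearMap.ker (B v))) n ∧
    ∃ Φ : (LinearMap.ker (B v) × ℂ) ≃ₗ[ℂ] V, (∀ x a, Φ (x, a) = x.1 + a • v) ∧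
      ∀ x a y b, B (Φ (x, a)) (Φ (y, b)) = B x.1 y.1 + a * b := by
  have := h.fin
  have hd : finrank ℂ (LinearMap.ker (B v)) = n := by
    have h1 := finrank_inf_ker_add_one ⊤ (B v) (u := v) trivial (by simp [hv])
    rw [top_inf_eq, finrank_top, h.dim] at h1
    omega
  let f : (LinearMap.ker (B v) × ℂ) →ₗ[ℂ] V :=
    (LinearMap.ker (B v)).subtype.coprod (LinearMap.toSpanSingleton ℂ V v)
  have hf : ∀ x a, f (x, a) = x.1 + a • v := fun x a => by simp [f]
  have hinj : Function.Injective f := by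
    rw [← LinearMap.ker_eq_bot, LinearMap.ker_eq_bot']
    rintro ⟨⟨x, hx⟩, a⟩ h0
    rw [hf] at h0
    have h1 := congrArg (B v) h0
    rw [LinearMap.mem_ker] at hx
    simp [hx, hv] at h1
    subst h1
    simpa using h0
  have hsurj : Function.Surjective f := by
    rw [← LinearMap.injective_iff_surjective_of_finrank_eq_finrank]
    · exact hinj
    · rw [finrank_prod, hd, Module.finrank_self, h.dim]
  refine ⟨⟨inferInstance, fun x y => h.symm _ _, fun x hx => ?_, hd⟩,
    LinearEquiv.ofBijective f ⟨hinj, hsurj⟩, hf, fun x a y b => ?_⟩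
  swap
  · have h1 : B x.1 v = 0 := (h.symm _ _).trans x.2
    have h2 : B v y.1 = 0 := y.2
    change B (f (x, a)) (f (y, b)) = _
    simp [hf, h1, h2, hv]
  apply Subtype.ext
  apply h.nondeg
  intro y
  obtain ⟨⟨z, a⟩, rfl⟩ := hsurj y
  have h1 : B x.1 v = 0 := by rw [h.symm]; exact x.2
  rw [hf, map_add, map_smul, h1, smul_zero, add_zero]
  exact hx z

/-- Splitting off a hyperbolic pair. -/
theorem exists_hyperbolic_split (h : IsQuad B (n + 2)) {p q : V} (hp : B p p = 0) (hq : B q q = 0)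
    (hpq : B p q = 1) :
    IsQuad (B.restrict (LinearMap.ker (B p) ⊓ LinearMap.ker (B q))) n ∧
    ∃ Φ : ((LinearMap.ker (B p) ⊓ LinearMap.ker (B q) : Submodule ℂ V) × ℂ × ℂ) ≃ₗ[ℂ] V,
      (∀ x a b, Φ (x, a, b) = x.1 + a • p + b • q) ∧
      ∀ x a b y c d, B (Φ (x, a, b)) (Φ (y, c, d)) = B x.1 y.1 + a * d + b * c := by
  have := h.fin
  have hqp : B q p = 1 := by rw [h.symm, hpq]
  set W : Submodule ℂ V := LinearMap.ker (B p) ⊓ LinearMap.ker (B q) with hW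
  have hd : finrank ℂ W = n := by
    rw [hW]
    have h1 := finrank_inf_ker_add_one ⊤ (B p) (u := q) trivial (by simp [hpq])
    have h2 := finrank_inf_ker_add_one (LinearMap.ker (B p)) (B q) (u := p)
      (by simp [hp]) (by simp [hqp])
    rw [top_inf_eq, finrank_top, h.dim] at h1
    omega
  let f : (W × ℂ × ℂ) →ₗ[ℂ] V := W.subtype.coprod
    ((LinearMap.toSpanSingleton ℂ V p).coprod (LinearMap.toSpanSingleton ℂ V q))
  have hf : ∀ x a b, f (x, a, b) = x.1 + a • p + b • q := fun x a b => by simp [f, add_assoc]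
  have hinj : Function.Injective f := by
    rw [← LinearMap.ker_eq_bot, LinearMap.ker_eq_bot']
    rintro ⟨⟨x, hx⟩, a, b⟩ h0
    rw [hf] at h0
    have h1 := congrArg (B p) h0
    have h2 := congrArg (B q) h0
    rw [hW, Submodule.mem_inf, LinearMap.mem_ker, LinearMap.mem_ker] at hx
    simp [hx.1, hp, hpq] at h1
    simp [hx.2, hq, hqp] at h2
    subst h1 h2
    simpa using h0
  have hsurj : Function.Surjective f := by
    rw [← LinearMap.injective_iff_surjective_of_finrank_eq_finrank]
    · exact hinj
    · rw [finrank_prod, finrank_prod, hd, Module.finrank_self, h.dim]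
  refine ⟨⟨inferInstance, fun x y => h.symm _ _, fun x hx => ?_, hd⟩,
    LinearEquiv.ofBijective f ⟨hinj, hsurj⟩, hf, fun x a b y c d => ?_⟩
  swap
  · have h1 : B x.1 p = 0 := (h.symm _ _).trans x.2.1
    have h2 : B x.1 q = 0 := (h.symm _ _).trans x.2.2
    have h3 : B p y.1 = 0 := y.2.1
    have h4 : B q y.1 = 0 := y.2.2
    change B (f (x, a, b)) (f (y, c, d)) = _
    simp [hf, h1, h2, h3, h4, hp, hq, hpq, hqp]
  apply Subtype.ext
  apply h.nondeg
  intro y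
  obtain ⟨⟨z, a, b⟩, rfl⟩ := hsurj y
  have h1 : B x.1 p = 0 := by rw [h.symm]; exact x.2.1
  have h2 : B x.1 q = 0 := by rw [h.symm]; exact x.2.2
  rw [hf, map_add, map_add, map_smul, map_smul, h1, h2, smul_zero, smul_zero, add_zero, add_zero]
  exact hx z

end IsQuad

/-! ### Isotropic flags and their reduction modulo the first line -/

namespace IsFlag

variable {B : LinearMap.BilinForm ℂ V} {E : ℕ → Submodule ℂ V} {l n : ℕ}

theorem zero_eq_bot [FiniteDimensional ℂ V] (h : IsFlag B E l) : E 0 = ⊥ := by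
  rw [← Submodule.finrank_eq_zero, h.dim, Nat.zero_min]

theorem eq_of_le [FiniteDimensional ℂ V] (h : IsFlag B E l) {i : ℕ} (hi : l ≤ i) : E i = E l := by
  symm
  apply Submodule.eq_of_le_of_finrank_eq (h.mono hi)
  rw [h.dim, h.dim]
  omega

theorem exists_line (h : IsFlag B E (l + 1)) :
    ∃ p, p ≠ 0 ∧ B p p = 0 ∧ ∀ x, x ∈ E 1 ↔ ∃ a : ℂ, x = a • p := by
  have h1 := h.dim 1
  rw [min_eq_left (by omega)] at h1
  obtain ⟨⟨p, hp⟩, hp0, hp1⟩ := finrank_eq_one_iff'.1 h1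
  refine ⟨p, fun h0 => hp0 (Subtype.ext h0), h.iso 1 p hp p hp, fun x => ⟨fun hx => ?_, ?_⟩⟩
  · obtain ⟨a, ha⟩ := hp1 ⟨x, hx⟩
    exact ⟨a, (congrArg Subtype.val ha).symm⟩
  · rintro ⟨a, rfl⟩
    exact Submodule.smul_mem _ _ hp

/-- The flag induced on the orthogonal complement of a hyperbolic pair whose first member spans the
first step. -/
theorem reduce (hB : IsQuad B n) (h : IsFlag B E (l + 1)) {p q : V} (hp : p ∈ E 1)
    (hpq : B p q = 1) :
    IsFlag (B.restrict (LinearMap.ker (B p) ⊓ LinearMap.ker (B q)))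
      (fun i => (E (i + 1)).comap (LinearMap.ker (B p) ⊓ LinearMap.ker (B q)).subtype) l := by
  have := hB.fin
  refine ⟨fun i j hij => Submodule.comap_mono (h.mono (by omega)),
    fun i x hx y hy => h.iso _ _ hx _ hy, fun i => ?_⟩
  have hp' : p ∈ E (i + 1) := h.mono (by omega) hp
  rw [finrank_comap_subtype]
  have h1 := finrank_inf_ker_add_one (E (i + 1)) (B q) hp' (by rw [hB.symm, hpq]; exact one_ne_zero)
  have h2 : E (i + 1) ⊓ (LinearMap.ker (B p) ⊓ LinearMap.ker (B q))
      = E (i + 1) ⊓ LinearMap.ker (B q) := by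
    ext x
    simp only [Submodule.mem_inf, LinearMap.mem_ker]
    exact ⟨fun hx => ⟨hx.1, hx.2.2⟩, fun hx => ⟨hx.1, h.iso _ _ hp' _ hx.1, hx.2⟩⟩
  rw [h.dim] at h1
  rw [h2]
  omega

/-- Pairing with `p`, itself in the isotropic space `E i`, reads off the coefficient of `q` and
forces it to vanish; the multiple of `p` is then harmless. -/
theorem mem_reduce_iff (h : IsFlag B E l) {p q x : V} {i : ℕ} (hp : p ∈ E i)
    (hpp : B p p = 0) (hpq : B p q = 1) (hx : B p x = 0) (a b : ℂ) :
    x + a • p + b • q ∈ E i ↔ x ∈ E i ∧ b = 0 := by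
  constructor
  · intro hm
    have h1 := h.iso _ _ hp _ hm
    simp [hx, hpp, hpq] at h1
    subst h1
    refine ⟨?_, rfl⟩
    rw [zero_smul, add_zero] at hm
    simpa using Submodule.sub_mem _ hm (Submodule.smul_mem _ a hp)
  · rintro ⟨h1, rfl⟩
    rw [zero_smul, add_zero]
    exact Submodule.add_mem _ h1 (Submodule.smul_mem _ a hp)

end IsFlag

/-- An isometry between quadratic spaces of the same dimension is invertible. -/
theorem exists_equiv_of_isometry {W : Type*} [AddCommGroup W] [Module ℂ W]
    {B : LinearMap.BilinForm ℂ V} {B' : LinearMap.BilinForm ℂ W} {n : ℕ} (hB : IsQuad B n)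
    (hB' : IsQuad B' n) (f : V →ₗ[ℂ] W) (hf : ∀ x y, B' (f x) (f y) = B x y) :
    ∃ φ : V ≃ₗ[ℂ] W, ∀ x, φ x = f x := by
  have := hB.fin
  have := hB'.fin
  have hinj : Function.Injective f := by
    rw [← LinearMap.ker_eq_bot, LinearMap.ker_eq_bot']
    intro x hx
    apply hB.nondeg
    intro y
    rw [← hf, hx, map_zero, LinearMap.zero_apply]
  exact ⟨LinearEquiv.ofInjectiveOfFinrankEq f hinj (by rw [hB.dim, hB'.dim]), fun x => rfl⟩

/-- A linear equivalence that maps a subspace into one of the same dimension maps it onto. -/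
theorem mem_iff_of_finrank_eq {W : Type*} [AddCommGroup W] [Module ℂ W] [FiniteDimensional ℂ V]
    [FiniteDimensional ℂ W] (φ : V ≃ₗ[ℂ] W) {S : Submodule ℂ V} {T : Submodule ℂ W}
    (h : ∀ x ∈ S, φ x ∈ T) (hd : finrank ℂ S = finrank ℂ T) (x : V) : φ x ∈ T ↔ x ∈ S := by
  have h1 : S.map (φ : V →ₗ[ℂ] W) = T := by
    apply Submodule.eq_of_le_of_finrank_eq
    · rintro _ ⟨y, hy, rfl⟩
      exact h y hy
    · rw [← hd]
      exact LinearEquiv.finrank_map_eq φ S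
  rw [← h1]
  constructor
  · rintro ⟨y, hy, hxy⟩
    rwa [← φ.injective hxy]
  · exact fun hx => ⟨x, hx, rfl⟩

end QuadraticSpaces

/-- Full isotropic flags in quadratic spaces of the same dimension are isometric. -/
theorem exists_isometry_flag (n : ℕ) : ∀ (V W : Type) [AddCommGroup V] [Module ℂ V]
    [AddCommGroup W] [Module ℂ W] (B : LinearMap.BilinForm ℂ V) (B' : LinearMap.BilinForm ℂ W)
    (E : ℕ → Submodule ℂ V) (E' : ℕ → Submodule ℂ W), IsQuad B n → IsQuad B' n →
    IsFlag B E (n / 2) → IsFlag B' E' (n / 2) →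
    ∃ φ : V ≃ₗ[ℂ] W, (∀ x y, B' (φ x) (φ y) = B x y) ∧ ∀ i x, φ x ∈ E' i ↔ x ∈ E i := by
  induction n using Nat.twoStepInduction with
  | zero =>
    intro V W _ _ _ _ B B' E E' hB hB' hE hE'
    have := hB.fin
    have := hB'.fin
    obtain ⟨φ, -⟩ := exists_equiv_of_isometry hB hB' 0 (fun x y => by
      have : Subsingleton V := finrank_zero_iff.1 hB.dim
      simp [Subsingleton.elim x 0])
    have : Subsingleton V := finrank_zero_iff.1 hB.dim
    exact ⟨φ, fun x y => by simp [Subsingleton.elim x 0],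
      fun i x => by simp [Subsingleton.elim x 0]⟩
  | one =>
    intro V W _ _ _ _ B B' E E' hB hB' hE hE'
    have := hB.fin
    have := hB'.fin
    obtain ⟨v, hv⟩ := hB.exists_unit
    obtain ⟨w, hw⟩ := hB'.exists_unit
    have hv0 : ∀ x, ∃ a : ℂ, a • v = x := by
      apply (finrank_eq_one_iff_of_nonzero' v ?_).1 hB.dim
      rintro rfl
      simp at hv
    have key : ∀ x y, B x y = B v x * B v y := by
      intro x y
      obtain ⟨a, rfl⟩ := hv0 x
      obtain ⟨b, rfl⟩ := hv0 y
      simp [hv, mul_comm]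
    obtain ⟨φ, hφ⟩ := exists_equiv_of_isometry hB hB' ((B v).smulRight w) (fun x y => by
      rw [key x y]
      simp [hw, mul_comm])
    refine ⟨φ, fun x y => by rw [hφ, hφ, key x y]; simp [hw, mul_comm], fun i => ?_⟩
    apply mem_iff_of_finrank_eq
    · have : E i = ⊥ := by
        rw [← Submodule.finrank_eq_zero, hE.dim]
        omega
      intro x hx
      rw [this, Submodule.mem_bot] at hx
      simp [hx]
    · rw [hE.dim, hE'.dim]
  | more n ih _ =>
    intro V W _ _ _ _ B B' E E' hB hB' hE hE'
    have := hB.fin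
    have := hB'.fin
    rw [show (n + 2) / 2 = n / 2 + 1 by omega] at hE hE'
    obtain ⟨p, hp0, hpp, hpE⟩ := hE.exists_line
    obtain ⟨p', hp0', hpp', hpE'⟩ := hE'.exists_line
    -- Each first line is completed to a hyperbolic pair. The isometry of the complements given by
    -- induction is extended by matching the two pairs.
    obtain ⟨q, -, hpq, hqq⟩ := hB.exists_partner (S := ⊥) (p := p) (by simpa using hp0) hpp
      (by simp)
    obtain ⟨q', -, hpq', hqq'⟩ := hB'.exists_partner (S := ⊥) (p := p') (by simpa using hp0') hpp'
      (by simp)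
    have hp1 : p ∈ E 1 := (hpE p).2 ⟨1, by simp⟩
    have hp1' : p' ∈ E' 1 := (hpE' p').2 ⟨1, by simp⟩
    obtain ⟨hQ, Φ, hΦ, hΦB⟩ := hB.exists_hyperbolic_split hpp hqq hpq
    obtain ⟨hQ', Φ', hΦ', hΦB'⟩ := hB'.exists_hyperbolic_split hpp' hqq' hpq'
    obtain ⟨ψ, hψ1, hψ2⟩ := ih _ _ _ _ _ _ hQ hQ' (hE.reduce hB hp1 hpq) (hE'.reduce hB' hp1' hpq')
    refine ⟨Φ.symm ≪≫ₗ (ψ.prodCongr (LinearEquiv.refl ℂ (ℂ × ℂ))) ≪≫ₗ Φ', fun x y => ?_,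
      fun i x => ?_⟩
    · obtain ⟨⟨x, a, b⟩, rfl⟩ := Φ.surjective x
      obtain ⟨⟨y, c, d⟩, rfl⟩ := Φ.surjective y
      have h1 := hψ1 x y
      simp only [LinearEquiv.trans_apply, LinearEquiv.symm_apply_apply,
        LinearEquiv.prodCongr_apply, LinearEquiv.refl_apply, hΦB, hΦB']
      rw [show B' (ψ x).1 (ψ y).1 = B x.1 y.1 from h1]
    · obtain ⟨⟨x, a, b⟩, rfl⟩ := Φ.surjective x
      rcases i with _ | i
      · rw [hE.zero_eq_bot, hE'.zero_eq_bot]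
        simp
      · have h1 := hE.mem_reduce_iff (hE.mono (by omega : 1 ≤ i + 1) hp1) hpp hpq x.2.1 a b
        have h2 := hE'.mem_reduce_iff (hE'.mono (by omega : 1 ≤ i + 1) hp1') hpp' hpq'
          (ψ x).2.1 a b
        have h3 := hψ2 i x
        simp only [Submodule.mem_comap, Submodule.subtype_apply] at h3
        simp only [LinearEquiv.trans_apply, LinearEquiv.symm_apply_apply,
          LinearEquiv.prodCongr_apply, LinearEquiv.refl_apply]
        rw [hΦ, hΦ', h1, h2, h3]

end OrthoCount

namespace OrthoCount

open Module

/-! ### Configurations: a unit vector, a flag in its complement, and a flag -/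

/-- A complex space with a bilinear form, a vector and two sequences of subspaces. -/
structure Config where
  V : Type
  [grp : AddCommGroup V]
  [mod : Module ℂ V]
  B : LinearMap.BilinForm ℂ V
  v : V
  F : ℕ → Submodule ℂ V
  E : ℕ → Submodule ℂ V

attribute [instance] Config.grp Config.mod

namespace Config

/-- The quadratic space has dimension `k + 1`, the vector is a unit vector, `F` is a full isotropic
flag in its orthogonal complement, and `E` is a full isotropic flag. -/
structure Valid (k : ℕ) (C : Config) : Prop where
  quad : IsQuad C.B (k + 1)
  unit : C.B C.v C.v = 1
  flagF : IsFlag C.B C.F (k / 2)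
  perp : ∀ i, ∀ x ∈ C.F i, C.B C.v x = 0
  flagE : IsFlag C.B C.E ((k + 1) / 2)

/-- Isometry of configurations. -/
def Iso (C C' : Config) : Prop :=
  ∃ φ : C.V ≃ₗ[ℂ] C'.V, (∀ x y, C'.B (φ x) (φ y) = C.B x y) ∧ φ C.v = C'.v ∧
    (∀ i x, φ x ∈ C'.F i ↔ x ∈ C.F i) ∧ ∀ i x, φ x ∈ C'.E i ↔ x ∈ C.E i

theorem Iso.trans {C C' C'' : Config} : Iso C C' → Iso C' C'' → Iso C C'' := by
  rintro ⟨φ, h1, h2, h3, h4⟩ ⟨φ', h1', h2', h3', h4'⟩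
  refine ⟨φ ≪≫ₗ φ', fun x y => ?_, ?_, fun i x => ?_, fun i x => ?_⟩
  · simp only [LinearEquiv.trans_apply, h1', h1]
  · simp only [LinearEquiv.trans_apply, h2', h2]
  · simp only [LinearEquiv.trans_apply, h3', h3]
  · simp only [LinearEquiv.trans_apply, h4', h4]

/-- Inclusions suffice for an isometry of valid configurations. -/
theorem Iso.of_linear {k : ℕ} {C C' : Config} (hC : C.Valid k) (hC' : C'.Valid k)
    (f : C.V →ₗ[ℂ] C'.V) (hf : ∀ x y, C'.B (f x) (f y) = C.B x y) (hv : f C.v = C'.v)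
    (hF : ∀ i, ∀ x ∈ C.F i, f x ∈ C'.F i) (hE : ∀ i, ∀ x ∈ C.E i, f x ∈ C'.E i) : Iso C C' := by
  have := hC.quad.fin
  have := hC'.quad.fin
  obtain ⟨φ, hφ⟩ := exists_equiv_of_isometry hC.quad hC'.quad f hf
  refine ⟨φ, fun x y => by rw [hφ, hφ, hf], by rw [hφ, hv], fun i => ?_, fun i => ?_⟩
  · exact mem_iff_of_finrank_eq φ (fun x hx => by rw [hφ]; exact hF i x hx)
      (by rw [hC.flagF.dim, hC'.flagF.dim])
  · exact mem_iff_of_finrank_eq φ (fun x hx => by rw [hφ]; exact hE i x hx)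
      (by rw [hC.flagE.dim, hC'.flagE.dim])

/-- In dimension one both flags are zero and `v` spans, so sending unit vector to unit vector is the
isometry. -/
theorem valid_zero_iso {C C' : Config} (hC : C.Valid 0) (hC' : C'.Valid 0) : Iso C C' := by
  have := hC.quad.fin
  have := hC'.quad.fin
  have hv0 : ∀ x, ∃ a : ℂ, a • C.v = x := by
    apply (finrank_eq_one_iff_of_nonzero' C.v ?_).1 hC.quad.dim
    intro h0
    have := hC.unit
    simp [h0] at this
  have key : ∀ x y, C.B x y = C.B C.v x * C.B C.v y := by
    intro x y
    obtain ⟨a, rfl⟩ := hv0 x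
    obtain ⟨b, rfl⟩ := hv0 y
    simp [hC.unit, mul_comm]
  refine Iso.of_linear hC hC' ((C.B C.v).smulRight C'.v) (fun x y => ?_) ?_ (fun i x hx => ?_)
    (fun i x hx => ?_)
  · rw [key x y]
    simp [hC'.unit, mul_comm]
  · simp [hC.unit]
  · have h0 : C.F i = ⊥ := by rw [← Submodule.finrank_eq_zero, hC.flagF.dim]; omega
    rw [h0, Submodule.mem_bot] at hx
    simp [hx]
  · have h0 : C.E i = ⊥ := by rw [← Submodule.finrank_eq_zero, hC.flagE.dim]; omega
    rw [h0, Submodule.mem_bot] at hx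
    simp [hx]

/-! #### The first step of `E` is not orthogonal to `v` -/

/-- `C` arises from `C₀` by adjoining an orthogonal unit vector `v`: the flag `E` of `C₀` becomes
`F`, and `F` becomes `E` after prefixing the isotropic line of `v + I v₀`. -/
def UpRel (C₀ C : Config) : Prop :=
  ∃ Φ : (C₀.V × ℂ) ≃ₗ[ℂ] C.V, (∀ x a y b, C.B (Φ (x, a)) (Φ (y, b)) = C₀.B x y + a * b) ∧
    Φ (0, 1) = C.v ∧ (∀ i x a, Φ (x, a) ∈ C.F i ↔ x ∈ C₀.E i ∧ a = 0) ∧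
    ∀ i x a, Φ (x, a) ∈ C.E (i + 1) ↔ x - (a * Complex.I) • C₀.v ∈ C₀.F i

theorem UpRel.iso_right {C₀ C C' : Config} (h : UpRel C₀ C) (hi : Iso C C') : UpRel C₀ C' := by
  obtain ⟨Φ, h1, h2, h3, h4⟩ := h
  obtain ⟨φ, g1, g2, g3, g4⟩ := hi
  refine ⟨Φ ≪≫ₗ φ, fun x a y b => ?_, ?_, fun i x a => ?_, fun i x a => ?_⟩
  · simp only [LinearEquiv.trans_apply, g1, h1]
  · simp only [LinearEquiv.trans_apply, g2, h2]
  · simp only [LinearEquiv.trans_apply, g3, h3]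
  · simp only [LinearEquiv.trans_apply, g4, h4]

/-- The relation expresses all data of `C` through those of `C₀`, so an isometry downstairs extends
by the identity on the added line. Only `E 0`, absent from `UpRel`, is treated separately: it is
zero. -/
theorem UpRel.congr {k : ℕ} {C₀ C C₀' C' : Config} (hC : C.Valid k) (hC' : C'.Valid k)
    (h : UpRel C₀ C) (h' : UpRel C₀' C') (hi : Iso C₀ C₀') : Iso C C' := by
  have := hC.quad.fin
  have := hC'.quad.fin
  obtain ⟨Φ, h1, h2, h3, h4⟩ := h
  obtain ⟨Φ', h1', h2', h3', h4'⟩ := h'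
  obtain ⟨φ, g1, g2, g3, g4⟩ := hi
  have hΨ : ∀ x a, (Φ.symm ≪≫ₗ φ.prodCongr (LinearEquiv.refl ℂ ℂ) ≪≫ₗ Φ') (Φ (x, a))
      = Φ' (φ x, a) := fun x a => by
    simp only [LinearEquiv.trans_apply, LinearEquiv.symm_apply_apply, LinearEquiv.prodCongr_apply,
      LinearEquiv.refl_apply]
  refine ⟨Φ.symm ≪≫ₗ (φ.prodCongr (LinearEquiv.refl ℂ ℂ)) ≪≫ₗ Φ', fun x y => ?_, ?_, fun i x => ?_,
    fun i x => ?_⟩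
  · obtain ⟨⟨x, a⟩, rfl⟩ := Φ.surjective x
    obtain ⟨⟨y, b⟩, rfl⟩ := Φ.surjective y
    rw [hΨ, hΨ, h1, h1', g1]
  · rw [← h2, hΨ, map_zero, h2']
  · obtain ⟨⟨x, a⟩, rfl⟩ := Φ.surjective x
    rw [hΨ, h3, h3', g4]
  · obtain ⟨⟨x, a⟩, rfl⟩ := Φ.surjective x
    rw [hΨ]
    rcases i with _ | i
    · rw [hC.flagE.zero_eq_bot, hC'.flagE.zero_eq_bot]
      simp
    · rw [h4, h4', ← g3, ← g2, map_sub, map_smul]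

/-- `C₀` can be recovered from `C`: its space is the complement of `v`, its vector comes from the
line `E 1`, and its flags are read off from `F` and `E`. -/
theorem UpRel.cancel {k : ℕ} {C₀ C C₀' : Config} (hC₀ : C₀.Valid k) (hC₀' : C₀'.Valid k)
    (h : UpRel C₀ C) (h' : UpRel C₀' C) : Iso C₀ C₀' := by
  obtain ⟨Φ, h1, h2, h3, h4⟩ := h
  obtain ⟨Φ', h1', h2', h3', h4'⟩ := h'
  -- The last coordinate is the pairing with `v` in both descriptions, so the vectors with last
  -- coordinate 0 agree.
  have key : ∀ x, Φ (x, 0) = Φ' ((Φ'.symm (Φ (x, 0))).1, 0) := by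
    intro x
    obtain ⟨y, b, hy⟩ : ∃ y b, Φ (x, 0) = Φ' (y, b) := ⟨_, _, (Φ'.apply_symm_apply _).symm⟩
    have hb : b = 0 := by
      have e1 := h1 x 0 0 1
      have e2 := h1' y b 0 1
      rw [h2, hy] at e1
      rw [h2'] at e2
      simp at e1 e2
      rw [← e2, e1]
    rw [hy, hb, Φ'.symm_apply_apply]
  let f : C₀.V →ₗ[ℂ] C₀'.V :=
    LinearMap.fst ℂ _ _ ∘ₗ Φ'.symm.toLinearMap ∘ₗ Φ.toLinearMap ∘ₗ LinearMap.inl ℂ _ _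
  have hf : ∀ x, Φ (x, 0) = Φ' (f x, 0) := key
  have hΦ : ∀ x a, Φ (x, a) = Φ' (f x, a) := by
    intro x a
    have e1 : Φ (x, a) = Φ (x, 0) + a • Φ (0, 1) := by rw [← map_smul, ← map_add]; simp
    have e2 : Φ' (f x, a) = Φ' (f x, 0) + a • Φ' (0, 1) := by rw [← map_smul, ← map_add]; simp
    rw [e1, e2, hf, h2, h2']
  have hv : f C₀.v = C₀'.v := by
    -- For a = -I one has a * I = 1, so this vector satisfies the criterion for `E 1` with 0 ∈ `F
    -- 0`; it spans that line.
    have e1 : Φ (C₀.v, -Complex.I) ∈ C.E 1 := by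
      rw [h4]
      simp
    rw [hΦ, h4'] at e1
    have := hC₀'.quad.fin
    rw [hC₀'.flagF.zero_eq_bot, Submodule.mem_bot] at e1
    simpa [sub_eq_zero] using e1
  refine Iso.of_linear hC₀ hC₀' f (fun x y => ?_) hv (fun i x hx => ?_) (fun i x hx => ?_)
  · have e1 := h1 x 0 y 0
    rw [hΦ, hΦ, h1'] at e1
    simpa using e1
  · have e1 := (h4 i x 0).2 (by simpa using hx)
    rw [hΦ, h4'] at e1
    simpa using e1
  · have e1 := (h3 i x 0).2 ⟨hx, rfl⟩
    rw [hΦ, h3'] at e1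
    exact e1.1

/-! #### The first step of `E` is orthogonal to `v` -/

/-- `C` arises from `C₀` by adjoining an orthogonal hyperbolic pair `p, q`: the flag `E` is prefixed
with the line of `p`, and `p` (if `ε`) or `q` (if not) is inserted in `F` after step `j`. -/
def InsRel (j : ℕ) (ε : Bool) (C₀ C : Config) : Prop :=
  ∃ Φ : (C₀.V × ℂ × ℂ) ≃ₗ[ℂ] C.V,
    (∀ x a b y c d, C.B (Φ (x, a, b)) (Φ (y, c, d)) = C₀.B x y + a * d + b * c) ∧
    Φ (C₀.v, 0, 0) = C.v ∧
    (∀ i ≤ j, ∀ x a b, Φ (x, a, b) ∈ C.F i ↔ x ∈ C₀.F i ∧ a = 0 ∧ b = 0) ∧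
    (∀ i ≥ j, ∀ x a b, Φ (x, a, b) ∈ C.F (i + 1) ↔ x ∈ C₀.F i ∧ (bif ε then b else a) = 0) ∧
    ∀ i x a b, Φ (x, a, b) ∈ C.E (i + 1) ↔ x ∈ C₀.E i ∧ b = 0

theorem InsRel.iso_right {j : ℕ} {ε : Bool} {C₀ C C' : Config} (h : InsRel j ε C₀ C)
    (hi : Iso C C') : InsRel j ε C₀ C' := by
  obtain ⟨Φ, h1, h2, h3, h4, h5⟩ := h
  obtain ⟨φ, g1, g2, g3, g4⟩ := hi
  refine ⟨Φ ≪≫ₗ φ, fun x a b y c d => ?_, ?_, fun i hi x a b => ?_, fun i hi x a b => ?_,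
    fun i x a b => ?_⟩
  · simp only [LinearEquiv.trans_apply, g1, h1]
  · simp only [LinearEquiv.trans_apply, g2, h2]
  · simp only [LinearEquiv.trans_apply, g3, h3 i hi]
  · simp only [LinearEquiv.trans_apply, g3, h4 i hi]
  · simp only [LinearEquiv.trans_apply, g4, h5]

theorem InsRel.congr {k j : ℕ} {ε : Bool} {C₀ C C₀' C' : Config} (hC : C.Valid k)
    (hC' : C'.Valid k) (h : InsRel j ε C₀ C) (h' : InsRel j ε C₀' C') (hi : Iso C₀ C₀') :
    Iso C C' := by
  have := hC.quad.fin
  have := hC'.quad.fin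
  obtain ⟨Φ, h1, h2, h3, h4, h5⟩ := h
  obtain ⟨Φ', h1', h2', h3', h4', h5'⟩ := h'
  obtain ⟨φ, g1, g2, g3, g4⟩ := hi
  have hΨ : ∀ x a b, (Φ.symm ≪≫ₗ φ.prodCongr (LinearEquiv.refl ℂ (ℂ × ℂ)) ≪≫ₗ Φ') (Φ (x, a, b))
      = Φ' (φ x, a, b) := fun x a b => by
    simp only [LinearEquiv.trans_apply, LinearEquiv.symm_apply_apply, LinearEquiv.prodCongr_apply,
      LinearEquiv.refl_apply]
  refine ⟨Φ.symm ≪≫ₗ (φ.prodCongr (LinearEquiv.refl ℂ (ℂ × ℂ))) ≪≫ₗ Φ', fun x y => ?_, ?_,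
    fun i x => ?_, fun i x => ?_⟩
  · obtain ⟨⟨x, a, b⟩, rfl⟩ := Φ.surjective x
    obtain ⟨⟨y, c, d⟩, rfl⟩ := Φ.surjective y
    rw [hΨ, hΨ, h1, h1', g1]
  · rw [← h2, hΨ, g2, h2']
  · obtain ⟨⟨x, a, b⟩, rfl⟩ := Φ.surjective x
    rw [hΨ]
    rcases le_or_gt i j with hij | hij
    · rw [h3 i hij, h3' i hij, g3]
    · obtain ⟨i, rfl⟩ := Nat.exists_eq_succ_of_ne_zero (by omega : i ≠ 0)
      rw [h4 i (by omega), h4' i (by omega), g3]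
  · obtain ⟨⟨x, a, b⟩, rfl⟩ := Φ.surjective x
    rw [hΨ]
    rcases i with _ | i
    · rw [hC.flagE.zero_eq_bot, hC'.flagE.zero_eq_bot]
      simp
    · rw [h5, h5', g4]

/-! ### The position of the line `E 1` as an isometry invariant -/

section Invariants

variable {j : ℕ} {ε : Bool} {C₀ C : Config}

/-- The line `E 1` is contained in `F i` precisely for `i > j`, if `ε` holds. -/
theorem InsRel.le_iff {k : ℕ} (hC₀ : C₀.Valid k) (h : InsRel j ε C₀ C) (i : ℕ) :
    C.E 1 ≤ C.F i ↔ ε = true ∧ j < i := by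
  have := hC₀.quad.fin
  obtain ⟨Φ, h1, h2, h3, h4, h5⟩ := h
  have hp : Φ (0, 1, 0) ∈ C.E 1 := by rw [h5]; simp
  constructor
  · intro hle
    have h6 := hle hp
    rcases le_or_gt i j with hij | hij
    · rw [h3 i hij] at h6
      simp at h6
    · obtain ⟨i, rfl⟩ := Nat.exists_eq_succ_of_ne_zero (by omega : i ≠ 0)
      rw [h4 i (by omega)] at h6
      refine ⟨?_, hij⟩
      cases ε
      · simp at h6
      · rfl
  · rintro ⟨rfl, hij⟩ y hy
    obtain ⟨⟨x, a, b⟩, rfl⟩ := Φ.surjective y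
    obtain ⟨i, rfl⟩ := Nat.exists_eq_succ_of_ne_zero (by omega : i ≠ 0)
    rw [h5, hC₀.flagE.zero_eq_bot, Submodule.mem_bot] at hy
    rw [h4 i (by omega), hy.1, hy.2]
    exact ⟨Submodule.zero_mem _, rfl⟩

/-- The line `E 1` is orthogonal to `F i` precisely for `i ≤ j`, unless `ε` holds. -/
theorem InsRel.perp_iff {k : ℕ} (hC₀ : C₀.Valid k) (h : InsRel j ε C₀ C) (i : ℕ) :
    (∀ x ∈ C.E 1, ∀ y ∈ C.F i, C.B x y = 0) ↔ ε = true ∨ i ≤ j := by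
  have := hC₀.quad.fin
  obtain ⟨Φ, h1, h2, h3, h4, h5⟩ := h
  have hp : Φ (0, 1, 0) ∈ C.E 1 := by rw [h5]; simp
  constructor
  · intro hle
    rcases le_or_gt i j with hij | hij
    · exact Or.inr hij
    · obtain ⟨i, rfl⟩ := Nat.exists_eq_succ_of_ne_zero (by omega : i ≠ 0)
      cases ε
      · have h6 := hle _ hp (Φ (0, 0, 1)) (by rw [h4 i (by omega)]; simp)
        rw [h1] at h6
        simp at h6
      · exact Or.inl rfl
  · intro h6 x hx y hy
    obtain ⟨⟨x, a, b⟩, rfl⟩ := Φ.surjective x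
    obtain ⟨⟨y, c, d⟩, rfl⟩ := Φ.surjective y
    rw [h5, hC₀.flagE.zero_eq_bot, Submodule.mem_bot] at hx
    rw [h1, hx.1, hx.2]
    rcases le_or_gt i j with hij | hij
    · rw [h3 i hij] at hy
      simp [hy.2.2]
    · obtain ⟨i, rfl⟩ := Nat.exists_eq_succ_of_ne_zero (by omega : i ≠ 0)
      rw [h4 i (by omega)] at hy
      rcases h6 with rfl | h6
      · simp at hy
        simp [hy.2]
      · omega

/-- Containment of `E 1` in `F i` and orthogonality of the two are intrinsic to `C`. The values of
`i` at which they change reveal `j` and `ε`. -/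
theorem InsRel.index_eq {k j' : ℕ} {ε' : Bool} {C₀' : Config} (hC₀ : C₀.Valid k)
    (hC₀' : C₀'.Valid k) (h : InsRel j ε C₀ C) (h' : InsRel j' ε' C₀' C) : j = j' ∧ ε = ε' := by
  have a1 := fun i => (h.le_iff hC₀ i).symm.trans (h'.le_iff hC₀' i)
  have a2 := fun i => (h.perp_iff hC₀ i).symm.trans (h'.perp_iff hC₀' i)
  cases ε <;> cases ε' <;> simp at a1 a2 ⊢
  · exact le_antisymm ((a2 j).1 le_rfl) ((a2 j').2 le_rfl)
  · exact absurd (a1 (j' + 1)) (by omega)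
  · exact absurd (a1 (j + 1)) (by omega)
  · have b1 := a1 (j + 1)
    have b2 := a1 (j' + 1)
    omega

/-- The line of `p` is intrinsic but its partner `q` is not. The space of `C₀` is therefore
identified with p^⊥/⟨p⟩: `f` ignores the component `g` along the second `p`, which affects neither
the form nor the flag conditions used. -/
theorem InsRel.cancel {k : ℕ} {C₀' : Config} (hC₀ : C₀.Valid k) (hC₀' : C₀'.Valid k)
    (h : InsRel j ε C₀ C) (h' : InsRel j ε C₀' C) : Iso C₀ C₀' := by
  have := hC₀.quad.fin
  have := hC₀'.quad.fin
  obtain ⟨Φ, h1, h2, h3, h4, h5⟩ := h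
  obtain ⟨Φ', h1', h2', h3', h4', h5'⟩ := h'
  -- the two vectors `p` are proportional
  obtain ⟨c, hc⟩ : ∃ c : ℂ, Φ' (0, 1, 0) = Φ (0, c, 0) := by
    obtain ⟨⟨x, a, b⟩, hx⟩ := Φ.surjective (Φ' (0, 1, 0))
    have e1 : Φ' (0, 1, 0) ∈ C.E 1 := by rw [h5']; simp
    rw [← hx, h5, hC₀.flagE.zero_eq_bot, Submodule.mem_bot] at e1
    exact ⟨a, by rw [← hx, e1.1, e1.2]⟩
  let f : C₀.V →ₗ[ℂ] C₀'.V :=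
    LinearMap.fst ℂ _ _ ∘ₗ Φ'.symm.toLinearMap ∘ₗ Φ.toLinearMap ∘ₗ LinearMap.inl ℂ _ _
  let g : C₀.V →ₗ[ℂ] ℂ :=
    LinearMap.fst ℂ _ _ ∘ₗ LinearMap.snd ℂ _ _ ∘ₗ Φ'.symm.toLinearMap ∘ₗ Φ.toLinearMap ∘ₗ
      LinearMap.inl ℂ _ _
  have hf : ∀ x, Φ (x, 0, 0) = Φ' (f x, g x, 0) := by
    intro x
    obtain ⟨⟨y, a, b⟩, hy⟩ := Φ'.surjective (Φ (x, 0, 0))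
    have hf : f x = y := by
      change (Φ'.symm (Φ (x, 0, 0))).1 = y
      rw [← hy, Φ'.symm_apply_apply]
    have hg : g x = a := by
      change (Φ'.symm (Φ (x, 0, 0))).2.1 = a
      rw [← hy, Φ'.symm_apply_apply]
    -- The vector is orthogonal to the first `p`, hence to the proportional second one, and that
    -- pairing is `b`.
    have hb : b = 0 := by
      have e1 := h1 x 0 0 0 c 0
      have e2 := h1' y a b 0 1 0
      rw [← hc, ← hy, e2] at e1
      simpa using e1
    rw [hf, hg, ← hy, hb]
  refine Iso.of_linear hC₀ hC₀' f (fun x y => ?_) ?_ (fun i x hx => ?_) (fun i x hx => ?_)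
  · have e1 := h1 x 0 0 y 0 0
    rw [hf, hf, h1'] at e1
    simpa using e1
  · rw [← h2', hf] at h2
    have e1 := Φ'.injective h2
    simp only [Prod.mk.injEq] at e1
    exact e1.1
  · rcases le_or_gt i j with hij | hij
    · have e1 := (h3 i hij x 0 0).2 ⟨hx, rfl, rfl⟩
      rw [hf, h3' i hij] at e1
      exact e1.1
    · have e1 := (h4 i (by omega) x 0 0).2 ⟨hx, by cases ε <;> rfl⟩
      rw [hf, h4' i (by omega)] at e1
      exact e1.1
  · have e1 := (h5 i x 0 0).2 ⟨hx, rfl⟩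
    rw [hf, h5'] at e1
    exact e1.1

/-- The line `E 1` is orthogonal to `v` in one case and not in the other: under `UpRel` its
generator pairs with `v` to -I. -/
theorem InsRel.not_upRel {k : ℕ} {C₀' : Config} (h : InsRel j ε C₀ C) (h' : UpRel C₀' C)
    (hC : C.Valid k) : False := by
  obtain ⟨Φ, h1, h2, h3, h4, h5⟩ := h
  obtain ⟨Φ', h1', h2', h3', h4'⟩ := h'
  have := hC.quad.fin
  have e1 : Φ' (C₀'.v, -Complex.I) ∈ C.E 1 := by rw [h4']; simp
  obtain ⟨⟨x, a, b⟩, hx⟩ := Φ.surjective (Φ' (C₀'.v, -Complex.I))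
  have e2 := h1' C₀'.v (-Complex.I) 0 1
  rw [h2', ← hx, ← h2, h1] at e2
  rw [← hx, h5] at e1
  have e3 : (Φ (x, 0, 0)) ∈ C.E 1 := (h5 _ _ _ _).2 ⟨e1.1, rfl⟩
  -- `E 1` has dimension at most one and contains both Φ (x, 0, 0) and the nonzero vector Φ (0, 1,
  -- 0).
  have e4 : x = 0 := by
    have e5 : Φ (0, 1, 0) ∈ C.E 1 := (h5 _ _ _ _).2 ⟨Submodule.zero_mem _, rfl⟩
    have e6 := hC.flagE.dim 1
    have e7 : finrank ℂ (C.E 1) ≤ 1 := by omega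
    rw [finrank_le_one_iff] at e7
    obtain ⟨w, hw⟩ := e7
    obtain ⟨s, hs⟩ := hw ⟨_, e3⟩
    obtain ⟨t, ht⟩ := hw ⟨_, e5⟩
    have hs' := congrArg Subtype.val hs
    have ht' := congrArg Subtype.val ht
    simp only [Submodule.coe_smul] at hs' ht'
    have e8 : t • Φ (x, 0, 0) = s • Φ (0, 1, 0) := by
      rw [← hs', ← ht', smul_comm]
    rw [← map_smul, ← map_smul] at e8
    have e9 := Φ.injective e8
    simp at e9
    rcases e9 with ⟨e9 | e9, e10⟩
    · rw [e9, zero_smul] at ht'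
      have := Φ.injective (ht'.symm.trans (map_zero Φ).symm)
      simp at this
    · exact e9
  rw [e4] at e2
  simp at e2

end Invariants

end Config

end OrthoCount

/-! ### Constructing the two enlargements and undoing them -/

namespace OrthoCount

open Module

theorem finrank_submodule_prod {V W : Type*} [AddCommGroup V] [Module ℂ V] [AddCommGroup W]
    [Module ℂ W] [FiniteDimensional ℂ V] [FiniteDimensional ℂ W] (S : Submodule ℂ V)
    (T : Submodule ℂ W) : finrank ℂ (S.prod T) = finrank ℂ S + finrank ℂ T := by
  rw [← finrank_prod]
  exact LinearEquiv.finrank_eq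
    { toFun := fun x => (⟨x.1.1, x.2.1⟩, ⟨x.1.2, x.2.2⟩)
      map_add' := fun _ _ => rfl
      map_smul' := fun _ _ => rfl
      invFun := fun x => ⟨(x.1.1, x.2.1), x.1.2, x.2.2⟩ }

namespace Config

theorem exists_upRel {k : ℕ} {C₀ : Config} (h : C₀.Valid k) : ∃ C, C.Valid (k + 1) ∧ UpRel C₀ C := by
  have := h.quad.fin
  -- The kernel of σ is the line of (I v₀, 1), which is isotropic because I² + 1 = 0; it becomes `E
  -- 1`, and the later steps are the preimages of the `F i`.
  let σ : (C₀.V × ℂ) →ₗ[ℂ] C₀.V :=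
    LinearMap.fst ℂ _ _ - (Complex.I • (LinearMap.toSpanSingleton ℂ C₀.V C₀.v)) ∘ₗ
      LinearMap.snd ℂ _ _
  have hσ : ∀ x a, σ (x, a) = x - (a * Complex.I) • C₀.v := fun x a => by
    simp [σ, smul_smul, mul_comm]
  let C : Config :=
    { V := C₀.V × ℂ
      B := C₀.B.compl₁₂ (LinearMap.fst ℂ _ _) (LinearMap.fst ℂ _ _) +
        (LinearMap.mul ℂ ℂ).compl₁₂ (LinearMap.snd ℂ _ _) (LinearMap.snd ℂ _ _)
      v := (0, 1)
      F := fun i => (C₀.E i).prod ⊥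
      E := fun i => Nat.casesOn i ⊥ fun i => (C₀.F i).comap σ }
  have hB : ∀ x a y b, C.B (x, a) (y, b) = C₀.B x y + a * b := fun x a y b => rfl
  have hE : ∀ i x a, (x, a) ∈ C.E (i + 1) ↔ x - (a * Complex.I) • C₀.v ∈ C₀.F i := fun i x a => by
    rw [← hσ]
    rfl
  have hF : ∀ i x a, (x, a) ∈ C.F i ↔ x ∈ C₀.E i ∧ a = 0 := fun i x a => by
    simp [C]
  refine ⟨C, ⟨⟨inferInstanceAs (FiniteDimensional ℂ (C₀.V × ℂ)), ?_, ?_, ?_⟩, ?_, ⟨?_, ?_, ?_⟩, ?_,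
    ⟨?_, ?_, ?_⟩⟩, LinearEquiv.refl ℂ _, hB, rfl, hF, hE⟩
  · rintro ⟨x, a⟩ ⟨y, b⟩
    rw [hB, hB, h.quad.symm, mul_comm]
  · rintro ⟨x, a⟩ h0
    have h1 := h0 (0, 1)
    rw [hB] at h1
    simp at h1
    subst h1
    have h2 : x = 0 := h.quad.nondeg x fun y => by
      have := h0 (y, 0)
      rw [hB] at this
      simpa using this
    rw [h2]
    rfl
  · change finrank ℂ (C₀.V × ℂ) = _
    rw [finrank_prod, h.quad.dim, finrank_self]
  · change C.B (0, 1) (0, 1) = 1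
    rw [hB]
    simp
  · exact fun i j hij => Submodule.prod_mono (h.flagE.mono hij) le_rfl
  · rintro i ⟨x, a⟩ hx ⟨y, b⟩ hy
    rw [hF] at hx hy
    rw [hB, h.flagE.iso i _ hx.1 _ hy.1, hx.2]
    simp
  · intro i
    change finrank ℂ ((C₀.E i).prod (⊥ : Submodule ℂ ℂ)) = _
    rw [finrank_submodule_prod, h.flagE.dim, finrank_bot, add_zero]
  · rintro i ⟨x, a⟩ hx
    change C.B (0, 1) (x, a) = 0
    rw [hF] at hx
    rw [hB, hx.2]
    simp
  · refine monotone_nat_of_le_succ fun i => ?_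
    rcases i with _ | i
    · exact bot_le
    · exact Submodule.comap_mono (h.flagF.mono (Nat.le_succ i))
  · intro i x hx y hy
    rcases i with _ | i
    · have hx' : x = 0 := by simpa [C] using hx
      rw [hx']
      simp
    · obtain ⟨x, a⟩ := x
      obtain ⟨y, b⟩ := y
      rw [hE] at hx hy
      have h1 := h.flagF.iso i _ hx _ hy
      have h2 := h.perp i _ hx
      have h3 := h.perp i _ hy
      have h4 := h.unit
      have h5 := h.quad.symm x C₀.v
      simp only [map_sub, map_smul, LinearMap.sub_apply, LinearMap.smul_apply, smul_eq_mul, h4]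
        at h1 h2 h3
      rw [hB]
      rw [h5] at h1
      -- Orthogonality of `F i` to v₀ says B(v₀, x) = a I and B(v₀, y) = b I. Substituted into the
      -- pairing of the two σ-images, this leaves B(x, y) + a b.
      linear_combination h1 + a * Complex.I * h3 + b * Complex.I * h2 + a * b * Complex.I_mul_I
  · intro i
    rcases i with _ | i
    · change finrank ℂ (⊥ : Submodule ℂ (C₀.V × ℂ)) = _
      simp
    · change finrank ℂ ((C₀.F i).comap σ) = _
      -- The shear (x, a) ↦ (σ (x, a), a) turns the preimage into a product.
      have h1 : finrank ℂ ((C₀.F i).comap σ) = finrank ℂ ((C₀.F i).prod (⊤ : Submodule ℂ ℂ)) := by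
        apply LinearEquiv.finrank_eq
        refine LinearEquiv.ofSubmodules
          (LinearEquiv.ofLinearMap (σ.prod (LinearMap.snd ℂ _ _))
            ((LinearMap.fst ℂ _ _ + (Complex.I • (LinearMap.toSpanSingleton ℂ C₀.V C₀.v)) ∘ₗ
            LinearMap.snd ℂ _ _).prod (LinearMap.snd ℂ _ _)) ?_ ?_) _ _ ?_
        · ext <;> simp [σ]
        · ext <;> simp [σ]
        · ext ⟨x, a⟩
          simp only [Submodule.mem_map, Submodule.mem_comap, Submodule.mem_prod]
          constructor
          · rintro ⟨y, hy, hyx⟩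
            have := congrArg Prod.fst hyx
            simp only [LinearEquiv.coe_coe, LinearEquiv.coe_ofLinearMap, LinearMap.prod_apply,
              Function.prod] at this
            exact ⟨this ▸ hy, trivial⟩
          · rintro ⟨hx, -⟩
            refine ⟨(x + (a * Complex.I) • C₀.v, a), ?_, ?_⟩
            · rw [hσ]
              simpa using hx
            · simp [hσ]
      rw [h1, finrank_submodule_prod, h.flagF.dim, finrank_top, finrank_self]
      omega

/-- The bound on `j` is sharp: the new flag has `k / 2 + 1` proper steps, and the new vector enters
at one of them. -/
theorem exists_insRel {k j : ℕ} {ε : Bool} {C₀ : Config} (h : C₀.Valid k) (hj : j < k / 2 + 1) :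
    ∃ C, C.Valid (k + 2) ∧ InsRel j ε C₀ C := by
  have := h.quad.fin
  let C : Config :=
    { V := C₀.V × ℂ × ℂ
      B := C₀.B.compl₁₂ (LinearMap.fst ℂ _ _) (LinearMap.fst ℂ _ _) +
        (LinearMap.mul ℂ ℂ).compl₁₂ (LinearMap.fst ℂ _ _ ∘ₗ LinearMap.snd ℂ _ _)
          (LinearMap.snd ℂ _ _ ∘ₗ LinearMap.snd ℂ _ _) +
        (LinearMap.mul ℂ ℂ).compl₁₂ (LinearMap.snd ℂ _ _ ∘ₗ LinearMap.snd ℂ _ _)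
          (LinearMap.fst ℂ _ _ ∘ₗ LinearMap.snd ℂ _ _)
      v := (C₀.v, 0, 0)
      F := fun i => if i ≤ j then (C₀.F i).prod ⊥ else
        (C₀.F (i - 1)).prod (bif ε then Submodule.prod ⊤ ⊥ else Submodule.prod ⊥ ⊤)
      E := fun i => Nat.casesOn i ⊥ fun i => (C₀.E i).prod (Submodule.prod ⊤ ⊥) }
  have hB : ∀ x a b y c d, C.B (x, a, b) (y, c, d) = C₀.B x y + a * d + b * c :=
    fun x a b y c d => rfl
  have hE : ∀ i x a b, (x, a, b) ∈ C.E (i + 1) ↔ x ∈ C₀.E i ∧ b = 0 := fun i x a b => by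
    simp [C]
  have hF1 : ∀ i ≤ j, C.F i = (C₀.F i).prod ⊥ := fun i hi => if_pos hi
  have hF2 : ∀ i ≥ j, C.F (i + 1) =
      (C₀.F i).prod (bif ε then Submodule.prod ⊤ ⊥ else Submodule.prod ⊥ ⊤) :=
    fun i hi => if_neg (by omega)
  have hF3 : ∀ i ≤ j, ∀ x a b, (x, a, b) ∈ C.F i ↔ x ∈ C₀.F i ∧ a = 0 ∧ b = 0 :=
    fun i hi x a b => by
      rw [hF1 i hi]
      change x ∈ C₀.F i ∧ (a, b) ∈ (⊥ : Submodule ℂ (ℂ × ℂ)) ↔ _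
      simp
  have hF4 : ∀ i ≥ j, ∀ x a b,
      (x, a, b) ∈ C.F (i + 1) ↔ x ∈ C₀.F i ∧ (bif ε then b else a) = 0 :=
    fun i hi x a b => by
      rw [hF2 i hi]
      cases ε
      · change x ∈ C₀.F i ∧ a ∈ (⊥ : Submodule ℂ ℂ) ∧ b ∈ (⊤ : Submodule ℂ ℂ) ↔ _
        simp
      · change x ∈ C₀.F i ∧ a ∈ (⊤ : Submodule ℂ ℂ) ∧ b ∈ (⊥ : Submodule ℂ ℂ) ↔ _
        simp
  refine ⟨C, ⟨⟨inferInstanceAs (FiniteDimensional ℂ (C₀.V × ℂ × ℂ)), ?_, ?_, ?_⟩, ?_, ⟨?_, ?_, ?_⟩,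
    ?_, ⟨?_, ?_, ?_⟩⟩, LinearEquiv.refl ℂ _, hB, rfl, hF3, hF4, hE⟩
  · rintro ⟨x, a, b⟩ ⟨y, c, d⟩
    rw [hB, hB, h.quad.symm]
    ring
  · rintro ⟨x, a, b⟩ h0
    have h1 := h0 (0, 1, 0)
    have h2 := h0 (0, 0, 1)
    rw [hB] at h1 h2
    simp at h1 h2
    subst h1 h2
    have h2 : x = 0 := h.quad.nondeg x fun y => by
      have := h0 (y, 0, 0)
      rw [hB] at this
      simpa using this
    rw [h2]
    rfl
  · change finrank ℂ (C₀.V × ℂ × ℂ) = _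
    rw [finrank_prod, finrank_prod, h.quad.dim, finrank_self]
  · change C.B (C₀.v, 0, 0) (C₀.v, 0, 0) = 1
    rw [hB, h.unit]
    simp
  · refine monotone_nat_of_le_succ fun i => ?_
    rcases lt_trichotomy i j with hij | rfl | hij
    · rw [hF1 i hij.le, hF1 (i + 1) hij]
      exact Submodule.prod_mono (h.flagF.mono (Nat.le_succ i)) le_rfl
    · rw [hF1 i le_rfl, hF2 i le_rfl]
      exact Submodule.prod_mono le_rfl bot_le
    · obtain ⟨i, rfl⟩ := Nat.exists_eq_succ_of_ne_zero (by omega : i ≠ 0)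
      rw [hF2 _ hij.le, Nat.succ_eq_add_one, hF2 i (by omega)]
      exact Submodule.prod_mono (h.flagF.mono (Nat.le_succ i)) le_rfl
  · rintro i ⟨x, a, b⟩ hx ⟨y, c, d⟩ hy
    rw [hB]
    rcases le_or_gt i j with hij | hij
    · rw [hF3 i hij] at hx hy
      rw [h.flagF.iso i _ hx.1 _ hy.1, hx.2.1, hx.2.2]
      simp
    · obtain ⟨i, rfl⟩ := Nat.exists_eq_succ_of_ne_zero (by omega : i ≠ 0)
      rw [Nat.succ_eq_add_one, hF4 i (by omega)] at hx hy
      rw [h.flagF.iso i _ hx.1 _ hy.1]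
      have h1 := hx.2
      have h2 := hy.2
      cases ε <;> simp at h1 h2 <;> simp [h1, h2]
  · intro i
    rcases le_or_gt i j with hij | hij
    · rw [hF1 i hij]
      change finrank ℂ ((C₀.F i).prod (⊥ : Submodule ℂ (ℂ × ℂ))) = _
      rw [finrank_submodule_prod, h.flagF.dim, finrank_bot]
      omega
    · obtain ⟨i, rfl⟩ := Nat.exists_eq_succ_of_ne_zero (by omega : i ≠ 0)
      rw [Nat.succ_eq_add_one, hF2 i (by omega)]
      change finrank ℂ ((C₀.F i).prod (bif ε then Submodule.prod (⊤ : Submodule ℂ ℂ)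
        (⊥ : Submodule ℂ ℂ) else Submodule.prod ⊥ ⊤)) = _
      rw [finrank_submodule_prod, h.flagF.dim]
      have h1 : finrank ℂ (bif ε then Submodule.prod (⊤ : Submodule ℂ ℂ)
        (⊥ : Submodule ℂ ℂ) else Submodule.prod ⊥ ⊤ : Submodule ℂ (ℂ × ℂ)) = 1 := by
        cases ε <;> simp only [cond_true, cond_false, finrank_submodule_prod, finrank_bot,
          finrank_top, finrank_self]
      rw [h1]
      omega
  · rintro i ⟨x, a, b⟩ hx
    change C.B (C₀.v, 0, 0) (x, a, b) = 0
    rw [hB]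
    rcases le_or_gt i j with hij | hij
    · rw [hF3 i hij] at hx
      simp [h.perp i _ hx.1]
    · obtain ⟨i, rfl⟩ := Nat.exists_eq_succ_of_ne_zero (by omega : i ≠ 0)
      rw [Nat.succ_eq_add_one, hF4 i (by omega)] at hx
      simp [h.perp i _ hx.1]
  · refine monotone_nat_of_le_succ fun i => ?_
    rcases i with _ | i
    · exact bot_le
    · exact Submodule.prod_mono (h.flagE.mono (Nat.le_succ i)) le_rfl
  · intro i x hx y hy
    rcases i with _ | i
    · have hx' : x = 0 := by simpa [C] using hx
      rw [hx']
      simp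
    · obtain ⟨x, a, b⟩ := x
      obtain ⟨y, c, d⟩ := y
      rw [hE] at hx hy
      rw [hB, h.flagE.iso i _ hx.1 _ hy.1, hx.2, hy.2]
      simp
  · intro i
    rcases i with _ | i
    · change finrank ℂ (⊥ : Submodule ℂ (C₀.V × ℂ × ℂ)) = _
      simp
    · change finrank ℂ ((C₀.E i).prod (Submodule.prod (⊤ : Submodule ℂ ℂ) (⊥ : Submodule ℂ ℂ))) = _
      rw [finrank_submodule_prod, finrank_submodule_prod, h.flagE.dim, finrank_top, finrank_bot,
        finrank_self]
      omega

/-- A configuration where the first step of `E` is not orthogonal to `v`. -/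
theorem exists_upRel_of_ne {k : ℕ} {C : Config} (h : C.Valid (k + 1)) {p : C.V} (hp : p ∈ C.E 1)
    (hvp : C.B C.v p ≠ 0) : ∃ C₀, C₀.Valid k ∧ UpRel C₀ C := by
  have := h.quad.fin
  -- With `u` isotropic and B(v, u) = B(v, v) = 1, the vector u - v is orthogonal to `v` and has
  -- square -1. Hence -I (u - v) is a unit vector of the complement.
  obtain ⟨u, huE, huv⟩ : ∃ u ∈ C.E 1, C.B C.v u = 1 :=
    ⟨(C.B C.v p)⁻¹ • p, Submodule.smul_mem _ _ hp, by simp [hvp]⟩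
  have huE' : ∀ i, u ∈ C.E (i + 1) := fun i => h.flagE.mono (by omega) huE
  have huu := h.flagE.iso 1 u huE u huE
  have huv' : C.B u C.v = 1 := (h.quad.symm _ _).trans huv
  obtain ⟨hQ, Φ, hΦ, hΦB⟩ := h.quad.exists_unit_split h.unit
  have hw : -Complex.I • (u - C.v) ∈ LinearMap.ker (C.B C.v) := by
    rw [LinearMap.mem_ker]
    simp [huv, h.unit]
  let C₀ : Config :=
    { V := LinearMap.ker (C.B C.v)
      B := C.B.restrict _
      v := ⟨-Complex.I • (u - C.v), hw⟩
      F := fun i => (C.E (i + 1)).comap (Submodule.subtype _)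
      E := fun i => (C.F i).comap (Submodule.subtype _) }
  refine ⟨C₀, ⟨hQ, ?_, ⟨?_, ?_, ?_⟩, ?_, ⟨?_, ?_, ?_⟩⟩, Φ, hΦB, ?_, ?_, ?_⟩
  · change C.B (-Complex.I • (u - C.v)) (-Complex.I • (u - C.v)) = 1
    simp only [map_sub, map_smul, LinearMap.sub_apply, LinearMap.smul_apply, smul_eq_mul, h.unit,
      huu, huv, huv']
    linear_combination -Complex.I_mul_I
  · exact fun i j hij => Submodule.comap_mono (h.flagE.mono (by omega))
  · exact fun i x hx y hy => h.flagE.iso _ _ hx _ hy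
  · intro i
    change finrank ℂ ((C.E (i + 1)).comap (Submodule.subtype (LinearMap.ker (C.B C.v)))) = _
    rw [finrank_comap_subtype]
    have h1 := finrank_inf_ker_add_one (C.E (i + 1)) (C.B C.v) (huE' i) (by simp [huv])
    rw [h.flagE.dim] at h1
    omega
  · rintro i ⟨x, hx⟩ hxE
    change C.B (-Complex.I • (u - C.v)) x = 0
    have h1 := h.flagE.iso _ _ (huE' i) x hxE
    rw [LinearMap.mem_ker] at hx
    simp [h1, hx]
  · exact fun i j hij => Submodule.comap_mono (h.flagF.mono hij)
  · exact fun i x hx y hy => h.flagF.iso _ _ hx _ hy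
  · intro i
    change finrank ℂ ((C.F i).comap (Submodule.subtype (LinearMap.ker (C.B C.v)))) = _
    rw [finrank_comap_subtype, inf_eq_left.2, h.flagF.dim]
    exact fun x hx => h.perp i x hx
  · rw [hΦ]
    simp
  · rintro i ⟨x, hx⟩ a
    change Φ (⟨x, hx⟩, a) ∈ C.F i ↔ x ∈ C.F i ∧ a = 0
    rw [hΦ]
    rw [LinearMap.mem_ker] at hx
    constructor
    · intro hm
      have h1 := h.perp _ _ hm
      simp [hx, h.unit] at h1
      subst h1
      simpa using hm
    · rintro ⟨h1, rfl⟩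
      simpa using h1
  · rintro i ⟨x, hx⟩ a
    change Φ (⟨x, hx⟩, a) ∈ C.E (i + 1) ↔
      x - (a * Complex.I) • (-Complex.I • (u - C.v)) ∈ C.E (i + 1)
    rw [hΦ]
    -- For v₀ = -I (u - v) the criterion of `UpRel` differs from membership of x + a v only by a
    -- multiple of `u`, which lies in `E (i + 1)`.
    have h1 : x - (a * Complex.I) • (-Complex.I • (u - C.v)) = (x + a • C.v) - a • u := by
      have h2 : a * Complex.I * -Complex.I = a := by
        linear_combination -a * Complex.I_mul_I
      rw [smul_smul, h2, smul_sub]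
      abel
    rw [h1, Submodule.sub_mem_iff_left _ (Submodule.smul_mem _ _ (huE' i))]

/-- In dimension two the complement of `v` is a line spanned by a unit vector, so it cannot contain
the isotropic line `E 1`. Hence only one code is needed here. -/
theorem exists_upRel_of_valid_one {C : Config} (h : C.Valid 1) : ∃ C₀, C₀.Valid 0 ∧ UpRel C₀ C := by
  have := h.quad.fin
  obtain ⟨p, hp0, hpp, hpE⟩ := h.flagE.exists_line
  refine exists_upRel_of_ne h ((hpE p).2 ⟨1, by simp⟩) fun h0 => ?_
  obtain ⟨hQ, -⟩ := h.quad.exists_unit_split h.unit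
  obtain ⟨v, hv⟩ := hQ.exists_unit
  have hx : (⟨p, h0⟩ : LinearMap.ker (C.B C.v)) ≠ 0 := fun h1 => hp0 (congrArg Subtype.val h1)
  have h1 := (finrank_eq_one_iff_of_nonzero' _ hx).1 hQ.dim v
  obtain ⟨c, rfl⟩ := h1
  have h2 : (C.B.restrict (LinearMap.ker (C.B C.v))) ⟨p, h0⟩ ⟨p, h0⟩ = 0 := hpp
  rw [map_smul, map_smul, LinearMap.smul_apply, h2] at hv
  simp at hv

/-- The position of the line of `p` relative to `F`. -/
theorem exists_position {k : ℕ} {C : Config} (h : C.Valid (k + 2)) {p : C.V} (hp0 : p ≠ 0)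
    (hpp : C.B p p = 0) (hvp : C.B C.v p = 0) :
    ∃ j < k / 2 + 1, ∃ ε : Bool, ∃ q, C.B p q = 1 ∧ C.B q q = 0 ∧ C.B C.v q = 0 ∧
      (∀ x ∈ C.F j, C.B x p = 0) ∧ (∀ x ∈ C.F j, C.B x q = 0) ∧
      (bif ε then p else q) ∈ C.F (j + 1) := by
  classical
  have := h.quad.fin
  have hl : (k + 2) / 2 = k / 2 + 1 := by omega
  have hbot := h.flagF.zero_eq_bot
  by_cases hpF : p ∈ C.F (k / 2 + 1)
  -- Here `j + 1` is the first step that contains `p`, and the partner `q` is chosen orthogonal to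
  -- both `F j` and `v`.
  · have hex : ∃ i, p ∈ C.F i := ⟨_, hpF⟩
    have h1 := Nat.find_spec hex
    have h2 := Nat.find_min' hex hpF
    have h3 : Nat.find hex ≠ 0 := by
      intro h0
      rw [h0, hbot, Submodule.mem_bot] at h1
      exact hp0 h1
    obtain ⟨j, hj⟩ := Nat.exists_eq_succ_of_ne_zero h3
    have h4 : p ∉ C.F j := Nat.find_min hex (by omega)
    rw [hj] at h1
    have hjp : ∀ x ∈ C.F j, C.B x p = 0 :=
      fun x hx => h.flagF.iso _ _ (h.flagF.mono (Nat.le_succ j) hx) _ h1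
    obtain ⟨q, hq1, hq2, hq3⟩ := h.quad.exists_partner (S := C.F j ⊔ Submodule.span ℂ {C.v}) (p := p)
      (fun hm => by
        obtain ⟨x, hx, y, hy, hxy⟩ := Submodule.mem_sup.1 hm
        obtain ⟨c, rfl⟩ := Submodule.mem_span_singleton.1 hy
        have h5 := congrArg (C.B C.v) hxy
        simp [h.perp j x hx, h.unit, hvp] at h5
        rw [h5, zero_smul, add_zero] at hxy
        exact h4 (hxy ▸ hx)) hpp
      (fun s hs => by
        obtain ⟨x, hx, y, hy, rfl⟩ := Submodule.mem_sup.1 hs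
        obtain ⟨c, rfl⟩ := Submodule.mem_span_singleton.1 hy
        simp [hjp x hx, hvp])
    exact ⟨j, by omega, true, q, hq2, hq3,
      hq1 _ (Submodule.mem_sup_right (Submodule.mem_span_singleton_self _)), hjp,
      fun x hx => hq1 x (Submodule.mem_sup_left hx), h1⟩
  -- The last step of `F` is a maximal isotropic subspace of v^⊥ by dimension, so an isotropic `p` ∈
  -- v^⊥ outside it cannot be orthogonal to it.
  · have hP : ¬ ∀ x ∈ C.F (k / 2 + 1), C.B x p = 0 := by
      intro hP
      obtain ⟨hQ, -⟩ := h.quad.exists_unit_split h.unit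
      set S := C.F (k / 2 + 1) ⊔ Submodule.span ℂ {p} with hS
      have hlt : C.F (k / 2 + 1) < S := lt_of_le_of_ne le_sup_left fun he =>
        hpF (he ▸ Submodule.mem_sup_right (Submodule.mem_span_singleton_self _))
      have h1 := Submodule.finrank_lt_finrank_of_lt hlt
      have hSk : S ≤ LinearMap.ker (C.B C.v) := by
        rw [hS, sup_le_iff, Submodule.span_singleton_le_iff_mem]
        exact ⟨fun x hx => h.perp _ x hx, hvp⟩
      have h2 := hQ.two_mul_finrank_le (S := S.comap (Submodule.subtype _)) (by
        rintro ⟨_, _⟩ hxS ⟨_, _⟩ hyS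
        obtain ⟨x, hx, x', hx', rfl⟩ := Submodule.mem_sup.1 hxS
        obtain ⟨y, hy, y', hy', rfl⟩ := Submodule.mem_sup.1 hyS
        obtain ⟨c, rfl⟩ := Submodule.mem_span_singleton.1 hx'
        obtain ⟨d, rfl⟩ := Submodule.mem_span_singleton.1 hy'
        have h3 := hP x hx
        have h4 := (h.quad.symm _ _).trans (hP y hy)
        change C.B (x + c • p) (y + d • p) = 0
        simp [h3, h4, hpp, h.flagF.iso _ x hx y hy])
      rw [finrank_comap_subtype, inf_eq_left.2 hSk] at h2
      rw [h.flagF.dim] at h1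
      omega
    -- Now `j + 1` is the first step not orthogonal to `p`, and the partner `q` is taken from that
    -- step itself, so `q` is automatically isotropic and orthogonal to `v` and `F j`.
    have hex : ∃ i, ¬ ∀ x ∈ C.F i, C.B x p = 0 := ⟨_, hP⟩
    have h1 := Nat.find_spec hex
    have h2 := Nat.find_min' hex hP
    have h3 : Nat.find hex ≠ 0 := by
      intro h0
      rw [h0] at h1
      apply h1
      intro x hx
      rw [hbot, Submodule.mem_bot] at hx
      simp [hx]
    obtain ⟨j, hj⟩ := Nat.exists_eq_succ_of_ne_zero h3
    have h4 : ∀ x ∈ C.F j, C.B x p = 0 := by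
      have := Nat.find_min hex (m := j) (by omega)
      rwa [not_not] at this
    rw [hj] at h1
    push Not at h1
    obtain ⟨x, hx, hxp⟩ := h1
    have hxp' : C.B p x ≠ 0 := by rwa [h.quad.symm]
    have hq : (C.B p x)⁻¹ • x ∈ C.F (j + 1) := Submodule.smul_mem _ _ hx
    exact ⟨j, by omega, false, (C.B p x)⁻¹ • x, by simp [hxp'], h.flagF.iso _ _ hq _ hq,
      h.perp _ _ hq, h4, fun y hy => h.flagF.iso _ _ (h.flagF.mono (Nat.le_succ j) hy) _ hq, hq⟩

/-- A configuration where the first step of `E` is orthogonal to `v`. -/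
theorem exists_insRel_of_eq {k : ℕ} {C : Config} (h : C.Valid (k + 2))
    (hv : ∀ p ∈ C.E 1, C.B C.v p = 0) :
    ∃ j < k / 2 + 1, ∃ ε C₀, C₀.Valid k ∧ InsRel j ε C₀ C := by
  have := h.quad.fin
  have hl : (k + 2 + 1) / 2 = (k + 1) / 2 + 1 := by omega
  have hl' : (k + 2) / 2 = k / 2 + 1 := by omega
  have hflagE := h.flagE
  have hflagF := h.flagF
  rw [hl] at hflagE
  rw [hl'] at hflagF
  obtain ⟨p, hp0, hpp, hpE⟩ := hflagE.exists_line
  have hp1 : p ∈ C.E 1 := (hpE p).2 ⟨1, by simp⟩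
  obtain ⟨j, hj, ε, q, hpq, hqq, hvq, hjp, hjq, hr⟩ := exists_position h hp0 hpp (hv p hp1)
  have hqp : C.B q p = 1 := (h.quad.symm _ _).trans hpq
  have hr' : ∀ i ≥ j, (bif ε then p else q) ∈ C.F (i + 1) := fun i hi => h.flagF.mono (by omega) hr
  have hsplit := h.quad.exists_hyperbolic_split hpp hqq hpq
  have hred := hflagE.reduce h.quad hp1 hpq
  obtain ⟨W, hW⟩ : ∃ W, LinearMap.ker (C.B p) ⊓ LinearMap.ker (C.B q) = W := ⟨_, rfl⟩
  have hmem : ∀ x, x ∈ W ↔ C.B p x = 0 ∧ C.B q x = 0 := fun x => by rw [← hW]; rfl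
  rw [hW] at hsplit hred
  obtain ⟨hQ, Φ, hΦ, hΦB⟩ := hsplit
  have hvW : C.v ∈ W := (hmem _).2 ⟨(h.quad.symm _ _).trans (hv p hp1), (h.quad.symm _ _).trans hvq⟩
  have hFW : ∀ i ≤ j, C.F i ≤ W := fun i hi x hx => (hmem _).2
    ⟨(h.quad.symm _ _).trans (hjp x (h.flagF.mono hi hx)),
      (h.quad.symm _ _).trans (hjq x (h.flagF.mono hi hx))⟩
  -- the steps after `j` lose one dimension
  have hdim : ∀ i ≥ j, finrank ℂ (C.F (i + 1) ⊓ W : Submodule ℂ C.V) = min i (k / 2) := by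
    intro i hi
    have h1 := finrank_inf_ker_add_one (C.F (i + 1)) (C.B (bif ε then q else p)) (hr' i hi)
      (by cases ε <;> simp [hpq, hqp])
    have h2 : C.F (i + 1) ⊓ W = C.F (i + 1) ⊓ LinearMap.ker (C.B (bif ε then q else p)) := by
      ext x
      simp only [Submodule.mem_inf, hmem, LinearMap.mem_ker]
      constructor
      · rintro ⟨hx, h3, h4⟩
        cases ε
        · exact ⟨hx, h3⟩
        · exact ⟨hx, h4⟩
      · rintro ⟨hx, h3⟩
        have h4 := h.flagF.iso _ _ (hr' i hi) _ hx
        cases ε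
        · exact ⟨hx, h3, h4⟩
        · exact ⟨hx, h4, h3⟩
    rw [h2]
    rw [hflagF.dim] at h1
    omega
  have hFj : C.F (j + 1) ⊓ W = C.F j := by
    symm
    apply Submodule.eq_of_le_of_finrank_eq (le_inf (h.flagF.mono (Nat.le_succ j)) (hFW j le_rfl))
    rw [hdim j le_rfl, hflagF.dim]
    omega
  have hFmono : Monotone fun i => C.F (if i ≤ j then i else i + 1) := by
    intro a b hab
    apply h.flagF.mono
    split_ifs <;> omega
  -- Since F (j+1) meets `W` in F j, the flag induced on `W` repeats at that place; the index j + 1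
  -- is skipped.
  let C₀ : Config :=
    { V := W
      B := C.B.restrict _
      v := ⟨C.v, hvW⟩
      F := fun i => (C.F (if i ≤ j then i else i + 1)).comap (Submodule.subtype _)
      E := fun i => (C.E (i + 1)).comap (Submodule.subtype _) }
  refine ⟨j, hj, ε, C₀, ⟨hQ, h.unit, ⟨?_, ?_, ?_⟩, ?_, hred⟩, Φ, hΦB, ?_, ?_, ?_,
    ?_⟩
  · exact fun a b hab => Submodule.comap_mono (hFmono hab)
  · exact fun i x hx y hy => h.flagF.iso _ _ hx _ hy
  · intro i
    change finrank ℂ ((C.F (if i ≤ j then i else i + 1)).comap (Submodule.subtype W)) = _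
    rw [finrank_comap_subtype]
    by_cases hij : i ≤ j
    · rw [if_pos hij, inf_eq_left.2 (hFW i hij), hflagF.dim]
      omega
    · rw [if_neg hij]
      exact hdim i (by omega)
  · exact fun i x hx => h.perp _ _ hx
  · rw [hΦ]
    simp [C₀]
  · rintro i hij ⟨x, hx⟩ a b
    change Φ (⟨x, hx⟩, a, b) ∈ C.F i ↔ x ∈ C.F (if i ≤ j then i else i + 1) ∧ a = 0 ∧ b = 0
    rw [hΦ, if_pos hij]
    constructor
    · intro hm
      have h1 := hFW i hij hm
      obtain ⟨h2, h3⟩ := (hmem x).1 hx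
      simp only [hmem, map_add, map_smul, h2, h3, hpp, hqq,
        hpq, hqp, smul_eq_mul, mul_one, mul_zero, add_zero, zero_add] at h1
      obtain ⟨rfl, rfl⟩ := h1
      refine ⟨?_, rfl, rfl⟩
      simpa using hm
    · rintro ⟨h1, rfl, rfl⟩
      simpa using h1
  · rintro i hij ⟨x, hx⟩ a b
    change Φ (⟨x, hx⟩, a, b) ∈ C.F (i + 1) ↔ x ∈ C.F (if i ≤ j then i else i + 1) ∧ _
    have h1 : x ∈ C.F (if i ≤ j then i else i + 1) ↔ x ∈ C.F (i + 1) := by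
      split_ifs with hij'
      · obtain rfl : i = j := le_antisymm hij' hij
        rw [← hFj]
        exact ⟨fun h2 => h2.1, fun h2 => ⟨h2, hx⟩⟩
      · rfl
    rw [hΦ, h1]
    cases ε
    · rw [show x + a • p + b • q = x + b • q + a • p by abel]
      exact h.flagF.mem_reduce_iff (hr' i hij) hqq hqp ((hmem x).1 hx).2 b a
    · exact h.flagF.mem_reduce_iff (hr' i hij) hpp hpq ((hmem x).1 hx).1 a b
  · rintro i ⟨x, hx⟩ a b
    change Φ (⟨x, hx⟩, a, b) ∈ C.E (i + 1) ↔ x ∈ C.E (i + 1) ∧ b = 0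
    rw [hΦ]
    exact h.flagE.mem_reduce_iff (h.flagE.mono (by omega) hp1) hpp hpq ((hmem x).1 hx).1 a b

/-! #### Classification -/

/-- Codes for the isometry classes of valid configurations in dimension `k + 1`. -/
def Code : ℕ → Type
  | 0 => Unit
  | 1 => Unit
  | k + 2 => Code (k + 1) ⊕ (Fin (k / 2 + 1) × Bool × Code k)

/-- The configuration `C` has the given code. -/
def HasCode : (k : ℕ) → Code k → Config → Prop
  | 0, _, C => C.Valid 0
  | 1, _, C => C.Valid 1
  | k + 2, .inl c, C => C.Valid (k + 2) ∧ ∃ C₀, HasCode (k + 1) c C₀ ∧ UpRel C₀ C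
  | k + 2, .inr (j, ε, c), C => C.Valid (k + 2) ∧ ∃ C₀, HasCode k c C₀ ∧ InsRel j ε C₀ C

theorem HasCode.valid {k : ℕ} {c : Code k} {C : Config} (h : HasCode k c C) : C.Valid k := by
  match k, c with
  | 0, _ => exact h
  | 1, _ => exact h
  | k + 2, .inl c => exact h.1
  | k + 2, .inr (j, ε, c) => exact h.1

theorem exists_hasCode : ∀ {k : ℕ} {C : Config}, C.Valid k → ∃ c, HasCode k c C
  | 0, C, h => ⟨(), h⟩
  | 1, C, h => ⟨(), h⟩
  | k + 2, C, h => by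
    by_cases hv : ∀ p ∈ C.E 1, C.B C.v p = 0
    · obtain ⟨j, hj, ε, C₀, h₀, hr⟩ := exists_insRel_of_eq h hv
      obtain ⟨c, hc⟩ := exists_hasCode h₀
      exact ⟨.inr (⟨j, hj⟩, ε, c), h, C₀, hc, hr⟩
    · push Not at hv
      obtain ⟨p, hp, hvp⟩ := hv
      obtain ⟨C₀, h₀, hr⟩ := exists_upRel_of_ne h hp hvp
      obtain ⟨c, hc⟩ := exists_hasCode h₀
      exact ⟨.inl c, h, C₀, hc, hr⟩

theorem exists_config : ∀ {k : ℕ} (c : Code k), ∃ C, HasCode k c C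
  | 0, c => ⟨{ V := ℂ, B := LinearMap.mul ℂ ℂ, v := 1, F := fun _ => ⊥, E := fun _ => ⊥ },
      ⟨inferInstanceAs (FiniteDimensional ℂ ℂ), fun x y => mul_comm x y,
        fun x hx => by simpa using hx 1, finrank_self ℂ⟩, by simp,
      ⟨fun _ _ _ => le_rfl, by simp, by simp⟩, by simp, ⟨fun _ _ _ => le_rfl, by simp, by simp⟩⟩
  | 1, c => by
    obtain ⟨C₀, h₀⟩ := exists_config (k := 0) ()
    obtain ⟨C, hC, -⟩ := exists_upRel h₀.valid
    exact ⟨C, hC⟩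
  | k + 2, .inl c => by
    obtain ⟨C₀, h₀⟩ := exists_config c
    obtain ⟨C, hC, hr⟩ := exists_upRel h₀.valid
    exact ⟨C, hC, C₀, h₀, hr⟩
  | k + 2, .inr (j, ε, c) => by
    obtain ⟨C₀, h₀⟩ := exists_config c
    obtain ⟨C, hC, hr⟩ := exists_insRel (ε := ε) h₀.valid j.2
    exact ⟨C, hC, C₀, h₀, hr⟩

theorem HasCode.iso : ∀ {k : ℕ} {c : Code k} {C C' : Config}, HasCode k c C → HasCode k c C' →
    Iso C C'
  | 0, _, _, _, h, h' => valid_zero_iso h h'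
  | 1, _, _, _, h, h' => by
    obtain ⟨C₀, h₀, hr⟩ := exists_upRel_of_valid_one h
    obtain ⟨C₀', h₀', hr'⟩ := exists_upRel_of_valid_one h'
    exact hr.congr h h' hr' (valid_zero_iso h₀ h₀')
  | k + 2, .inl c, _, _, ⟨h, C₀, h₀, hr⟩, ⟨h', C₀', h₀', hr'⟩ => hr.congr h h' hr' (h₀.iso h₀')
  | k + 2, .inr (j, ε, c), _, _, ⟨h, C₀, h₀, hr⟩, ⟨h', C₀', h₀', hr'⟩ =>
    hr.congr h h' hr' (h₀.iso h₀')

/-- The two kinds of enlargement exclude each other, the index (j, ε) is invariant, and the smaller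
configuration is unique up to isometry, so the code is recovered by recursion. -/
theorem HasCode.code_eq : ∀ {k : ℕ} {c c' : Code k} {C C' : Config}, HasCode k c C →
    HasCode k c' C' → Iso C C' → c = c'
  | 0, _, _, _, _, _, _, _ => rfl
  | 1, _, _, _, _, _, _, _ => rfl
  | k + 2, .inl c, .inl c', _, _, ⟨h, C₀, h₀, hr⟩, ⟨h', C₀', h₀', hr'⟩, hi =>
    congrArg Sum.inl (h₀.code_eq h₀' ((hr.iso_right hi).cancel h₀.valid h₀'.valid hr'))
  | k + 2, .inl c, .inr (j, ε, c'), _, _, ⟨h, C₀, h₀, hr⟩, ⟨h', C₀', h₀', hr'⟩, hi =>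
    (hr'.not_upRel (hr.iso_right hi) h').elim
  | k + 2, .inr (j, ε, c), .inl c', _, _, ⟨h, C₀, h₀, hr⟩, ⟨h', C₀', h₀', hr'⟩, hi =>
    ((hr.iso_right hi).not_upRel hr' h').elim
  | k + 2, .inr (j, ε, c), .inr (j', ε', c'), _, _, ⟨h, C₀, h₀, hr⟩, ⟨h', C₀', h₀', hr'⟩, hi => by
    have hr2 := hr.iso_right hi
    obtain ⟨h1, h2⟩ := hr2.index_eq h₀.valid h₀'.valid hr'
    obtain rfl := Fin.ext h1
    subst h2
    rw [h₀.code_eq h₀' (hr2.cancel h₀.valid h₀'.valid hr')]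

end Config

end OrthoCount

namespace OrthoCount

/-! ### Counting partitions into signed lists -/

theorem isSignedList_iff {A : Finset ℕ} {s : List ℤ} :
    IsSignedList A s ↔ (∀ x ∈ s, x.natAbs ∈ A) ∧ (absList s).Nodup := by
  unfold IsSignedList absList List.Nodup
  rw [List.pairwise_map]
  refine and_congr (forall₂_congr fun x _ => ⟨?_, fun h => ?_⟩) ?_
  · rintro ⟨a, ha, rfl | rfl⟩ <;> simpa
  · exact ⟨_, h, Int.natAbs_eq x⟩
  · have h : ∀ x y : ℤ, (x ≠ y ∧ x ≠ -y) ↔ x.natAbs ≠ y.natAbs := fun x y => by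
      rw [Ne, Ne, Ne, Int.natAbs_eq_natAbs_iff, not_or]
    simp only [h]

/-- A list that can occur in a partition of `A` into signed lists. -/
structure IsBlock (A : Finset ℕ) (s : List ℤ) : Prop where
  ne_nil : s ≠ []
  mem : ∀ x ∈ s, x.natAbs ∈ A
  nodup : (absList s).Nodup
  last : ∀ x ∈ s.getLast?, 0 ≤ x
  zero : (0 : ℤ) ∈ s → s.getLast? = some 0

theorem mem_absList {s : List ℤ} {a : ℕ} : a ∈ absList s ↔ ∃ x ∈ s, x.natAbs = a := List.mem_map

/-- A working form: blocks that share an absolute value are equal. This absorbs both injectivity of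
`absList` and uniqueness of the containing list. -/
theorem isSPIL_iff {A : Finset ℕ} {P : Finset (List ℤ)} :
    IsSPIL A P ↔ (∀ s ∈ P, IsBlock A s) ∧
      (∀ s ∈ P, ∀ t ∈ P, ∀ a, a ∈ absList s → a ∈ absList t → s = t) ∧
      ∀ a ∈ A, ∃ s ∈ P, a ∈ absList s := by
  constructor
  · rintro ⟨h1, h2, ⟨h3, h4⟩, h5, h6⟩
    have hA : ∀ s ∈ P, ∀ a ∈ absList s, a ∈ A := fun s hs a ha =>
      (h3 _ (Finset.mem_image_of_mem _ hs)).2.2 a ha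
    refine ⟨fun s hs => ⟨?_, (isSignedList_iff.1 (h1 s hs)).1, (isSignedList_iff.1 (h1 s hs)).2,
      h5 s hs, h6 s hs⟩, fun s hs t ht a has hat => ?_, fun a ha => ?_⟩
    · rintro rfl
      exact (h3 _ (Finset.mem_image_of_mem _ hs)).1 rfl
    · exact h2 hs ht ((h4 a (hA s hs a has)).unique ⟨Finset.mem_image_of_mem _ hs, has⟩
        ⟨Finset.mem_image_of_mem _ ht, hat⟩)
    · obtain ⟨t, ⟨ht, hat⟩, -⟩ := h4 a ha
      obtain ⟨s, hs, rfl⟩ := Finset.mem_image.1 ht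
      exact ⟨s, hs, hat⟩
  · rintro ⟨h1, h2, h3⟩
    refine ⟨fun s hs => isSignedList_iff.2 ⟨(h1 s hs).mem, (h1 s hs).nodup⟩, fun s hs t ht hst => ?_,
      ⟨fun t ht => ?_, fun a ha => ?_⟩, fun s hs => (h1 s hs).last, fun s hs => (h1 s hs).zero⟩
    · obtain ⟨x, hx⟩ := List.exists_mem_of_ne_nil s (h1 s hs).ne_nil
      have hx' : x.natAbs ∈ absList s := mem_absList.2 ⟨x, hx, rfl⟩
      exact h2 s hs t ht _ hx' (hst ▸ hx')
    · obtain ⟨s, hs, rfl⟩ := Finset.mem_image.1 ht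
      refine ⟨fun h0 => (h1 s hs).ne_nil (List.map_eq_nil_iff.1 h0), (h1 s hs).nodup, fun a ha => ?_⟩
      obtain ⟨x, hx, rfl⟩ := mem_absList.1 ha
      exact (h1 s hs).mem x hx
    · obtain ⟨s, hs, has⟩ := h3 a ha
      refine ⟨absList s, ⟨Finset.mem_image_of_mem _ hs, has⟩, ?_⟩
      rintro t ⟨ht, hat⟩
      obtain ⟨u, hu, rfl⟩ := Finset.mem_image.1 ht
      rw [h2 u hu s hs a hat has]

theorem not_mem_of_isSPIL_sdiff {A : Finset ℕ} {Q : Finset (List ℤ)} {s : List ℤ} (hs : s ≠ [])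
    (hQ : IsSPIL (A \ (absList s).toFinset) Q) : s ∉ Q := by
  intro h
  obtain ⟨x, hx⟩ := List.exists_mem_of_ne_nil s hs
  have h1 := ((isSPIL_iff.1 hQ).1 s h).mem x hx
  rw [Finset.mem_sdiff, List.mem_toFinset] at h1
  exact h1.2 (mem_absList.2 ⟨x, hx, rfl⟩)

theorem IsBlock.isSPIL_insert {A : Finset ℕ} {Q : Finset (List ℤ)} {s : List ℤ} (hs : IsBlock A s)
    (hQ : IsSPIL (A \ (absList s).toFinset) Q) : IsSPIL A (insert s Q) := by
  rw [isSPIL_iff] at hQ ⊢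
  obtain ⟨h1, h2, h3⟩ := hQ
  have h4 : ∀ t ∈ Q, ∀ a ∈ absList t, a ∈ A ∧ a ∉ absList s := by
    intro t ht a ha
    obtain ⟨x, hx, rfl⟩ := mem_absList.1 ha
    simpa using (h1 t ht).mem x hx
  refine ⟨fun t ht => ?_, fun t ht u hu a hat hau => ?_, fun a ha => ?_⟩
  · rcases Finset.mem_insert.1 ht with rfl | ht
    · exact hs
    · exact ⟨(h1 t ht).ne_nil, fun x hx => (h4 t ht _ (mem_absList.2 ⟨x, hx, rfl⟩)).1,
        (h1 t ht).nodup, (h1 t ht).last, (h1 t ht).zero⟩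
  · rcases Finset.mem_insert.1 ht with ht' | ht' <;> rcases Finset.mem_insert.1 hu with hu' | hu'
    · rw [ht', hu']
    · exact absurd (ht' ▸ hat) (h4 u hu' a hau).2
    · exact absurd (hu' ▸ hau) (h4 t ht' a hat).2
    · exact h2 t ht' u hu' a hat hau
  · by_cases has : a ∈ absList s
    · exact ⟨s, Finset.mem_insert_self _ _, has⟩
    · obtain ⟨t, ht, hat⟩ := h3 a (by simp [ha, has])
      exact ⟨t, Finset.mem_insert_of_mem ht, hat⟩

theorem isSPIL_erase {A : Finset ℕ} {P : Finset (List ℤ)} {s : List ℤ} (hP : IsSPIL A P)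
    (hs : s ∈ P) : IsSPIL (A \ (absList s).toFinset) (P.erase s) := by
  rw [isSPIL_iff] at hP ⊢
  obtain ⟨h1, h2, h3⟩ := hP
  refine ⟨fun t ht => ?_, fun t ht u hu => ?_, fun a ha => ?_⟩
  · obtain ⟨hts, ht⟩ := Finset.mem_erase.1 ht
    refine ⟨(h1 t ht).ne_nil, fun x hx => ?_, (h1 t ht).nodup, (h1 t ht).last, (h1 t ht).zero⟩
    rw [Finset.mem_sdiff, List.mem_toFinset]
    exact ⟨(h1 t ht).mem x hx,
      fun h => hts (h2 t ht s hs _ (mem_absList.2 ⟨x, hx, rfl⟩) h)⟩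
  · exact h2 t (Finset.mem_of_mem_erase ht) u (Finset.mem_of_mem_erase hu)
  · rw [Finset.mem_sdiff, List.mem_toFinset] at ha
    obtain ⟨t, ht, hat⟩ := h3 a ha.1
    refine ⟨t, Finset.mem_erase.2 ⟨?_, ht⟩, hat⟩
    rintro rfl
    exact ha.2 hat

/-- Pairs of a signed list in `A` and a structure on the remaining elements. -/
def listCons {X : Type} (P : Finset ℕ → Set X) (A : Finset ℕ) : Set (List ℤ × X) :=
  {p | ((∀ x ∈ p.1, x.natAbs ∈ A) ∧ (absList p.1).Nodup) ∧ p.2 ∈ P (A \ (absList p.1).toFinset)}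

theorem cons_mem_listCons_iff {X : Type} {P : Finset ℕ → Set X} {A : Finset ℕ} {y : ℤ} {s : List ℤ}
    {z : X} : (y :: s, z) ∈ listCons P A ↔
      y.natAbs ∈ A ∧ (s, z) ∈ listCons P (A.erase y.natAbs) := by
  have h : A \ (absList (y :: s)).toFinset = A.erase y.natAbs \ (absList s).toFinset := by
    ext a
    simp only [absList, List.map_cons, List.toFinset_cons, Finset.mem_sdiff, Finset.mem_insert,
      List.mem_toFinset, Finset.mem_erase]
    tauto
  simp only [listCons, Set.mem_ofPred_eq, h]
  simp only [absList, List.map_cons, List.nodup_cons, List.mem_cons,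
    forall_eq_or_imp, Finset.mem_erase, List.mem_map, not_exists, not_and]
  constructor
  · rintro ⟨⟨⟨h1, h2⟩, h3, h4⟩, h5⟩
    exact ⟨h1, ⟨fun x hx => ⟨h3 x hx, h2 x hx⟩, h4⟩, h5⟩
  · rintro ⟨h1, ⟨h2, h4⟩, h5⟩
    exact ⟨⟨⟨h1, fun x hx => (h2 x hx).2⟩, fun x hx => (h2 x hx).1, h4⟩, h5⟩

/-- The number of pairs of a signed list and a structure on the rest, from the number `f l` of
structures on `l` elements. -/
def consCount (f : ℕ → ℕ) : ℕ → ℕ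
  | 0 => f 0
  | l + 1 => f (l + 1) + 2 * (l + 1) * consCount f l

/-- The nonempty signed lists are obtained by prefixing an element. -/
def listConsEquiv {X : Type} (P : Finset ℕ → Set X) (A : Finset ℕ) (hA : 0 ∉ A) :
    listCons P A ≃ P A ⊕ (Σ y : A × Bool, listCons P (A.erase y.1)) where
  toFun
    | ⟨([], z), h⟩ => .inl ⟨z, by simpa [listCons, absList] using h⟩
    | ⟨(y :: s, z), h⟩ =>
      .inr ⟨(⟨y.natAbs, (cons_mem_listCons_iff.1 h).1⟩, decide (0 ≤ y)), (s, z),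
        (cons_mem_listCons_iff.1 h).2⟩
  invFun
    | .inl z => ⟨([], z.1), by simp [listCons, absList]⟩
    | .inr ⟨(a, ε), p⟩ => ⟨((bif ε then (a.1 : ℤ) else -(a.1 : ℤ)) :: p.1.1, p.1.2), by
        have h : (bif ε then (a.1 : ℤ) else -(a.1 : ℤ)).natAbs = a.1 := by cases ε <;> simp
        rw [cons_mem_listCons_iff, h]
        exact ⟨a.2, p.2⟩⟩
  left_inv := by
    rintro ⟨⟨_ | ⟨y, s⟩, z⟩, h⟩
    · rfl
    · apply Subtype.ext
      simp only [Prod.mk.injEq, List.cons.injEq, and_true]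
      by_cases hy : 0 ≤ y
      · simp [hy]
      · simp only [hy, decide_false, cond_false]
        omega
  right_inv := by
    rintro (z | ⟨⟨⟨a, ha⟩, ε⟩, ⟨⟨s, z⟩, hp⟩⟩)
    · rfl
    · have ha0 : a ≠ 0 := fun h => hA (h ▸ ha)
      have h1 : (bif ε then (a : ℤ) else -(a : ℤ)).natAbs = a := by cases ε <;> simp
      have h2 : decide (0 ≤ (bif ε then (a : ℤ) else -(a : ℤ))) = ε := by
        cases ε
        · simp only [cond_false, decide_eq_false_iff_not]
          omega
        · simp
      simp only [Sum.inr.injEq]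
      rw [Sigma.mk.injEq]
      refine ⟨by simp only [h1, h2], ?_⟩
      congr! 1
      all_goals simp only [h1]

/-- A list is empty, or begins with one of `l` elements in one of two signs and continues on the
other `l - 1`. This is the recursion of `consCount`. -/
theorem card_listCons {X : Type} {P : Finset ℕ → Set X} {f : ℕ → ℕ} {l : ℕ} :
    ∀ {A : Finset ℕ}, 0 ∉ A → A.card = l →
    (∀ A' ⊆ A, (P A').Finite ∧ (P A').ncard = f A'.card) →
    (listCons P A).Finite ∧ (listCons P A).ncard = consCount f l := by
  induction l with
  | zero =>
    intro A hA hl hP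
    have hP' := hP A subset_rfl
    have := hP'.1.to_subtype
    have e := listConsEquiv P A hA
    rw [Finset.card_eq_zero] at hl
    have : IsEmpty (Σ y : A × Bool, listCons P (A.erase y.1)) := by
      rw [hl]
      exact ⟨fun y => absurd y.1.1.2 (Finset.notMem_empty _)⟩
    refine ⟨Set.finite_coe_iff.1 (Finite.of_equiv _ e.symm), ?_⟩
    rw [← Nat.card_coe_set_eq, Nat.card_congr e, Nat.card_sum, Nat.card_of_isEmpty (α := Σ _, _), add_zero,
      Nat.card_coe_set_eq, hP'.2, hl]
    rfl
  | succ l ih =>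
    intro A hA hl hP
    have hP' := hP A subset_rfl
    have := hP'.1.to_subtype
    have e := listConsEquiv P A hA
    have hy : ∀ y : A × Bool, (listCons P (A.erase y.1)).Finite ∧
        (listCons P (A.erase y.1)).ncard = consCount f l := fun y =>
      ih (fun h => hA (Finset.mem_of_mem_erase h)) (by rw [Finset.card_erase_of_mem y.1.2, hl]; rfl)
        fun A' hA' => hP A' (hA'.trans (Finset.erase_subset _ _))
    have : ∀ y : A × Bool, Finite (listCons P (A.erase y.1)) := fun y => (hy y).1.to_subtype
    refine ⟨Set.finite_coe_iff.1 (Finite.of_equiv _ e.symm), ?_⟩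
    rw [← Nat.card_coe_set_eq, Nat.card_congr e, Nat.card_sum, Nat.card_sigma,
      Nat.card_coe_set_eq, hP'.2]
    simp only [Nat.card_coe_set_eq, (hy _).2]
    simp only [Finset.sum_const, Finset.card_univ, Fintype.card_prod, Fintype.card_coe,
      Fintype.card_bool, hl, smul_eq_mul, consCount]
    ring

/-! ### Splitting a partition at a marked element -/

theorem absList_append (s t : List ℤ) : absList (s ++ t) = absList s ++ absList t :=
  List.map_append

/-- Inside a partition the block containing `a` is unique, so it can be identified and removed. -/
theorem eq_of_insert_eq_insert {A : Finset ℕ} {Q Q' : Finset (List ℤ)} {s s' : List ℤ} {a : ℕ}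
    (hs : IsBlock A s) (hs' : IsBlock A s') (hQ : IsSPIL (A \ (absList s).toFinset) Q)
    (hQ' : IsSPIL (A \ (absList s').toFinset) Q') (ha : a ∈ absList s) (ha' : a ∈ absList s')
    (h : insert s Q = insert s' Q') : s = s' ∧ Q = Q' := by
  have h1 : s = s' := (isSPIL_iff.1 (hs'.isSPIL_insert hQ')).2.1 s (h ▸ Finset.mem_insert_self _ _)
    s' (Finset.mem_insert_self _ _) a ha ha'
  subst h1
  refine ⟨rfl, ?_⟩
  have h2 := congrArg (fun P => P.erase s) h
  simpa only [Finset.erase_insert (not_mem_of_isSPIL_sdiff hs.ne_nil hQ),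
    Finset.erase_insert (not_mem_of_isSPIL_sdiff hs.ne_nil hQ')] using h2

/-- Appending the entry `0` gives a block, and every block that contains `0` is of this form. -/
theorem isBlock_append_zero_iff {A : Finset ℕ} (hA : 0 ∉ A) {s : List ℤ} :
    IsBlock (insert 0 A) (s ++ [0]) ↔ (∀ x ∈ s, x.natAbs ∈ A) ∧ (absList s).Nodup := by
  have h : (absList (s ++ [0])).Nodup ↔ (absList s).Nodup ∧ 0 ∉ absList s := by
    rw [absList_append]
    change (absList s ++ [0]).Nodup ↔ _
    rw [List.nodup_append_comm, List.singleton_append, List.nodup_cons, and_comm]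
  constructor
  · intro hs
    obtain ⟨h1, h2⟩ := h.1 hs.nodup
    refine ⟨fun x hx => ?_, h1⟩
    have h3 := hs.mem x (List.mem_append_left _ hx)
    rw [Finset.mem_insert] at h3
    exact h3.resolve_left fun h0 => h2 (mem_absList.2 ⟨x, hx, h0⟩)
  · rintro ⟨h1, h2⟩
    refine ⟨by simp, fun x hx => ?_, h.2 ⟨h2, fun h0 => ?_⟩, by simp, by simp⟩
    · rw [List.mem_append, List.mem_singleton] at hx
      rcases hx with hx | rfl
      · exact Finset.mem_insert_of_mem (h1 x hx)
      · exact Finset.mem_insert_self _ _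
    · obtain ⟨x, hx, hx0⟩ := mem_absList.1 h0
      exact hA (hx0 ▸ h1 x hx)

/-- The block of 0 ends in 0, so its last entry is non-negative automatically and the preceding
signed list is unconstrained. -/
theorem bijOn_SPIL_insert_zero {A : Finset ℕ} (hA : 0 ∉ A) :
    Set.BijOn (fun p : List ℤ × Finset (List ℤ) => insert (p.1 ++ [0]) p.2) (listCons SPIL A)
      (SPIL (insert 0 A)) := by
  have hsd : ∀ s : List ℤ,
      insert 0 A \ (absList (s ++ [0])).toFinset = A \ (absList s).toFinset := by
    intro s
    ext a
    simp only [absList, List.map_append, List.toFinset_append, Finset.mem_sdiff, Finset.mem_insert,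
      Finset.mem_union, List.mem_toFinset, List.map_cons, List.map_nil, List.mem_singleton,
      Int.natAbs_zero, not_or]
    constructor
    · rintro ⟨h1, h2, h3⟩
      exact ⟨h1.resolve_left h3, h2⟩
    · rintro ⟨h1, h2⟩
      exact ⟨Or.inr h1, h2, fun h0 => hA (h0 ▸ h1)⟩
  have h0 : ∀ s : List ℤ, 0 ∈ absList (s ++ [0]) := fun s => mem_absList.2 ⟨0, by simp, rfl⟩
  refine ⟨?_, ?_, ?_⟩
  · rintro ⟨s, Q⟩ ⟨hs, hQ⟩
    exact ((isBlock_append_zero_iff hA).2 hs).isSPIL_insert ((hsd s).symm ▸ hQ)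
  · rintro ⟨s, Q⟩ ⟨hs, hQ⟩ ⟨s', Q'⟩ ⟨hs', hQ'⟩ h
    obtain ⟨h1, h2⟩ := eq_of_insert_eq_insert ((isBlock_append_zero_iff hA).2 hs)
      ((isBlock_append_zero_iff hA).2 hs') ((hsd s).symm ▸ hQ) ((hsd s').symm ▸ hQ') (h0 s) (h0 s') h
    rw [Prod.mk.injEq]
    exact ⟨List.append_cancel_right h1, h2⟩
  · intro P hP
    obtain ⟨h1, h2, h3⟩ := isSPIL_iff.1 hP
    obtain ⟨s, hs, h0s⟩ := h3 0 (Finset.mem_insert_self _ _)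
    obtain ⟨x, hx, hx0⟩ := mem_absList.1 h0s
    rw [Int.natAbs_eq_zero] at hx0
    obtain ⟨t, rfl⟩ := List.getLast?_eq_some_iff.1 ((h1 s hs).zero (hx0 ▸ hx))
    refine ⟨(t, P.erase (t ++ [0])), ⟨(isBlock_append_zero_iff hA).1 (h1 _ hs), ?_⟩,
      Finset.insert_erase hs⟩
    rw [← hsd]
    exact isSPIL_erase hP hs

/-- The list `s`, with all signs changed if the last entry is negative. -/
def normSign (s : List ℤ) : List ℤ := if ∀ x ∈ s.getLast?, 0 ≤ x then s else s.map Neg.neg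

theorem absList_map_neg (s : List ℤ) : absList (s.map Neg.neg) = absList s := by
  simp [absList]

theorem absList_normSign (s : List ℤ) : absList (normSign s) = absList s := by
  unfold normSign
  split_ifs
  · rfl
  · exact absList_map_neg s

theorem forall_natAbs_mem_iff {A : Finset ℕ} {s : List ℤ} :
    (∀ x ∈ s, x.natAbs ∈ A) ↔ ∀ a ∈ absList s, a ∈ A := by
  simp [absList]

theorem isBlock_normSign {A : Finset ℕ} (hA : 0 ∉ A) {s : List ℤ} (hs : s ≠ [])
    (h1 : ∀ x ∈ s, x.natAbs ∈ A) (h2 : (absList s).Nodup) : IsBlock A (normSign s) := by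
  have h3 : ∀ x ∈ normSign s, x.natAbs ∈ A := by
    rw [forall_natAbs_mem_iff, absList_normSign, ← forall_natAbs_mem_iff]
    exact h1
  refine ⟨fun h => hs ?_, h3, by rwa [absList_normSign], fun x hx => ?_,
    fun h => absurd (h3 0 h) hA⟩
  · have := congrArg absList h
    rw [absList_normSign] at this
    exact List.map_eq_nil_iff.1 this
  · unfold normSign at hx
    split_ifs at hx with h
    · exact h x hx
    · push Not at h
      obtain ⟨y, hy, hy0⟩ := h
      rw [List.getLast?_map, Option.mem_def, Option.map_eq_some_iff] at hx
      obtain ⟨z, hz, rfl⟩ := hx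
      obtain rfl : y = z := Option.some_injective _ (hy.symm.trans hz)
      omega

theorem normSign_eq {s t : List ℤ} (h : normSign s = normSign t) : s = t ∨ s = t.map Neg.neg := by
  unfold normSign at h
  split_ifs at h
  · exact Or.inl h
  · exact Or.inr h
  · right
    rw [← h]
    simp
  · exact Or.inl (List.map_injective_iff.2 neg_injective h)

/-- Without 0, the condition on the last entry selects one of the two lists `u` and `-u`. It can be
traded for positivity of the entry ±x: the lists before and after `x` are then free, and `normSign`
restores the original condition. -/
theorem bijOn_SPIL_insert {A : Finset ℕ} (hA : 0 ∉ A) {x : ℕ} (hx : x ∉ A) (hx0 : x ≠ 0) :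
    Set.BijOn (fun p : List ℤ × List ℤ × Finset (List ℤ) =>
      insert (normSign (p.1 ++ (x : ℤ) :: p.2.1)) p.2.2) (listCons (listCons SPIL) A)
      (SPIL (insert x A)) := by
  have hA' : 0 ∉ insert x A := by
    rw [Finset.mem_insert, not_or]
    exact ⟨hx0.symm, hA⟩
  have hsd : ∀ s t : List ℤ, insert x A \ (absList (s ++ (x : ℤ) :: t)).toFinset
      = (A \ (absList s).toFinset) \ (absList t).toFinset := by
    intro s t
    ext a
    simp only [absList, List.map_append, List.toFinset_append, Finset.mem_sdiff, Finset.mem_insert,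
      Finset.mem_union, List.mem_toFinset, List.map_cons, List.mem_cons, Int.natAbs_natCast, not_or]
    constructor
    · rintro ⟨h1, h2, h3, h4⟩
      exact ⟨⟨h1.resolve_left h3, h2⟩, h4⟩
    · rintro ⟨⟨h1, h2⟩, h3⟩
      exact ⟨Or.inr h1, h2, fun h0 => hx (h0 ▸ h1), h3⟩
  have hperm : ∀ s t : List ℤ, (absList (s ++ (x : ℤ) :: t)).Nodup ↔
      ((absList s).Nodup ∧ (absList t).Nodup ∧ ∀ a ∈ absList t, a ∉ absList s) ∧
        x ∉ absList s ∧ x ∉ absList t := by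
    intro s t
    rw [absList_append]
    change (absList s ++ x :: absList t).Nodup ↔ _
    rw [List.nodup_middle, List.nodup_cons, List.nodup_append', List.mem_append, not_or, and_comm]
    refine and_congr_left fun _ => and_congr_right fun _ => and_congr_right fun _ => ?_
    exact ⟨fun h a ha ha' => h ha' ha, fun h a ha ha' => h a ha' ha⟩
  have hmem : ∀ s t : List ℤ, (∀ z ∈ s ++ (x : ℤ) :: t, z.natAbs ∈ insert x A) ∧
      (absList (s ++ (x : ℤ) :: t)).Nodup ↔ ((∀ z ∈ s, z.natAbs ∈ A) ∧ (absList s).Nodup) ∧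
        (∀ z ∈ t, z.natAbs ∈ A \ (absList s).toFinset) ∧ (absList t).Nodup := by
    intro s t
    rw [hperm, forall_natAbs_mem_iff, forall_natAbs_mem_iff, forall_natAbs_mem_iff, absList_append]
    simp only [List.mem_append, Finset.mem_sdiff, List.mem_toFinset]
    change (∀ a, a ∈ absList s ∨ a ∈ x :: absList t → a ∈ insert x A) ∧ _ ↔ _
    simp only [List.mem_cons, Finset.mem_insert]
    constructor
    · rintro ⟨h1, ⟨h2, h3, h4⟩, h5, h6⟩
      exact ⟨⟨fun a ha => (h1 a (Or.inl ha)).resolve_left fun h0 => h5 (h0 ▸ ha), h2⟩,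
        fun a ha => ⟨(h1 a (Or.inr (Or.inr ha))).resolve_left fun h0 => h6 (h0 ▸ ha), h4 a ha⟩, h3⟩
    · rintro ⟨⟨h1, h2⟩, h3, h4⟩
      refine ⟨?_, ⟨h2, h4, fun a ha => (h3 a ha).2⟩, fun h => hx (h1 x h), fun h => hx (h3 x h).1⟩
      rintro a (ha | ha | ha)
      · exact Or.inr (h1 a ha)
      · exact Or.inl ha
      · exact Or.inr (h3 a ha).1
  have hblock : ∀ s t : List ℤ, ((∀ z ∈ s, z.natAbs ∈ A) ∧ (absList s).Nodup) ∧
      (∀ z ∈ t, z.natAbs ∈ A \ (absList s).toFinset) ∧ (absList t).Nodup →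
      IsBlock (insert x A) (normSign (s ++ (x : ℤ) :: t)) := fun s t h =>
    isBlock_normSign hA' (by simp) ((hmem s t).2 h).1 ((hmem s t).2 h).2
  have hxm : ∀ s t : List ℤ, x ∈ absList (normSign (s ++ (x : ℤ) :: t)) := fun s t => by
    rw [absList_normSign]
    exact mem_absList.2 ⟨x, by simp, by simp⟩
  refine ⟨?_, ?_, ?_⟩
  · rintro ⟨s, t, Q⟩ ⟨hs, ht, hQ⟩
    refine (hblock s t ⟨hs, ht⟩).isSPIL_insert ?_
    rw [absList_normSign, hsd]
    exact hQ
  · rintro ⟨s, t, Q⟩ ⟨hs, ht, hQ⟩ ⟨s', t', Q'⟩ ⟨hs', ht', hQ'⟩ h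
    obtain ⟨h1, h2⟩ := eq_of_insert_eq_insert (hblock s t ⟨hs, ht⟩) (hblock s' t' ⟨hs', ht'⟩)
      (by rw [absList_normSign, hsd]; exact hQ) (by rw [absList_normSign, hsd]; exact hQ')
      (hxm s t) (hxm s' t') h
    have hn := (hperm s t).1 ((hmem s t).2 ⟨hs, ht⟩).2
    have hn' := (hperm s' t').1 ((hmem s' t').2 ⟨hs', ht'⟩).2
    have hne : ∀ {u : List ℤ} {y : ℤ}, y.natAbs = x → x ∉ absList u → y ∉ u := fun hy hu hyu =>
      hu (mem_absList.2 ⟨_, hyu, hy⟩)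
    rcases normSign_eq h1 with h3 | h3
    · obtain ⟨h4, -, h5⟩ := (List.append_cons_inj_of_notMem (hne (Int.natAbs_natCast x) hn.2.1)
        (hne (Int.natAbs_natCast x) hn.2.2)).1 h3
      rw [h4, h5, show Q = Q' from h2]
    -- Opposite lists would put -x into s' ++ x :: t', where the absolute value x occurs only once,
    -- with sign +.
    · exfalso
      have h4 : (x : ℤ) ∈ (s' ++ (x : ℤ) :: t').map Neg.neg := by
        rw [← h3]
        simp
      rw [List.mem_map] at h4
      obtain ⟨y, hy, hyx⟩ := h4
      rw [List.mem_append, List.mem_cons] at hy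
      rcases hy with hy | hy | hy
      · exact hne (by omega) hn'.2.1 hy
      · omega
      · exact hne (by omega) hn'.2.2 hy
  · intro P hP
    obtain ⟨h1, h2, h3⟩ := isSPIL_iff.1 hP
    obtain ⟨u, hu, hxu⟩ := h3 x (Finset.mem_insert_self _ _)
    obtain ⟨s, t, hst, hst'⟩ : ∃ s t, normSign (s ++ (x : ℤ) :: t) = u ∧
        absList (s ++ (x : ℤ) :: t) = absList u := by
      obtain ⟨y, hy, hyx⟩ := mem_absList.1 hxu
      obtain ⟨s, t, rfl⟩ := List.append_of_mem hy
      have hlast := (h1 _ hu).last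
      by_cases hy0 : 0 ≤ y
      · obtain rfl : y = x := by omega
        exact ⟨s, t, if_pos hlast, rfl⟩
      · obtain rfl : y = -x := by omega
        have h4 : s.map Neg.neg ++ (x : ℤ) :: t.map Neg.neg
            = (s ++ -(x : ℤ) :: t).map Neg.neg := by simp
        refine ⟨s.map Neg.neg, t.map Neg.neg, ?_, by rw [h4, absList_map_neg]⟩
        rw [h4]
        unfold normSign
        rw [if_neg]
        · simp
        · push Not
          obtain ⟨z, hz⟩ : ∃ z, (s ++ -(x : ℤ) :: t).getLast? = some z := by
            rw [← Option.isSome_iff_exists, List.getLast?_isSome]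
            simp
          have h5 := hlast z hz
          have h6 : z ≠ 0 := by
            rintro rfl
            exact hA' ((h1 _ hu).mem 0 (List.mem_of_getLast? hz))
          refine ⟨-z, by rw [List.getLast?_map, hz]; rfl, by omega⟩
    obtain ⟨h4, h5⟩ := (hmem s t).1 ⟨by
      rw [forall_natAbs_mem_iff, hst', ← forall_natAbs_mem_iff]
      exact (h1 u hu).mem, hst' ▸ (h1 u hu).nodup⟩
    refine ⟨(s, t, P.erase u), ⟨h4, h5, ?_⟩, ?_⟩
    · rw [← hsd, hst']
      exact isSPIL_erase hP hu
    · change insert (normSign (s ++ (x : ℤ) :: t)) (P.erase u) = P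
      rw [hst, Finset.insert_erase hu]

/-- The common value of the numbers of orbits and of partitions into signed lists. -/
def orbitCount : ℕ → ℕ
  | 0 => 1
  | 1 => 1
  | n + 2 => orbitCount (n + 1) + 2 * ((n + 1) / 2) * orbitCount n

/-- Both parities of the recursion are consequences of `consCount`: with f counting the SPILs
without 0, one list on top counts those with 0. -/
theorem consCount_even (l : ℕ) : consCount (fun l => orbitCount (2 * l)) l = orbitCount (2 * l + 1) := by
  induction l with
  | zero => rfl
  | succ l ih =>
    rw [consCount, ih, show 2 * (l + 1) + 1 = 2 * l + 1 + 2 by ring, orbitCount,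
      show (2 * l + 1 + 1) / 2 = l + 1 by omega]
    rfl

/-- A second list on top counts the SPILs with one more nonzero element, namely the marked one. -/
theorem consCount_odd (l : ℕ) :
    consCount (fun l => orbitCount (2 * l + 1)) l = orbitCount (2 * l + 2) := by
  induction l with
  | zero => rfl
  | succ l ih =>
    rw [consCount, ih, show 2 * (l + 1) + 2 = 2 * l + 2 + 2 by ring, orbitCount.eq_3 (2 * l + 2),
      show (2 * l + 2 + 1) / 2 = l + 1 by omega]
    rfl

theorem card_SPIL_of_bijOn {X : Type} {f : X → Finset (List ℤ)} {S : Set X} {A : Finset ℕ} {c : ℕ}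
    (hf : Set.BijOn f S (SPIL A)) (hS : S.Finite ∧ S.ncard = c) :
    (SPIL A).Finite ∧ (SPIL A).ncard = c := by
  rw [← hf.image_eq]
  exact ⟨hS.1.image f, hf.injOn.ncard_image.trans hS.2⟩

theorem card_SPIL {l : ℕ} : ∀ {A : Finset ℕ}, 0 ∉ A → A.card = l →
    (SPIL A).Finite ∧ (SPIL A).ncard = orbitCount (2 * l) := by
  induction l using Nat.strong_induction_on with
  | _ l ih =>
    intro A hA hl
    rcases A.eq_empty_or_nonempty with rfl | ⟨x, hx⟩
    · have h : SPIL ∅ = {∅} := by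
        ext P
        rw [Set.mem_singleton_iff]
        constructor
        · intro hP
          rw [Finset.eq_empty_iff_forall_notMem]
          intro s hs
          have h1 := (isSPIL_iff.1 hP).1 s hs
          obtain ⟨x, hx⟩ := List.exists_mem_of_ne_nil s h1.ne_nil
          exact Finset.notMem_empty _ (h1.mem x hx)
        · rintro rfl
          exact isSPIL_iff.2 (by simp)
      rw [h, ← hl]
      simp [orbitCount]
    · have h1 : A.card = (A.erase x).card + 1 := (Finset.card_erase_add_one hx).symm
      have h0 : ∀ {A' : Finset ℕ}, A' ⊆ A.erase x → 0 ∉ A' := fun hs h =>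
        hA (Finset.mem_of_mem_erase (hs h))
      have h2 := bijOn_SPIL_insert (h0 subset_rfl) (Finset.notMem_erase x A)
        (fun h => hA (h ▸ hx))
      rw [Finset.insert_erase hx] at h2
      have h3 : ∀ A' ⊆ A.erase x, (SPIL A').Finite ∧ (SPIL A').ncard = orbitCount (2 * A'.card) :=
        fun A' hA' => ih _ (by have := Finset.card_le_card hA'; omega) (h0 hA') rfl
      have h4 : ∀ A' ⊆ A.erase x, (listCons SPIL A').Finite ∧
          (listCons SPIL A').ncard = orbitCount (2 * A'.card + 1) := fun A' hA' => by
        rw [← consCount_even]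
        exact card_listCons (f := fun l => orbitCount (2 * l)) (h0 hA') rfl
          fun A'' hA'' => h3 A'' (hA''.trans hA')
      have h5 := card_listCons (f := fun l => orbitCount (2 * l + 1)) (h0 subset_rfl) rfl h4
      rw [consCount_odd, show 2 * (A.erase x).card + 2 = 2 * l by omega] at h5
      exact card_SPIL_of_bijOn h2 h5

theorem card_SPIL_insert_zero {l : ℕ} {A : Finset ℕ} (hA : 0 ∉ A) (hl : A.card = l) :
    (SPIL (insert 0 A)).Finite ∧ (SPIL (insert 0 A)).ncard = orbitCount (2 * l + 1) := by
  refine card_SPIL_of_bijOn (bijOn_SPIL_insert_zero hA) ?_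
  rw [← consCount_even]
  exact card_listCons (f := fun l => orbitCount (2 * l)) hA hl
    fun A' hA' => card_SPIL (fun h => hA (hA' h)) rfl

end OrthoCount

namespace OrthoCount

open Module Matrix

/-! ### Borel subalgebras are stabilizers of full isotropic flags -/

section Borel

variable {n : ℕ}

/-- The form `β` as a bilinear form. -/
noncomputable def betaForm (n : ℕ) : LinearMap.BilinForm ℂ (Fin n → ℂ) := Matrix.toBilin' (S n)

theorem betaForm_apply (x y : Fin n → ℂ) : betaForm n x y = beta x y :=
  Matrix.toBilin'_apply' _ _ _

theorem S_mulVec (y : Fin n → ℂ) (i : Fin n) : (S n *ᵥ y) i = y (Fin.rev i) := by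
  have h : ∀ j, S n i j = if j = Fin.rev i then 1 else 0 := fun j => by
    simp only [S, Matrix.of_apply]
    congr 1
    rw [eq_iff_iff]
    exact ⟨fun h => by rw [h, Fin.rev_rev], fun h => by rw [h, Fin.rev_rev]⟩
  simp [Matrix.mulVec, dotProduct, h]

theorem beta_eq_sum (x y : Fin n → ℂ) : beta x y = ∑ i, x i * y (Fin.rev i) := by
  simp only [beta, dotProduct, S_mulVec]

theorem beta_single_left (i : Fin n) (y : Fin n → ℂ) : beta (Pi.single i 1) y = y (Fin.rev i) := by
  rw [beta, single_one_dotProduct, S_mulVec]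

theorem isQuad_betaForm (n : ℕ) : IsQuad (betaForm n) n := by
  refine ⟨inferInstance, fun x y => ?_, fun x hx => ?_, by simp⟩
  · rw [betaForm_apply, betaForm_apply, beta_eq_sum, beta_eq_sum, ← Equiv.sum_comp Fin.revPerm]
    refine Finset.sum_congr rfl fun i _ => ?_
    rw [Fin.revPerm_apply, Fin.rev_rev, mul_comm]
  · ext i
    have h := hx (Pi.single (Fin.rev i) 1)
    rw [betaForm_apply, beta_eq_sum, Finset.sum_eq_single i] at h
    · simpa using h
    · intro j _ hj
      rw [Pi.single_eq_of_ne, mul_zero]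
      exact fun h => hj (Fin.rev_injective h)
    · simp

theorem mem_so_iff {Z : Matrix (Fin n) (Fin n) ℂ} :
    Z ∈ so n ↔ ∀ x y, betaForm n (Z *ᵥ x) y = -betaForm n x (Z *ᵥ y) := by
  simp only [betaForm_apply]
  rfl

theorem betaForm_so (Z : so n) (x y : Fin n → ℂ) :
    betaForm n (Z.1 *ᵥ x) y = -betaForm n x (Z.1 *ᵥ y) := mem_so_iff.1 Z.2 x y

theorem so_bracket_mulVec (Z W : so n) (x : Fin n → ℂ) :
    (⁅Z, W⁆ : so n).1 *ᵥ x = Z.1 *ᵥ (W.1 *ᵥ x) - W.1 *ᵥ (Z.1 *ᵥ x) := by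
  rw [LieSubalgebra.coe_bracket, Ring.lie_def, sub_mulVec, mulVec_mulVec, mulVec_mulVec]

/-- The stabilizer in `so(n)` of a sequence of subspaces. -/
def flagStab (E : ℕ → Submodule ℂ (Fin n → ℂ)) : LieSubalgebra ℂ (so n) where
  carrier := {Z | ∀ i, ∀ x ∈ E i, Z.1 *ᵥ x ∈ E i}
  zero_mem' := fun i x _ => by
    change (0 : Matrix (Fin n) (Fin n) ℂ) *ᵥ x ∈ E i
    simp
  add_mem' := fun {Z W} hZ hW i x hx => by
    change (Z.1 + W.1) *ᵥ x ∈ E i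
    rw [add_mulVec]
    exact Submodule.add_mem _ (hZ i x hx) (hW i x hx)
  smul_mem' := fun c Z hZ i x hx => by
    change (c • Z.1) *ᵥ x ∈ E i
    rw [smul_mulVec]
    exact Submodule.smul_mem _ _ (hZ i x hx)
  lie_mem' := fun {Z W} hZ hW i x hx => by
    rw [so_bracket_mulVec]
    exact Submodule.sub_mem _ (hZ i _ (hW i x hx)) (hW i _ (hZ i x hx))

/-! #### Solvable subalgebras stabilize flags -/

/-- Lie's theorem for the action of `c` on the nonzero quotient Q/P; the eigenvector is lifted to
`Q`. -/
theorem exists_common_eigenvector {c : LieSubalgebra ℂ (so n)} (hc : LieAlgebra.IsSolvable c)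
    {P Q : Submodule ℂ (Fin n → ℂ)} (hPQ : P < Q) (hP : ∀ Z ∈ c, ∀ x ∈ P, Z.1 *ᵥ x ∈ P)
    (hQ : ∀ Z ∈ c, ∀ x ∈ Q, Z.1 *ᵥ x ∈ Q) :
    ∃ z ∈ Q, z ∉ P ∧ ∀ Z ∈ c, ∃ χ : ℂ, Z.1 *ᵥ z - χ • z ∈ P := by
  let P' : Submodule ℂ Q := P.comap Q.subtype
  let r : c → Module.End ℂ Q := fun Z => (Matrix.mulVecLin Z.1.1).restrict (hQ Z.1 Z.2)
  have hr : ∀ (Z : c) (x : Q), ((r Z x : Q) : Fin n → ℂ) = Z.1.1 *ᵥ x.1 := fun _ _ => rfl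
  have hrP : ∀ Z, P' ≤ P'.comap (r Z) := fun Z x hx => hP Z.1 Z.2 x.1 hx
  let ρ : c →ₗ⁅ℂ⁆ Module.End ℂ (Q ⧸ P') :=
    { toFun := fun Z => P'.mapQ P' (r Z) (hrP Z)
      map_add' := fun Z W => by
        apply Submodule.linearMap_qext
        ext x : 1
        simp only [LinearMap.comp_apply, Submodule.mkQ_apply, Submodule.mapQ_apply,
          LinearMap.add_apply, ← Submodule.Quotient.mk_add]
        congr 1
        apply Subtype.ext
        exact add_mulVec Z.1.1 W.1.1 x.1
      map_smul' := fun a Z => by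
        apply Submodule.linearMap_qext
        ext x : 1
        simp only [LinearMap.comp_apply, Submodule.mkQ_apply, Submodule.mapQ_apply,
          LinearMap.smul_apply, RingHom.id_apply, ← Submodule.Quotient.mk_smul]
        congr 1
        apply Subtype.ext
        exact smul_mulVec a Z.1.1 x.1
      map_lie' := fun {Z W} => by
        apply Submodule.linearMap_qext
        ext x : 1
        simp only [LinearMap.comp_apply, Submodule.mkQ_apply, Submodule.mapQ_apply,
          LieRing.of_associative_ring_bracket, LinearMap.sub_apply, Module.End.mul_apply,
          ← Submodule.Quotient.mk_sub]
        congr 1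
        apply Subtype.ext
        exact so_bracket_mulVec Z.1 W.1 x.1 }
  have hnt : Nontrivial (Q ⧸ P') := by
    rw [Submodule.Quotient.nontrivial_iff]
    intro htop
    apply hPQ.not_ge
    intro x hx
    have : (⟨x, hx⟩ : Q) ∈ P' := htop ▸ Submodule.mem_top
    exact this
  have hsol : LieAlgebra.IsSolvable ρ.range := inferInstance
  obtain ⟨χ, hχ⟩ := LieModule.exists_nontrivial_weightSpace_of_isSolvable ℂ ρ.range (Q ⧸ P')
  obtain ⟨⟨v, hv⟩, hv0⟩ := exists_ne (0 : LieModule.weightSpace (Q ⧸ P') χ)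
  rw [LieModule.mem_weightSpace] at hv
  obtain ⟨z, rfl⟩ := Submodule.Quotient.mk_surjective _ v
  refine ⟨z.1, z.2, fun hz => hv0 ?_, fun Z hZ => ?_⟩
  · apply Subtype.ext
    exact (Submodule.Quotient.mk_eq_zero P').2 hz
  · refine ⟨χ ⟨ρ ⟨Z, hZ⟩, ⟨Z, hZ⟩, rfl⟩, ?_⟩
    have h1 := hv ⟨ρ ⟨Z, hZ⟩, ⟨Z, hZ⟩, rfl⟩
    have h2 : (Submodule.Quotient.mk (r ⟨Z, hZ⟩ z) : Q ⧸ P')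
      = χ ⟨ρ ⟨Z, hZ⟩, ⟨Z, hZ⟩, rfl⟩ • Submodule.Quotient.mk z := h1
    rw [← Submodule.Quotient.mk_smul, Submodule.Quotient.eq] at h2
    exact h2

theorem finrank_sup_span_singleton {V : Type*} [AddCommGroup V] [Module ℂ V]
    [FiniteDimensional ℂ V] {P : Submodule ℂ V} {z : V} (hz : z ∉ P) :
    finrank ℂ (P ⊔ Submodule.span ℂ {z} : Submodule ℂ V) = finrank ℂ P + 1 := by
  have h0 : z ≠ 0 := fun h => hz (h ▸ P.zero_mem)
  have h1 := Submodule.finrank_sup_add_finrank_inf_eq P (Submodule.span ℂ {z})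
  have h2 : P ⊓ Submodule.span ℂ {z} = ⊥ := by
    rw [← disjoint_iff, Submodule.disjoint_span_singleton' h0]
    exact hz
  rw [h2, finrank_bot, finrank_span_singleton h0] at h1
  omega

theorem mem_sup_span_singleton_iff {V : Type*} [AddCommGroup V] [Module ℂ V] {P : Submodule ℂ V}
    {z x : V} : x ∈ P ⊔ Submodule.span ℂ {z} ↔ ∃ p ∈ P, ∃ a : ℂ, x = p + a • z := by
  simp only [Submodule.mem_sup, Submodule.mem_span_singleton]
  constructor
  · rintro ⟨p, hp, _, ⟨a, rfl⟩, rfl⟩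
    exact ⟨p, hp, a, rfl⟩
  · rintro ⟨p, hp, a, rfl⟩
    exact ⟨p, hp, _, ⟨a, rfl⟩, rfl⟩

/-- A solvable subalgebra stabilizes an isotropic extension of a stable isotropic subspace. -/
theorem exists_isotropic_extension {c : LieSubalgebra ℂ (so n)} (hc : LieAlgebra.IsSolvable c)
    {P : Submodule ℂ (Fin n → ℂ)} (hP : ∀ Z ∈ c, ∀ x ∈ P, Z.1 *ᵥ x ∈ P)
    (hiso : ∀ x ∈ P, ∀ y ∈ P, betaForm n x y = 0) (hd : 2 * (finrank ℂ P + 1) ≤ n) :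
    ∃ Q, P ≤ Q ∧ (∀ Z ∈ c, ∀ x ∈ Q, Z.1 *ᵥ x ∈ Q) ∧ (∀ x ∈ Q, ∀ y ∈ Q, betaForm n x y = 0) ∧
      finrank ℂ Q = finrank ℂ P + 1 := by
  have hB := isQuad_betaForm n
  -- it suffices to find a suitable vector
  suffices h : ∃ z, z ∉ P ∧ (∀ x ∈ P, betaForm n x z = 0) ∧ betaForm n z z = 0 ∧
      ∀ Z ∈ c, ∃ χ : ℂ, Z.1 *ᵥ z - χ • z ∈ P by
    obtain ⟨z, hz, hPz, hzz, hZz⟩ := h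
    refine ⟨P ⊔ Submodule.span ℂ {z}, le_sup_left, fun Z hZ x hx => ?_, fun x hx y hy => ?_,
      finrank_sup_span_singleton hz⟩
    · obtain ⟨x', hx', a, rfl⟩ := mem_sup_span_singleton_iff.1 hx
      obtain ⟨χ, hχ⟩ := hZz Z hZ
      have h1 : Z.1 *ᵥ (x' + a • z) = (Z.1 *ᵥ x' + a • (Z.1 *ᵥ z - χ • z)) + (a * χ) • z := by
        rw [mulVec_add, mulVec_smul, smul_sub, smul_smul]
        abel
      rw [h1]
      exact Submodule.add_mem_sup (Submodule.add_mem _ (hP Z hZ x' hx') (Submodule.smul_mem _ _ hχ))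
        (Submodule.smul_mem _ _ (Submodule.mem_span_singleton_self _))
    · obtain ⟨x', hx', a, rfl⟩ := mem_sup_span_singleton_iff.1 hx
      obtain ⟨y', hy', b, rfl⟩ := mem_sup_span_singleton_iff.1 hy
      have h1 := (hB.symm z y').trans (hPz y' hy')
      simp [hiso x' hx' y' hy', hPz x' hx', h1, hzz]
  have hperp : ∀ R : Submodule ℂ (Fin n → ℂ), (∀ Z ∈ c, ∀ x ∈ R, Z.1 *ᵥ x ∈ R) →
      ∀ Z ∈ c, ∀ x ∈ (betaForm n).orthogonal R, Z.1 *ᵥ x ∈ (betaForm n).orthogonal R := by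
    intro R hR Z hZ x hx y hy
    have h1 := betaForm_so Z y x
    have h2 : betaForm n (Z.1 *ᵥ y) x = 0 := hx _ (hR Z hZ y hy)
    rw [h2] at h1
    exact neg_eq_zero.1 h1.symm
  have hPperp : P ≤ (betaForm n).orthogonal P := fun x hx y hy => hiso y hy x hx
  -- Since 2 (dim P + 1) ≤ n, the quotient P^⊥/P has dimension at least two, leaving room for a
  -- second eigenvector should the first be anisotropic.
  have hPlt : P < (betaForm n).orthogonal P := by
    refine lt_of_le_of_ne hPperp fun he => ?_
    have h1 := hB.finrank_orthogonal P
    rw [← he] at h1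
    omega
  obtain ⟨z, hzP', hzP, hz⟩ := exists_common_eigenvector hc hPlt hP (hperp P hP)
  have hzP'' : ∀ x ∈ P, betaForm n x z = 0 := hzP'
  by_cases hzz : betaForm n z z = 0
  · exact ⟨z, hzP, hzP'', hzz, hz⟩
  -- anisotropic eigenvectors have weight zero
  have hweight : ∀ w, (∀ x ∈ P, betaForm n x w = 0) → betaForm n w w ≠ 0 →
      (∀ Z ∈ c, ∃ χ : ℂ, Z.1 *ᵥ w - χ • w ∈ P) → ∀ Z ∈ c, Z.1 *ᵥ w ∈ P := by
    intro w hw hww hZw Z hZ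
    obtain ⟨χ, hχ⟩ := hZw Z hZ
    have h1 := hw _ hχ
    have h2 := betaForm_so Z w w
    rw [hB.symm w] at h2
    simp only [map_sub, map_smul, LinearMap.sub_apply, LinearMap.smul_apply, smul_eq_mul] at h1
    have h3 : χ * betaForm n w w = 0 := by linear_combination h2 / 2 - h1
    rw [(mul_eq_zero.1 h3).resolve_right hww, zero_smul, sub_zero] at hχ
    exact hχ
  have hz0 := hweight z hzP'' hzz hz
  set R := P ⊔ Submodule.span ℂ {z} with hR
  have hRst : ∀ Z ∈ c, ∀ x ∈ R, Z.1 *ᵥ x ∈ R := by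
    intro Z hZ x hx
    obtain ⟨x', hx', a, rfl⟩ := mem_sup_span_singleton_iff.1 hx
    rw [mulVec_add, mulVec_smul]
    exact Submodule.mem_sup_left
      (Submodule.add_mem _ (hP Z hZ x' hx') (Submodule.smul_mem _ _ (hz0 Z hZ)))
  have hPR : P < (betaForm n).orthogonal R := by
    have h1 : P ≤ (betaForm n).orthogonal R := by
      intro x hx y hy
      obtain ⟨y', hy', a, rfl⟩ := mem_sup_span_singleton_iff.1 hy
      change betaForm n (y' + a • z) x = 0
      simp [hiso y' hy' x hx, (hB.symm z x).trans (hzP'' x hx)]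
    refine lt_of_le_of_ne h1 fun he => ?_
    have h2 := hB.finrank_orthogonal R
    rw [← he, hR, finrank_sup_span_singleton hzP] at h2
    omega
  obtain ⟨w, hwR, hwP, hw⟩ := exists_common_eigenvector hc hPR hP (hperp R hRst)
  have hwP' : ∀ x ∈ P, betaForm n x w = 0 := fun x hx => hwR x (Submodule.mem_sup_left hx)
  have hzw : betaForm n z w = 0 :=
    hwR z (Submodule.mem_sup_right (Submodule.mem_span_singleton_self _))
  by_cases hww : betaForm n w w = 0
  · exact ⟨w, hwP, hwP', hww, hw⟩
  have hw0 := hweight w hwP' hww hw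
  -- Both `z` and `w` are orthogonal to each other, anisotropic and killed modulo `P`, so z + a w is
  -- also killed; a² = -β(z,z)/β(w,w) makes it isotropic.
  obtain ⟨a, ha⟩ := IsAlgClosed.exists_pow_nat_eq (-betaForm n z z / betaForm n w w) (n := 2)
    (by norm_num)
  refine ⟨z + a • w, fun hm => ?_, fun x hx => ?_, ?_, fun Z hZ => ⟨0, ?_⟩⟩
  · have h1 : betaForm n z (z + a • w) = 0 := (hB.symm _ _).trans (hzP'' _ hm)
    rw [map_add, map_smul, hzw, smul_zero, add_zero] at h1
    exact hzz h1
  · simp [hzP'' x hx, hwP' x hx]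
  · have h1 := (hB.symm w z).trans hzw
    simp only [map_add, map_smul, LinearMap.add_apply, LinearMap.smul_apply, smul_eq_mul, hzw, h1]
    field_simp at ha
    linear_combination ha
  · rw [zero_smul, sub_zero, mulVec_add, mulVec_smul]
    exact Submodule.add_mem _ (hz0 Z hZ) (Submodule.smul_mem _ _ (hw0 Z hZ))

theorem exists_flag_of_isSolvable {c : LieSubalgebra ℂ (so n)} (hc : LieAlgebra.IsSolvable c) :
    ∃ E, IsFlag (betaForm n) E (n / 2) ∧ c ≤ flagStab E := by
  suffices h : ∀ m ≤ n / 2, ∃ E, IsFlag (betaForm n) E m ∧ c ≤ flagStab E from h _ le_rfl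
  intro m
  induction m with
  | zero =>
    intro _
    refine ⟨fun _ => ⊥, ⟨fun _ _ _ => le_rfl, by simp, by simp⟩, fun Z _ i x hx => ?_⟩
    rw [Submodule.mem_bot] at hx ⊢
    rw [hx, mulVec_zero]
  | succ m ih =>
    intro hm
    obtain ⟨E, hE, hcE⟩ := ih (by omega)
    have hEm := hE.dim m
    rw [min_self] at hEm
    obtain ⟨Q, hPQ, hQ, hQiso, hQd⟩ := exists_isotropic_extension hc
      (fun Z hZ => hcE hZ m) (hE.iso m) (by omega)
    refine ⟨fun i => if i ≤ m then E i else Q, ⟨?_, fun i => ?_, fun i => ?_⟩, fun Z hZ i => ?_⟩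
    · refine monotone_nat_of_le_succ fun i => ?_
      split_ifs with h1 h2 h2
      · exact hE.mono (Nat.le_succ i)
      · exact (hE.mono h1).trans hPQ
      · omega
      · exact le_rfl
    · split_ifs
      · exact hE.iso i
      · exact hQiso
    · by_cases h1 : i ≤ m
      · rw [if_pos h1, hE.dim]
        omega
      · rw [if_neg h1, hQd, hEm]
        omega
    · by_cases h1 : i ≤ m
      · simpa only [if_pos h1] using hcE hZ i
      · simpa only [if_neg h1] using hQ Z hZ

/-! #### Stabilizers of full flags are solvable -/

/-- `Z` and `W` act on Q/P, of dimension at most one, by scalars, which commute. -/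
theorem bracket_mulVec_mem {Z W : so n} {P Q : Submodule ℂ (Fin n → ℂ)} (hPQ : P ≤ Q)
    (hd : finrank ℂ Q ≤ finrank ℂ P + 1) (hZP : ∀ x ∈ P, Z.1 *ᵥ x ∈ P)
    (hWP : ∀ x ∈ P, W.1 *ᵥ x ∈ P) (hZQ : ∀ x ∈ Q, Z.1 *ᵥ x ∈ Q) (hWQ : ∀ x ∈ Q, W.1 *ᵥ x ∈ Q)
    {x : Fin n → ℂ} (hx : x ∈ Q) : (⁅Z, W⁆ : so n).1 *ᵥ x ∈ P := by
  rw [so_bracket_mulVec]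
  by_cases hxP : x ∈ P
  · exact Submodule.sub_mem _ (hZP _ (hWP x hxP)) (hWP _ (hZP x hxP))
  have hQ : Q = P ⊔ Submodule.span ℂ {x} := by
    symm
    apply Submodule.eq_of_le_of_finrank_le
    · rw [sup_le_iff, Submodule.span_singleton_le_iff_mem]
      exact ⟨hPQ, hx⟩
    · rwa [finrank_sup_span_singleton hxP]
  have key : ∀ y ∈ Q, ∃ p ∈ P, ∃ a : ℂ, y = p + a • x := fun y hy =>
    mem_sup_span_singleton_iff.1 (hQ ▸ hy)
  obtain ⟨p, hp, a, ha⟩ := key _ (hZQ x hx)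
  obtain ⟨q, hq, b, hb⟩ := key _ (hWQ x hx)
  rw [ha, hb, mulVec_add, mulVec_add, mulVec_smul, mulVec_smul, ha, hb]
  have h1 : Z.1 *ᵥ q + b • (p + a • x) - (W.1 *ᵥ p + a • (q + b • x))
      = (Z.1 *ᵥ q + b • p) - (W.1 *ᵥ p + a • q) := by
    rw [smul_add, smul_add, smul_smul, smul_smul, mul_comm b a]
    abel
  rw [h1]
  exact Submodule.sub_mem _ (Submodule.add_mem _ (hZP q hq) (Submodule.smul_mem _ _ hp))
    (Submodule.add_mem _ (hWP p hp) (Submodule.smul_mem _ _ hq))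

/-- The first derived algebra lowers the chain by one step, and each further derivation lowers it by
at least one more, until everything lands in `G 0`. -/
theorem isSolvable_of_chain {c : LieSubalgebra ℂ (so n)} {G : ℕ → Submodule ℂ (Fin n → ℂ)}
    (hmono : Monotone G) (hd : ∀ i, finrank ℂ (G (i + 1)) ≤ finrank ℂ (G i) + 1) (h0 : G 0 = ⊥)
    (htop : G n = ⊤) (hc : ∀ Z ∈ c, ∀ i, ∀ x ∈ G i, Z.1 *ᵥ x ∈ G i) : LieAlgebra.IsSolvable c := by
  -- the elements that lower the index by `k`
  let N : ℕ → Submodule ℂ c := fun k =>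
    { carrier := {Z | ∀ i, ∀ x ∈ G i, Z.1.1 *ᵥ x ∈ G (i - k)}
      zero_mem' := fun i x _ => by
        change (0 : Matrix (Fin n) (Fin n) ℂ) *ᵥ x ∈ _
        simp
      add_mem' := fun {Z W} hZ hW i x hx => by
        change (Z.1.1 + W.1.1) *ᵥ x ∈ _
        rw [add_mulVec]
        exact Submodule.add_mem _ (hZ i x hx) (hW i x hx)
      smul_mem' := fun a Z hZ i x hx => by
        change (a • Z.1.1) *ᵥ x ∈ _
        rw [smul_mulVec]
        exact Submodule.smul_mem _ _ (hZ i x hx) }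
  have hN : ∀ k, (LieAlgebra.derivedSeries ℂ c (k + 1)).toSubmodule ≤ N (k + 1) := by
    intro k
    induction k with
    | zero =>
      rw [LieAlgebra.derivedSeries_def, LieAlgebra.derivedSeriesOfIdeal_succ,
        LieSubmodule.lieIdeal_oper_eq_linear_span', Submodule.span_le]
      rintro _ ⟨Z, -, W, -, rfl⟩ i x hx
      rcases i with _ | i
      · exact hc _ (⁅Z, W⁆ : c).2 0 x hx
      · exact bracket_mulVec_mem (hmono (Nat.le_succ i)) (hd i) (hc _ Z.2 i) (hc _ W.2 i)
          (hc _ Z.2 (i + 1)) (hc _ W.2 (i + 1)) hx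
    | succ k ih =>
      rw [LieAlgebra.derivedSeries_def, LieAlgebra.derivedSeriesOfIdeal_succ,
        LieSubmodule.lieIdeal_oper_eq_linear_span', Submodule.span_le]
      rintro _ ⟨Z, hZ, W, hW, rfl⟩ i x hx
      have hZ' : Z ∈ N (k + 1) := ih hZ
      have hW' : W ∈ N (k + 1) := ih hW
      have h1 : (⁅Z, W⁆ : c).1.1 *ᵥ x = _ := so_bracket_mulVec Z.1 W.1 x
      rw [h1]
      exact Submodule.sub_mem _ (hmono (by omega) (hZ' _ _ (hW' _ _ hx)))
        (hmono (by omega) (hW' _ _ (hZ' _ _ hx)))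
  -- At level n + 1 the truncated index n - (n + 1) is 0, so the operators send `G n`, the whole
  -- space, to zero.
  apply LieAlgebra.IsSolvable.mk (R := ℂ) (k := n + 1)
  rw [eq_bot_iff]
  intro Z hZ
  have h1 : Z ∈ N (n + 1) := hN n hZ
  have h2 : Z.1.1 = 0 := by
    apply Matrix.mulVec_injective
    ext x : 1
    have h3 := h1 n x (htop ▸ Submodule.mem_top)
    rw [show n - (n + 1) = 0 by omega, h0, Submodule.mem_bot] at h3
    rw [h3, zero_mulVec]
  rw [LieSubmodule.mem_bot]
  exact Subtype.ext (Subtype.ext h2)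

/-- Skew-adjoint operators that preserve `E i` preserve its orthogonal complement, so `E` extends by
the complements to a complete chain in ℂⁿ. -/
theorem isSolvable_flagStab {E : ℕ → Submodule ℂ (Fin n → ℂ)}
    (hE : IsFlag (betaForm n) E (n / 2)) : LieAlgebra.IsSolvable (flagStab E) := by
  have hB := isQuad_betaForm n
  let G : ℕ → Submodule ℂ (Fin n → ℂ) := fun i =>
    if i ≤ n / 2 then E i else (betaForm n).orthogonal (E (n - i))
  have hGd : ∀ i, finrank ℂ (G i) = min i n := by
    intro i
    by_cases h : i ≤ n / 2
    · rw [show G i = E i from if_pos h, hE.dim]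
      omega
    · rw [show G i = (betaForm n).orthogonal (E (n - i)) from if_neg h]
      have h1 := hB.finrank_orthogonal (E (n - i))
      rw [hE.dim] at h1
      omega
  refine isSolvable_of_chain (G := G) (monotone_nat_of_le_succ fun i => ?_) (fun i => ?_) ?_ ?_
    fun Z hZ i x hx => ?_
  · simp only [G]
    split_ifs with h1 h2 h2
    · exact hE.mono (Nat.le_succ i)
    · intro x hx y hy
      exact hE.iso i y (hE.mono (by omega) hy) x hx
    · omega
    · exact LinearMap.BilinForm.orthogonal_le (hE.mono (by omega))
  · rw [hGd, hGd]
    omega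
  · rw [← Submodule.finrank_eq_zero, hGd]
    omega
  · apply Submodule.eq_top_of_finrank_eq
    rw [hGd, hB.dim, min_self]
  · simp only [G] at hx ⊢
    split_ifs at hx ⊢
    · exact hZ i x hx
    · intro y hy
      have h1 := betaForm_so Z y x
      have h2 : betaForm n (Z.1 *ᵥ y) x = 0 := hx _ (hZ _ y hy)
      rw [h2] at h1
      exact neg_eq_zero.1 h1.symm

/-! #### The stabilizer determines the flag below the middle dimension -/

/-- The element `z ↦ β(x, z) y - β(y, z) x` of `so(n)`. -/
noncomputable def wedge (x y : Fin n → ℂ) : so n :=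
  ⟨LinearMap.toMatrix' ((betaForm n x).smulRight y - (betaForm n y).smulRight x), by
    rw [mem_so_iff]
    intro z w
    have h1 := (isQuad_betaForm n).symm z x
    have h2 := (isQuad_betaForm n).symm z y
    rw [LinearMap.toMatrix'_mulVec, LinearMap.toMatrix'_mulVec]
    simp only [LinearMap.sub_apply, LinearMap.smulRight_apply, map_sub,
      map_smul, LinearMap.smul_apply, smul_eq_mul, h1, h2]
    ring⟩

theorem wedge_mulVec (x y z : Fin n → ℂ) :
    (wedge x y).1 *ᵥ z = betaForm n x z • y - betaForm n y z • x := by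
  rw [wedge, LinearMap.toMatrix'_mulVec]
  rfl

/-- Let `E i` = `E' i` and let x ∈ E (i+1) lie outside E' (i+1). For every `y` in (E i)^⊥ the
operator `wedge x y` stabilizes `E`, hence `E'`. Applied to some z ∈ E' (i+1) outside `E i`, it puts
`x` into E' (i+1), or else makes (E i)^⊥ too small; the latter is where 2 (i + 1) < n enters. -/
theorem eq_of_flagStab_le {E E' : ℕ → Submodule ℂ (Fin n → ℂ)}
    (hE : IsFlag (betaForm n) E (n / 2)) (hE' : IsFlag (betaForm n) E' (n / 2))
    (h : flagStab E ≤ flagStab E') : ∀ i, 2 * i < n → E i = E' i := by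
  have hB := isQuad_betaForm n
  intro i
  induction i with
  | zero => intro _; rw [hE.zero_eq_bot, hE'.zero_eq_bot]
  | succ i ih =>
    intro hi
    have hEi := ih (by omega)
    have hd := hE.dim (i + 1)
    have hd' := hE'.dim (i + 1)
    have hdi := hE.dim i
    apply Submodule.eq_of_le_of_finrank_eq _ (hd.trans hd'.symm)
    intro x hx
    by_contra hxE'
    have hstab : ∀ y, (∀ u ∈ E i, betaForm n u y = 0) → wedge x y ∈ flagStab E := by
      intro y hy k u hu
      rw [wedge_mulVec]
      rcases Nat.lt_or_ge i k with hik | hik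
      · rw [hE.iso k x (hE.mono hik hx) u hu, zero_smul, zero_sub]
        exact Submodule.neg_mem _ (Submodule.smul_mem _ _ (hE.mono hik hx))
      · rw [hE.iso (i + 1) x hx u (hE.mono (by omega) hu),
          (hB.symm y u).trans (hy u (hE.mono hik hu))]
        simp
    obtain ⟨z, hz, hzi⟩ : ∃ z ∈ E' (i + 1), z ∉ E i := by
      by_contra! hc
      have h1 := Submodule.finrank_mono (s := E' (i + 1)) (t := E i) hc
      omega
    have hmem : ∀ y, (∀ u ∈ E i, betaForm n u y = 0) →
        betaForm n x z • y - betaForm n y z • x ∈ E' (i + 1) := fun y hy => by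
      rw [← wedge_mulVec]
      exact h (hstab y hy) _ z hz
    by_cases hxz : betaForm n x z = 0
    · obtain ⟨y, hy, hzy⟩ := hB.exists_orthogonal_ne_zero hzi
      have h1 := hmem y hy
      rw [hxz, zero_smul, zero_sub, Submodule.neg_mem_iff] at h1
      exact hxE' ((Submodule.smul_mem_iff _ (by rwa [hB.symm])).1 h1)
    · have h1 : (betaForm n).orthogonal (E i) ≤ E' (i + 1) ⊔ Submodule.span ℂ {x} := by
        intro y hy
        have h2 := Submodule.smul_mem _ (betaForm n x z)⁻¹ (hmem y hy)
        rw [smul_sub, smul_smul, inv_mul_cancel₀ hxz, one_smul, smul_smul] at h2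
        have h3 := Submodule.add_mem_sup h2 (Submodule.smul_mem _
          ((betaForm n x z)⁻¹ * betaForm n y z) (Submodule.mem_span_singleton_self (R := ℂ) x))
        rwa [sub_add_cancel] at h3
      have h2 := Submodule.finrank_mono h1
      rw [finrank_sup_span_singleton hxE'] at h2
      have h3 := hB.finrank_orthogonal (E i)
      omega

/-- Only a Lagrangian step, n = 2(l+1), needs an argument. It is E' l plus a line ⟨z⟩ and equals its
own complement. As β(Zz, z) = 0 by skewness, `Z` maps it into its complement. -/
theorem flagStab_le_of_eq {E E' : ℕ → Submodule ℂ (Fin n → ℂ)}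
    (hE : IsFlag (betaForm n) E (n / 2)) (hE' : IsFlag (betaForm n) E' (n / 2))
    (h : ∀ i, 2 * i < n → E i = E' i) : flagStab E ≤ flagStab E' := by
  have hB := isQuad_betaForm n
  intro Z hZ
  have hlow : ∀ i, 2 * i < n → ∀ x ∈ E' i, Z.1 *ᵥ x ∈ E' i := fun i hi => by
    rw [← h i hi]
    exact hZ i
  intro i
  rcases Nat.lt_or_ge (2 * i) n with hi | hi
  · exact hlow i hi
  rw [hE'.eq_of_le (by omega : n / 2 ≤ i)]
  rcases Nat.lt_or_ge (2 * (n / 2)) n with hl | hl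
  · exact hlow _ hl
  rcases Nat.eq_zero_or_pos n with rfl | hn
  · intro x hx
    rwa [Subsingleton.elim (Z.1 *ᵥ x) x]
  obtain ⟨l, hl⟩ : ∃ l, n / 2 = l + 1 := ⟨n / 2 - 1, by omega⟩
  rw [hl]
  have hd := hE'.dim (l + 1)
  have hdl := hE'.dim l
  obtain ⟨z, hz, hzl⟩ : ∃ z ∈ E' (l + 1), z ∉ E' l := by
    by_contra! hc
    have h1 := Submodule.finrank_mono (s := E' (l + 1)) (t := E' l) hc
    omega
  have hsup : E' (l + 1) = E' l ⊔ Submodule.span ℂ {z} := by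
    symm
    apply Submodule.eq_of_le_of_finrank_eq
    · rw [sup_le_iff, Submodule.span_singleton_le_iff_mem]
      exact ⟨hE'.mono (Nat.le_succ l), hz⟩
    · rw [finrank_sup_span_singleton hzl]
      omega
  have hself : (betaForm n).orthogonal (E' (l + 1)) = E' (l + 1) := by
    symm
    apply Submodule.eq_of_le_of_finrank_eq
    · exact fun x hx y hy => hE'.iso _ y hy x hx
    · have := hB.finrank_orthogonal (E' (l + 1))
      omega
  have hZl : ∀ x ∈ E' l, ∀ y ∈ E' (l + 1), betaForm n (Z.1 *ᵥ x) y = 0 := fun x hx y hy =>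
    hE'.iso _ _ (hE'.mono (Nat.le_succ l) (hlow l (by omega) x hx)) y hy
  have hZz : betaForm n (Z.1 *ᵥ z) z = 0 := by
    have h1 := betaForm_so Z z z
    rw [hB.symm z] at h1
    linear_combination h1 / 2
  intro x hx
  rw [← hself]
  intro y hy
  change betaForm n y (Z.1 *ᵥ x) = 0
  rw [hB.symm]
  rw [hsup] at hx hy
  obtain ⟨x', hx', a, rfl⟩ := mem_sup_span_singleton_iff.1 hx
  obtain ⟨y', hy', b, rfl⟩ := mem_sup_span_singleton_iff.1 hy
  have h1 : betaForm n (Z.1 *ᵥ z) y' = 0 := by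
    rw [betaForm_so, hB.symm, hZl y' hy' z hz, neg_zero]
  simp [mulVec_add, mulVec_smul, hZl x' hx' y' (hE'.mono (Nat.le_succ l) hy'), hZl x' hx' z hz, h1,
    hZz]

theorem flagStab_eq_iff {E E' : ℕ → Submodule ℂ (Fin n → ℂ)}
    (hE : IsFlag (betaForm n) E (n / 2)) (hE' : IsFlag (betaForm n) E' (n / 2)) :
    flagStab E = flagStab E' ↔ ∀ i, 2 * i < n → E i = E' i :=
  ⟨fun h => eq_of_flagStab_le hE hE' h.le, fun h => le_antisymm (flagStab_le_of_eq hE hE' h)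
    (flagStab_le_of_eq hE' hE fun i hi => (h i hi).symm)⟩

/-- A larger solvable subalgebra stabilizes some flag, whose low steps must agree with those of `E`;
so it lies in the same stabilizer. -/
theorem isBorel_flagStab {E : ℕ → Submodule ℂ (Fin n → ℂ)}
    (hE : IsFlag (betaForm n) E (n / 2)) : IsBorel (flagStab E) := by
  refine ⟨isSolvable_flagStab hE, fun c hc hle => ?_⟩
  obtain ⟨E', hE', hcE'⟩ := exists_flag_of_isSolvable hc
  have h1 := eq_of_flagStab_le hE hE' (hle.trans hcE')
  rwa [(flagStab_eq_iff hE hE').2 h1]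

theorem IsBorel.exists_flag {b : LieSubalgebra ℂ (so n)} (hb : IsBorel b) :
    ∃ E, IsFlag (betaForm n) E (n / 2) ∧ b = flagStab E := by
  obtain ⟨E, hE, hbE⟩ := exists_flag_of_isSolvable hb.1
  exact ⟨E, hE, le_antisymm hbE (hb.2 (isSolvable_flagStab hE) hbE)⟩

end Borel

end OrthoCount

namespace OrthoCount

open Module Matrix

/-! ### The orthogonal group and the standard flag -/

section Orthogonal

variable {n : ℕ}

theorem betaForm_eq_sum (x y : Fin n → ℂ) : betaForm n x y = ∑ i, x i * y (Fin.rev i) := by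
  rw [betaForm_apply, beta_eq_sum]

theorem betaForm_single_left (i : Fin n) (y : Fin n → ℂ) :
    betaForm n (Pi.single i 1) y = y (Fin.rev i) := by
  rw [betaForm_apply, beta_single_left]

/-- The span of the first `m` basis vectors of `ℂⁿ`. -/
def coordSub (n m : ℕ) : Submodule ℂ (Fin n → ℂ) where
  carrier := {x | ∀ j : Fin n, m ≤ j → x j = 0}
  zero_mem' := fun _ _ => rfl
  add_mem' := fun {x y} hx hy j hj => by rw [Pi.add_apply, hx j hj, hy j hj, add_zero]
  smul_mem' := fun a x hx j hj => by rw [Pi.smul_apply, hx j hj, smul_zero]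

theorem mem_coordSub {m : ℕ} {x : Fin n → ℂ} : x ∈ coordSub n m ↔ ∀ j : Fin n, m ≤ j → x j = 0 :=
  Iff.rfl

theorem coordSub_mono : Monotone (coordSub n) := fun _ _ h _ hx j hj => hx j (h.trans hj)

theorem single_mem_coordSub {m : ℕ} {i : Fin n} (hi : (i : ℕ) < m) (a : ℂ) :
    Pi.single i a ∈ coordSub n m := fun j hj => by
  rw [Pi.single_apply, if_neg]
  rintro rfl
  omega

theorem finrank_coordSub {m : ℕ} (hm : m ≤ n) : finrank ℂ (coordSub n m) = m := by
  induction hm using Nat.decreasingInduction with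
  | self =>
    have : coordSub n n = ⊤ := by
      rw [eq_top_iff]
      exact fun x _ j hj => absurd j.2 (by omega)
    rw [this, finrank_top, finrank_fin_fun]
  | of_succ m hm ih =>
    have h := finrank_inf_ker_add_one (coordSub n (m + 1)) (LinearMap.proj ⟨m, hm⟩)
      (single_mem_coordSub (i := ⟨m, hm⟩) (Nat.lt_succ_self m) 1) (by simp)
    have he : coordSub n (m + 1) ⊓ LinearMap.ker (LinearMap.proj ⟨m, hm⟩) = coordSub n m := by
      ext x
      simp only [Submodule.mem_inf, LinearMap.mem_ker, LinearMap.proj_apply, mem_coordSub]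
      constructor
      · rintro ⟨h1, h2⟩ j hj
        rcases hj.eq_or_lt with h | h
        · rwa [show j = ⟨m, hm⟩ from Fin.ext h.symm]
        · exact h1 j h
      · exact fun h => ⟨fun j hj => h j (by omega), h _ le_rfl⟩
    rw [he] at h
    omega

theorem mem_coordSub_iff_orthogonal {m m' : ℕ} (hm : m + m' = n) {x : Fin n → ℂ} :
    x ∈ coordSub n m ↔ ∀ y ∈ coordSub n m', betaForm n y x = 0 := by
  constructor
  · intro hx y hy
    rw [betaForm_eq_sum]
    refine Finset.sum_eq_zero fun i _ => ?_
    rcases lt_or_ge (i : ℕ) m' with h | h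
    · rw [hx _ (by rw [Fin.val_rev]; omega), mul_zero]
    · rw [hy i h, zero_mul]
  · intro h j hj
    have := h (Pi.single (Fin.rev j) 1) (single_mem_coordSub (by rw [Fin.val_rev]; omega) 1)
    rwa [betaForm_single_left, Fin.rev_rev] at this

/-- The standard isotropic flag of length `l`. -/
def stdFlag (n l i : ℕ) : Submodule ℂ (Fin n → ℂ) := coordSub n (min i l)

theorem isFlag_stdFlag {l : ℕ} (hl : 2 * l ≤ n) : IsFlag (betaForm n) (stdFlag n l) l where
  mono := fun i j h => coordSub_mono (by omega)
  iso := fun i x hx y hy => (mem_coordSub_iff_orthogonal (m := n - min i l) (by omega)).1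
    (coordSub_mono (by omega) hy) x hx
  dim := fun i => finrank_coordSub (by omega)

/-- The isometries of `ℂⁿ` with the form `β`. -/
def orth (n : ℕ) : Subgroup ((Fin n → ℂ) ≃ₗ[ℂ] (Fin n → ℂ)) where
  carrier := {φ | ∀ x y, betaForm n (φ x) (φ y) = betaForm n x y}
  one_mem' := fun _ _ => rfl
  mul_mem' := fun {φ ψ} hφ hψ x y => (hφ (ψ x) (ψ y)).trans (hψ x y)
  inv_mem' := fun {φ} hφ x y => by
    rw [← hφ, ← LinearEquiv.mul_apply, ← LinearEquiv.mul_apply, mul_inv_cancel]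
    rfl

theorem det_S_mul_det_S : (S n).det * (S n).det = 1 := by
  rw [← det_mul]
  have : S n * S n = 1 := by
    refine Matrix.toLin'.injective (LinearMap.ext fun x => funext fun i => ?_)
    rw [toLin'_mul, LinearMap.comp_apply, toLin'_apply, toLin'_apply, S_mulVec, S_mulVec,
      Fin.rev_rev, toLin'_one, LinearMap.id_apply]
  rw [this, det_one]

/-- The matrix of an isometry. -/
theorem transpose_mul_S_mul {φ : (Fin n → ℂ) ≃ₗ[ℂ] (Fin n → ℂ)} (hφ : φ ∈ orth n) :
    (LinearMap.toMatrix' (φ : (Fin n → ℂ) →ₗ[ℂ] (Fin n → ℂ)))ᵀ * S n *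
      LinearMap.toMatrix' (φ : (Fin n → ℂ) →ₗ[ℂ] (Fin n → ℂ)) = S n := by
  apply Matrix.toBilin'.injective
  refine LinearMap.ext fun x => LinearMap.ext fun y => ?_
  have h := hφ x y
  rw [betaForm_apply, beta] at h
  rw [Matrix.toBilin'_apply', ← betaForm, ← h, Matrix.mul_assoc, ← mulVec_mulVec, ← mulVec_mulVec,
    dotProduct_mulVec, vecMul_transpose, LinearMap.toMatrix'_mulVec, LinearMap.toMatrix'_mulVec]
  rfl

theorem det_eq_one_or {φ : (Fin n → ℂ) ≃ₗ[ℂ] (Fin n → ℂ)} (hφ : φ ∈ orth n) :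
    LinearEquiv.det φ = 1 ∨ LinearEquiv.det φ = -1 := by
  have h := congrArg Matrix.det (transpose_mul_S_mul hφ)
  rw [det_mul, det_mul, det_transpose, LinearMap.det_toMatrix'] at h
  have hS := det_S_mul_det_S (n := n)
  have h1 : LinearMap.det (φ : (Fin n → ℂ) →ₗ[ℂ] (Fin n → ℂ)) *
      LinearMap.det (φ : (Fin n → ℂ) →ₗ[ℂ] (Fin n → ℂ)) = 1 := by
    linear_combination (S n).det * h +
      (1 - LinearMap.det (φ : (Fin n → ℂ) →ₗ[ℂ] (Fin n → ℂ)) *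
        LinearMap.det (φ : (Fin n → ℂ) →ₗ[ℂ] (Fin n → ℂ))) * hS
  rcases mul_self_eq_one_iff.1 h1 with h2 | h2
  · exact Or.inl (Units.ext (by rw [LinearEquiv.coe_det, h2, Units.val_one]))
  · exact Or.inr (Units.ext (by rw [LinearEquiv.coe_det, h2, Units.val_neg, Units.val_one]))

theorem exists_SO {φ : (Fin n → ℂ) ≃ₗ[ℂ] (Fin n → ℂ)} (hφ : φ ∈ orth n)
    (hd : LinearEquiv.det φ = 1) : ∃ g : SO n, ∀ x, mat g *ᵥ x = φ x := by
  refine ⟨⟨⟨LinearMap.toMatrix' (φ : (Fin n → ℂ) →ₗ[ℂ] (Fin n → ℂ)), ?_⟩, fun x y => ?_⟩, fun x => ?_⟩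
  · rw [LinearMap.det_toMatrix', ← LinearEquiv.coe_det, hd, Units.val_one]
  · rw [LinearMap.toMatrix'_mulVec, LinearMap.toMatrix'_mulVec, ← betaForm_apply, ← betaForm_apply]
    exact hφ x y
  · exact LinearMap.toMatrix'_mulVec _ x

theorem exists_orth (g : SO n) : ∃ φ ∈ orth n, LinearEquiv.det φ = 1 ∧ ∀ x, mat g *ᵥ x = φ x := by
  obtain ⟨φ, hφ⟩ := exists_equiv_of_isometry (isQuad_betaForm n) (isQuad_betaForm n)
    (Matrix.toLin' (mat g)) (fun x y => by
      rw [toLin'_apply, toLin'_apply, betaForm_apply, betaForm_apply, beta_mat])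
  refine ⟨φ, fun x y => ?_, ?_, fun x => ?_⟩
  · rw [hφ, hφ, toLin'_apply, toLin'_apply, betaForm_apply, betaForm_apply, beta_mat]
  · have : (φ : (Fin n → ℂ) →ₗ[ℂ] (Fin n → ℂ)) = Matrix.toLin' (mat g) := LinearMap.ext hφ
    refine Units.ext ?_
    rw [LinearEquiv.coe_det, this, LinearMap.det_toLin', Units.val_one]
    exact g.1.2
  · rw [hφ, toLin'_apply]

/-! #### Isometries that preserve the standard flag -/

theorem map_mem_coordSub_iff {φ : (Fin n → ℂ) ≃ₗ[ℂ] (Fin n → ℂ)} {m : ℕ}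
    (h : ∀ x ∈ coordSub n m, φ x ∈ coordSub n m) (x : Fin n → ℂ) :
    φ x ∈ coordSub n m ↔ x ∈ coordSub n m := mem_iff_of_finrank_eq φ h rfl x

theorem map_mem_coordSub_of_add_eq {φ : (Fin n → ℂ) ≃ₗ[ℂ] (Fin n → ℂ)} (hφ : φ ∈ orth n)
    {m m' : ℕ} (hm : m + m' = n) (h : ∀ x ∈ coordSub n m', φ x ∈ coordSub n m') :
    ∀ x ∈ coordSub n m, φ x ∈ coordSub n m := by
  intro x hx
  rw [mem_coordSub_iff_orthogonal hm] at hx ⊢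
  intro y hy
  obtain ⟨z, rfl⟩ := φ.surjective y
  rw [hφ]
  exact hx z ((map_mem_coordSub_iff h z).1 hy)

theorem map_mem_coordSub_of_le_half {φ : (Fin n → ℂ) ≃ₗ[ℂ] (Fin n → ℂ)} (hφ : φ ∈ orth n)
    (h : ∀ m ≤ n / 2, ∀ x ∈ coordSub n m, φ x ∈ coordSub n m) {m : ℕ} (hm : m ≤ n) :
    ∀ x ∈ coordSub n m, φ x ∈ coordSub n m := by
  rcases le_or_gt m (n / 2) with h1 | h1
  · exact h m h1
  · exact map_mem_coordSub_of_add_eq hφ (m' := n - m) (by omega) (h _ (by omega))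

theorem apply_single_eq_zero {φ : (Fin n → ℂ) ≃ₗ[ℂ] (Fin n → ℂ)} (hφ : φ ∈ orth n)
    (h : ∀ m ≤ n / 2, ∀ x ∈ coordSub n m, φ x ∈ coordSub n m) {i j : Fin n} (hij : i < j) :
    φ (Pi.single i 1) j = 0 :=
  map_mem_coordSub_of_le_half hφ h (m := i + 1) (by omega) _
    (single_mem_coordSub (Nat.lt_succ_self _) 1) j hij

theorem toMatrix'_isUpperTriangular {φ : (Fin n → ℂ) ≃ₗ[ℂ] (Fin n → ℂ)} (hφ : φ ∈ orth n)
    (h : ∀ m ≤ n / 2, ∀ x ∈ coordSub n m, φ x ∈ coordSub n m) :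
    (LinearMap.toMatrix' (φ : (Fin n → ℂ) →ₗ[ℂ] (Fin n → ℂ))).BlockTriangular id := by
  intro i j hij
  rw [LinearMap.toMatrix'_apply]
  exact apply_single_eq_zero hφ h hij

/-- The matrix is upper triangular, and preservation of β makes the diagonal entries at `i` and
`Fin.rev i` inverse to each other. Only a middle index is unpaired, whence `hmid`. -/
theorem det_eq_one_of_map_mem {φ : (Fin n → ℂ) ≃ₗ[ℂ] (Fin n → ℂ)} (hφ : φ ∈ orth n)
    (h : ∀ m ≤ n / 2, ∀ x ∈ coordSub n m, φ x ∈ coordSub n m)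
    (hmid : ∀ i : Fin n, Fin.rev i = i → φ (Pi.single i 1) i = 1) : LinearEquiv.det φ = 1 := by
  refine Units.ext ?_
  rw [LinearEquiv.coe_det, ← LinearMap.det_toMatrix',
    Matrix.det_of_isUpperTriangular (toMatrix'_isUpperTriangular hφ h), Units.val_one]
  refine Finset.prod_involution (fun i _ => Fin.rev i) (fun i _ => ?_) (fun i _ hi hr => hi ?_)
    (fun _ _ => Finset.mem_univ _) (fun i _ => Fin.rev_rev i)
  · rw [LinearMap.toMatrix'_apply, LinearMap.toMatrix'_apply]
    have h1 := hφ (Pi.single i 1) (Pi.single (Fin.rev i) 1)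
    rw [betaForm_single_left, Pi.single_eq_same, betaForm_eq_sum,
      Finset.sum_eq_single i] at h1
    · exact h1
    · intro j _ hj
      rcases lt_or_gt_of_ne hj with hl | hl
      · rw [apply_single_eq_zero hφ h (Fin.rev_lt_rev.2 hl), mul_zero]
      · rw [apply_single_eq_zero hφ h hl, zero_mul]
    · simp
  · rw [LinearMap.toMatrix'_apply]
    exact hmid i hr

end Orthogonal

end OrthoCount

namespace OrthoCount

open Module Matrix

section Orientation

variable {n : ℕ}

/-! #### The reflection in the fixed vector -/

theorem fixedVec_odd (l : ℕ) : fixedVec (2 * l + 1) = Pi.single ⟨l, by omega⟩ 1 := by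
  ext i
  simp only [fixedVec, Pi.single_apply, Fin.ext_iff]
  split_ifs <;> first | rfl | omega

theorem fixedVec_even (l : ℕ) : fixedVec (2 * (l + 1)) =
    Pi.single ⟨l, by omega⟩ 1 - Pi.single ⟨l + 1, by omega⟩ 1 := by
  ext i
  simp only [fixedVec, Pi.sub_apply, Pi.single_apply, Fin.ext_iff]
  split_ifs <;> first | omega | simp

theorem betaForm_fixedVec_odd {l : ℕ} (x : Fin (2 * l + 1) → ℂ) :
    betaForm _ (fixedVec (2 * l + 1)) x = x ⟨l, by omega⟩ := by
  rw [fixedVec_odd, betaForm_single_left]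
  congr 1
  ext
  rw [Fin.val_rev]
  dsimp only
  omega

theorem betaForm_fixedVec_even {l : ℕ} (x : Fin (2 * (l + 1)) → ℂ) :
    betaForm _ (fixedVec (2 * (l + 1))) x = x ⟨l + 1, by omega⟩ - x ⟨l, by omega⟩ := by
  rw [fixedVec_even, map_sub, LinearMap.sub_apply, betaForm_single_left, betaForm_single_left]
  congr 2 <;> ext <;> rw [Fin.val_rev] <;> dsimp only <;> omega

theorem betaForm_fixedVec_self_ne_zero (hn : 0 < n) :
    betaForm n (fixedVec n) (fixedVec n) ≠ 0 := by
  rcases n.even_or_odd' with ⟨l, rfl | rfl⟩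
  · obtain ⟨l, rfl⟩ : ∃ l', l = l' + 1 := ⟨l - 1, by omega⟩
    rw [betaForm_fixedVec_even, fixedVec_even]
    simp
    norm_num
  · rw [betaForm_fixedVec_odd, fixedVec_odd]
    simp

theorem betaForm_fixedVec_eq_zero {m : ℕ} (hm : 2 * m < n) {x : Fin n → ℂ} (hx : x ∈ coordSub n m) :
    betaForm n (fixedVec n) x = 0 := by
  rcases n.even_or_odd' with ⟨l, rfl | rfl⟩
  · obtain ⟨l, rfl⟩ : ∃ l', l = l' + 1 := ⟨l - 1, by omega⟩
    rw [betaForm_fixedVec_even, hx _ (by dsimp only; omega), hx _ (by dsimp only; omega), sub_zero]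
  · rw [betaForm_fixedVec_odd, hx _ (by dsimp only; omega)]

theorem exists_reflection (hn : 0 < n) : ∃ ρ ∈ orth n, LinearEquiv.det ρ = -1 ∧
    ∀ x, ρ x = x - (2 * betaForm n (fixedVec n) x / betaForm n (fixedVec n) (fixedVec n)) •
      fixedVec n := by
  have hq := betaForm_fixedVec_self_ne_zero hn
  have hs := (isQuad_betaForm n).symm
  obtain ⟨q, hq'⟩ : ∃ q, betaForm n (fixedVec n) (fixedVec n) = q := ⟨_, rfl⟩
  rw [hq'] at hq ⊢
  -- Written as a transvection, the reflection has determinant 1 - (2/q) q = -1.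
  have hf : ∀ x, LinearMap.transvection (-(2 / q) • betaForm n (fixedVec n)) (fixedVec n) x =
      x - (2 * betaForm n (fixedVec n) x / q) • fixedVec n := fun x => by
    rw [LinearMap.transvection.apply, LinearMap.smul_apply, sub_eq_add_neg, ← neg_smul, smul_eq_mul]
    congr 2
    ring
  have hiso : ∀ x y, betaForm n (x - (2 * betaForm n (fixedVec n) x / q) • fixedVec n)
      (y - (2 * betaForm n (fixedVec n) y / q) • fixedVec n) = betaForm n x y := fun x y => by
    simp only [map_sub, LinearMap.sub_apply, map_smul, LinearMap.smul_apply, smul_eq_mul, hq',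
      hs x (fixedVec n)]
    field_simp
    ring
  obtain ⟨ρ, hρ⟩ := exists_equiv_of_isometry (isQuad_betaForm n) (isQuad_betaForm n)
    (LinearMap.transvection (-(2 / q) • betaForm n (fixedVec n)) (fixedVec n))
    (fun x y => by rw [hf, hf, hiso])
  refine ⟨ρ, fun x y => by rw [hρ, hρ, hf, hf, hiso], ?_, fun x => by rw [hρ, hf]⟩
  refine Units.ext ?_
  rw [LinearEquiv.coe_det, show (ρ : (Fin n → ℂ) →ₗ[ℂ] (Fin n → ℂ)) = _ from LinearMap.ext hρ,
    LinearMap.transvection.det, LinearMap.smul_apply, hq', smul_eq_mul]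
  field_simp
  norm_num

/-! #### Isometries of determinant one -/

theorem map_mem_coordSub_succ {φ : (Fin n → ℂ) ≃ₗ[ℂ] (Fin n → ℂ)} {l : ℕ} (hl : l < n)
    (h : ∀ x ∈ coordSub n l, φ x ∈ coordSub n l)
    (he : φ (Pi.single ⟨l, hl⟩ 1) ∈ coordSub n (l + 1)) :
    ∀ x ∈ coordSub n (l + 1), φ x ∈ coordSub n (l + 1) := by
  intro x hx
  have h1 : x - x ⟨l, hl⟩ • Pi.single ⟨l, hl⟩ 1 ∈ coordSub n l := fun j hj => by
    rcases hj.eq_or_lt with h | h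
    · rw [show j = ⟨l, hl⟩ from Fin.ext h.symm]
      simp
    · rw [Pi.sub_apply, Pi.smul_apply, hx j h,
        Pi.single_eq_of_ne (fun hj' => h.ne' (congrArg Fin.val hj')), smul_zero, sub_zero]
  rw [← sub_add_cancel x (x ⟨l, hl⟩ • Pi.single ⟨l, hl⟩ 1), map_add, map_smul]
  exact add_mem (coordSub_mono (Nat.le_succ l) (h _ h1)) (Submodule.smul_mem _ _ he)

/-- For n = 2(l+1) the plane `coordSub n (l + 2)` modulo `coordSub n l` has just two isotropic
lines, those of the two middle basis vectors. If ψ interchanged them, composing with the reflection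
in the fixed vector, which also interchanges them, would give an isometry of determinant -1
preserving the whole standard flag, against `det_eq_one_of_map_mem`. -/
theorem map_mem_coordSub_of_det_eq_one {ψ : (Fin n → ℂ) ≃ₗ[ℂ] (Fin n → ℂ)} (hψ : ψ ∈ orth n)
    (hd : LinearEquiv.det ψ = 1)
    (h : ∀ m, 2 * m < n → ∀ x ∈ coordSub n m, ψ x ∈ coordSub n m) :
    ∀ m ≤ n / 2, ∀ x ∈ coordSub n m, ψ x ∈ coordSub n m := by
  intro m hm
  rcases lt_or_ge (2 * m) n with hlt | hge
  · exact h m hlt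
  obtain rfl : n = 2 * m := by omega
  rcases m with _ | l
  · exact fun _ _ j => absurd j.2 (by omega)
  obtain ⟨a, ha⟩ : ∃ a : Fin (2 * (l + 1)), a = ⟨l, by omega⟩ := ⟨_, rfl⟩
  obtain ⟨b, hb⟩ : ∃ b : Fin (2 * (l + 1)), b = ⟨l + 1, by omega⟩ := ⟨_, rfl⟩
  have hav : (a : ℕ) = l := by rw [ha]
  have hbv : (b : ℕ) = l + 1 := by rw [hb]
  have hra : Fin.rev a = b := by ext; rw [Fin.val_rev]; omega
  have hrb : Fin.rev b = a := by rw [← hra, Fin.rev_rev]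
  have hab : a ≠ b := fun h => by rw [h] at hav; omega
  have hx : ψ (Pi.single a 1) ∈ coordSub _ (l + 2) :=
    map_mem_coordSub_of_add_eq hψ (m' := l) (by omega) (h l (by omega)) _
      (single_mem_coordSub (by omega) 1)
  have hxx : ψ (Pi.single a 1) a * ψ (Pi.single a 1) b = 0 := by
    have h1 := hψ (Pi.single a 1) (Pi.single a 1)
    rw [betaForm_single_left, hra, Pi.single_eq_of_ne hab.symm, betaForm_eq_sum,
      Finset.sum_eq_add a b hab, hra, hrb, mul_comm (ψ _ b), ← two_mul] at h1
    · exact (mul_eq_zero.1 h1).resolve_left two_ne_zero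
    · rintro j - ⟨hja, hjb⟩
      rcases lt_or_ge (j : ℕ) (l + 2) with hj | hj
      · rw [hx (Fin.rev j), mul_zero]
        have h1 : (j : ℕ) ≠ l := fun h => hja (Fin.ext (h.trans hav.symm))
        have h2 : (j : ℕ) ≠ l + 1 := fun h => hjb (Fin.ext (h.trans hbv.symm))
        rw [Fin.val_rev]
        omega
      · rw [hx j hj, zero_mul]
    · simp
    · simp
  have hmem : ∀ y ∈ coordSub (2 * (l + 1)) (l + 2), y b = 0 → y ∈ coordSub _ (l + 1) := by
    intro y hy hy0 j hj
    rcases hj.eq_or_lt with h | h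
    · rwa [show j = b from Fin.ext (h.symm.trans hbv.symm)]
    · exact hy j h
  rcases mul_eq_zero.1 hxx with h0 | h0
  · exfalso
    obtain ⟨ρ, hρ, hρd, hρf⟩ := exists_reflection (n := 2 * (l + 1)) (by omega)
    have hq : betaForm _ (fixedVec (2 * (l + 1))) (fixedVec (2 * (l + 1))) = -2 := by
      rw [betaForm_fixedVec_even, fixedVec_even]
      simp
      norm_num
    have hρl : ∀ m, 2 * m < 2 * (l + 1) → ∀ x ∈ coordSub _ m, ρ x = x := fun m hm x hx => by
      rw [hρf, betaForm_fixedVec_eq_zero hm hx, mul_zero, zero_div, zero_smul, sub_zero]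
    have hρb : ∀ x, ρ x b = x a := fun x => by
      rw [hρf, hq, betaForm_fixedVec_even, fixedVec_even, ha, hb]
      simp
      ring
    have hρψ : ∀ m, 2 * m < 2 * (l + 1) → ∀ x ∈ coordSub (2 * (l + 1)) m, (ρ * ψ) x ∈ coordSub _ m :=
      fun m hm x hx => by
        rw [LinearEquiv.mul_apply, hρl m hm _ (h m hm x hx)]
        exact h m hm x hx
    have hdet := det_eq_one_of_map_mem (mul_mem hρ hψ) (fun m hm => by
      rcases lt_or_ge (2 * m) (2 * (l + 1)) with hlt | hge
      · exact hρψ m hlt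
      obtain rfl : m = l + 1 := by omega
      refine map_mem_coordSub_succ (by omega) (hρψ l (by omega)) (hmem _ ?_ ?_)
      · refine map_mem_coordSub_of_add_eq (mul_mem hρ hψ) (m' := l) (by omega) (hρψ l (by omega)) _
          (single_mem_coordSub (by dsimp only; omega) 1)
      · rw [LinearEquiv.mul_apply, hρb, ← ha]
        exact h0) (fun i hi => by
          have := congrArg Fin.val hi
          rw [Fin.val_rev] at this
          omega)
    rw [map_mul, hρd, hd, mul_one] at hdet
    have := congrArg Units.val hdet
    norm_num at this
  · refine map_mem_coordSub_succ (by omega) (h l (by omega)) ?_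
    rw [← ha]
    exact hmem _ hx h0

end Orientation

end OrthoCount

/-! ### Oriented flags, and orbits as isometry classes of configurations -/

namespace OrthoCount

open Module Matrix

section OrientedFlags

variable {n : ℕ}

/-- Flags in the orbit of the standard flag under isometries of determinant one. -/
def IsOriented (E : ℕ → Submodule ℂ (Fin n → ℂ)) : Prop :=
  ∃ φ ∈ orth n, LinearEquiv.det φ = 1 ∧ ∀ i x, φ x ∈ E i ↔ x ∈ stdFlag n (n / 2) i

theorem IsOriented.isFlag {E : ℕ → Submodule ℂ (Fin n → ℂ)} (h : IsOriented E) :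
    IsFlag (betaForm n) E (n / 2) := by
  obtain ⟨φ, hφ, -, hE⟩ := h
  have hs := isFlag_stdFlag (n := n) (l := n / 2) (by omega)
  have he : ∀ i, E i = (stdFlag n (n / 2) i).map (φ : (Fin n → ℂ) →ₗ[ℂ] (Fin n → ℂ)) := fun i => by
    ext x
    obtain ⟨y, rfl⟩ := φ.surjective x
    rw [hE]
    exact ⟨fun h => ⟨y, h, rfl⟩, fun ⟨z, hz, hzy⟩ => φ.injective hzy ▸ hz⟩
  refine ⟨fun i j hij => ?_, fun i => ?_, fun i => ?_⟩
  · rw [he, he]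
    exact Submodule.map_mono (hs.mono hij)
  · rw [he]
    rintro _ ⟨x, hx, rfl⟩ _ ⟨y, hy, rfl⟩
    exact (hφ x y).trans (hs.iso i x hx y hy)
  · rw [he, ← hs.dim i]
    exact LinearEquiv.finrank_map_eq φ _

theorem IsOriented.comap_symm {E : ℕ → Submodule ℂ (Fin n → ℂ)} (h : IsOriented E)
    {ψ : (Fin n → ℂ) ≃ₗ[ℂ] (Fin n → ℂ)} (hψ : ψ ∈ orth n) (hd : LinearEquiv.det ψ = 1) :
    IsOriented fun i => (E i).comap (ψ.symm : (Fin n → ℂ) →ₗ[ℂ] (Fin n → ℂ)) := by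
  obtain ⟨φ, hφ, hφd, hE⟩ := h
  refine ⟨ψ * φ, mul_mem hψ hφ, by rw [map_mul, hd, hφd, one_mul], fun i x => ?_⟩
  rw [← hE, LinearEquiv.mul_apply]
  simp

theorem isOriented_comap_symm {φ : (Fin n → ℂ) ≃ₗ[ℂ] (Fin n → ℂ)} (hφ : φ ∈ orth n)
    (hd : LinearEquiv.det φ = 1) : IsOriented fun i =>
      (stdFlag n (n / 2) i).comap (φ.symm : (Fin n → ℂ) →ₗ[ℂ] (Fin n → ℂ)) :=
  ⟨φ, hφ, hd, fun i x => by simp⟩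

theorem IsFlag.exists_orth {E : ℕ → Submodule ℂ (Fin n → ℂ)} (hE : IsFlag (betaForm n) E (n / 2)) :
    ∃ φ ∈ orth n, ∀ i x, φ x ∈ E i ↔ x ∈ stdFlag n (n / 2) i :=
  exists_isometry_flag n _ _ _ _ _ _ (isQuad_betaForm n) (isQuad_betaForm n)
    (isFlag_stdFlag (by omega)) hE

/-- Every full flag can be made oriented by changing its last step. -/
theorem IsFlag.exists_isOriented (hn : 0 < n) {E : ℕ → Submodule ℂ (Fin n → ℂ)}
    (hE : IsFlag (betaForm n) E (n / 2)) :
    ∃ E', IsOriented E' ∧ ∀ i, 2 * i < n → E i = E' i := by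
  obtain ⟨φ, hφ, hφE⟩ := hE.exists_orth
  rcases det_eq_one_or hφ with hd | hd
  · exact ⟨E, ⟨φ, hφ, hd, hφE⟩, fun _ _ => rfl⟩
  -- Precomposing with the reflection corrects the determinant. It fixes the standard steps below
  -- the middle pointwise, so only a middle step can change.
  obtain ⟨ρ, hρ, hρd, hρf⟩ := exists_reflection hn
  refine ⟨_, isOriented_comap_symm (mul_mem hφ hρ) (by rw [map_mul, hd, hρd]; norm_num),
    fun i hi => ?_⟩
  have hρi : ∀ x ∈ stdFlag n (n / 2) i, ρ x = x := fun x hx => by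
    rw [hρf, betaForm_fixedVec_eq_zero (m := min i (n / 2)) (by omega) hx, mul_zero, zero_div,
      zero_smul, sub_zero]
  ext y
  obtain ⟨x, rfl⟩ := (φ * ρ).surjective y
  rw [Submodule.mem_comap, LinearEquiv.coe_coe, LinearEquiv.symm_apply_apply, LinearEquiv.mul_apply,
    hφE]
  exact mem_iff_of_finrank_eq ρ (fun x hx => by rwa [hρi x hx]) rfl x

/-- An oriented flag is determined by its members of dimension less than `n / 2`. -/
theorem IsOriented.eq_of_eq {E E' : ℕ → Submodule ℂ (Fin n → ℂ)} (hE : IsOriented E)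
    (hE' : IsOriented E') (h : ∀ i, 2 * i < n → E i = E' i) : E = E' := by
  have hf := hE.isFlag
  have hf' := hE'.isFlag
  obtain ⟨φ, hφ, hd, hφE⟩ := hE
  obtain ⟨φ', hφ', hd', hφE'⟩ := hE'
  have hψ : ∀ x, φ' ((φ'⁻¹ * φ) x) = φ x := fun x => by
    rw [← LinearEquiv.mul_apply, mul_inv_cancel_left]
  have hm := map_mem_coordSub_of_det_eq_one (mul_mem (inv_mem hφ') hφ)
    (by rw [map_mul, map_inv, hd, hd', inv_one, one_mul]) (fun m hm x hx => by
      have h1 : stdFlag n (n / 2) m = coordSub n m := by rw [stdFlag, min_eq_left (by omega)]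
      rwa [← h1, ← hφE', hψ, ← h m hm, hφE, h1])
  funext i
  refine Submodule.eq_of_le_of_finrank_eq (fun y hy => ?_) (by rw [hf.dim, hf'.dim])
  obtain ⟨x, rfl⟩ := φ.surjective y
  rw [hφE] at hy
  rw [← hψ, hφE']
  exact hm _ (by omega) x hy

/-! #### Configurations in `ℂⁿ` -/

/-- The configuration of a flag in `ℂᵏ⁺¹`, relative to a multiple of the fixed vector and to the
standard flag in its orthogonal complement. -/
noncomputable def stdConfig (k : ℕ) (c : ℂ) (E : ℕ → Submodule ℂ (Fin (k + 1) → ℂ)) : Config where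
  V := Fin (k + 1) → ℂ
  B := betaForm (k + 1)
  v := c • fixedVec (k + 1)
  F := stdFlag (k + 1) (k / 2)
  E := E

section StdConfig

variable {k : ℕ} {c : ℂ}

/-- The fixed vector need not be a unit vector (its square is -2 for even positive n), while
configurations require one. -/
theorem exists_normalizer (k : ℕ) :
    ∃ c : ℂ, c * c * betaForm (k + 1) (fixedVec (k + 1)) (fixedVec (k + 1)) = 1 := by
  have hq := betaForm_fixedVec_self_ne_zero (Nat.succ_pos k)
  obtain ⟨c, hc⟩ := IsAlgClosed.exists_pow_nat_eq
    (betaForm (k + 1) (fixedVec (k + 1)) (fixedVec (k + 1)))⁻¹ two_pos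
  exact ⟨c, by rw [← sq, hc, inv_mul_cancel₀ hq]⟩

theorem valid_stdConfig
    (hc : c * c * betaForm (k + 1) (fixedVec (k + 1)) (fixedVec (k + 1)) = 1)
    {E : ℕ → Submodule ℂ (Fin (k + 1) → ℂ)} (hE : IsFlag (betaForm (k + 1)) E ((k + 1) / 2)) :
    (stdConfig k c E).Valid k where
  quad := isQuad_betaForm (k + 1)
  unit := by
    change betaForm (k + 1) (c • fixedVec (k + 1)) (c • fixedVec (k + 1)) = 1
    rw [← hc]
    simp [mul_assoc]
  flagF := isFlag_stdFlag (by omega)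
  perp := by
    have h : ∀ i, ∀ x ∈ stdFlag (k + 1) (k / 2) i,
        betaForm (k + 1) (c • fixedVec (k + 1)) x = 0 := fun i x hx => by
      rw [map_smul, LinearMap.smul_apply,
        betaForm_fixedVec_eq_zero (m := min i (k / 2)) (by omega) hx, smul_zero]
    exact h
  flagE := hE

theorem iso_stdConfig_iff (hc : c ≠ 0) {E E' : ℕ → Submodule ℂ (Fin (k + 1) → ℂ)} :
    (stdConfig k c E).Iso (stdConfig k c E') ↔ ∃ φ ∈ orth (k + 1),
      φ (fixedVec (k + 1)) = fixedVec (k + 1) ∧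
      (∀ m, 2 * m < k + 1 → ∀ x ∈ coordSub (k + 1) m, φ x ∈ coordSub (k + 1) m) ∧
      ∀ i x, φ x ∈ E' i ↔ x ∈ E i := by
  constructor
  · rintro ⟨φ, h1, h2, h3, h4⟩
    refine ⟨φ, h1, ?_, fun m hm x hx => ?_, h4⟩
    · exact smul_right_injective _ hc ((map_smul φ c _).symm.trans h2)
    · have h : stdFlag (k + 1) (k / 2) m = coordSub (k + 1) m := by
        rw [stdFlag, min_eq_left (by omega)]
      rw [← h] at hx ⊢
      exact (h3 m x).2 hx
  · rintro ⟨φ, h1, h2, h3, h4⟩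
    refine ⟨φ, h1, ?_, fun i x => ?_, h4⟩
    · exact (map_smul φ c _).trans (congrArg (c • ·) h2)
    · exact map_mem_coordSub_iff (h3 (min i (k / 2)) (by omega)) x

/-- The flags `F` are full in the complements of the unit vectors, so `exists_isometry_flag` matches
them there; the vectors themselves are then matched. -/
theorem Config.Valid.exists_isometry {C C' : Config} (h : C.Valid k) (h' : C'.Valid k) :
    ∃ Ψ : C.V ≃ₗ[ℂ] C'.V, (∀ x y, C'.B (Ψ x) (Ψ y) = C.B x y) ∧ Ψ C.v = C'.v ∧
      ∀ i x, Ψ x ∈ C'.F i ↔ x ∈ C.F i := by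
  have := h.quad.fin
  have := h'.quad.fin
  have hflag : ∀ {C : Config}, C.Valid k → IsFlag (C.B.restrict (LinearMap.ker (C.B C.v)))
      (fun i => (C.F i).comap (LinearMap.ker (C.B C.v)).subtype) (k / 2) := fun {C} h => by
    refine ⟨fun i j hij => Submodule.comap_mono (h.flagF.mono hij),
      fun i x hx y hy => h.flagF.iso i x hx y hy, fun i => ?_⟩
    rw [finrank_comap_subtype, inf_eq_left.2 (fun x hx => h.perp i x hx), h.flagF.dim]
  obtain ⟨hQ, Φ, hΦ, hΦB⟩ := h.quad.exists_unit_split h.unit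
  obtain ⟨hQ', Φ', hΦ', hΦB'⟩ := h'.quad.exists_unit_split h'.unit
  obtain ⟨φ, hφ, hφF⟩ := exists_isometry_flag k _ _ _ _ _ _ hQ hQ' (hflag h) (hflag h')
  have hΨ : ∀ x a, (Φ.symm ≪≫ₗ φ.prodCongr (LinearEquiv.refl ℂ ℂ) ≪≫ₗ Φ') (Φ (x, a))
      = Φ' (φ x, a) := fun x a => by
    simp only [LinearEquiv.trans_apply, LinearEquiv.symm_apply_apply, LinearEquiv.prodCongr_apply,
      LinearEquiv.refl_apply]
  obtain ⟨Ψ, hΨ'⟩ : ∃ Ψ, Ψ = Φ.symm ≪≫ₗ φ.prodCongr (LinearEquiv.refl ℂ ℂ) ≪≫ₗ Φ' := ⟨_, rfl⟩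
  rw [← hΨ'] at hΨ
  refine ⟨Ψ, fun x y => ?_, ?_, fun i =>
    mem_iff_of_finrank_eq Ψ (fun x hx => ?_) (by rw [h.flagF.dim, h'.flagF.dim])⟩
  · obtain ⟨⟨x, a⟩, rfl⟩ := Φ.surjective x
    obtain ⟨⟨y, b⟩, rfl⟩ := Φ.surjective y
    rw [hΨ, hΨ, hΦB, hΦB']
    exact congrArg (· + a * b) (hφ x y)
  · have := hΨ 0 1
    rwa [hΦ, map_zero, hΦ', Submodule.coe_zero, Submodule.coe_zero, zero_add, zero_add, one_smul,
      one_smul] at this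
  · have := hΨ ⟨x, h.perp i x hx⟩ 0
    rw [hΦ, hΦ', zero_smul, zero_smul, add_zero, add_zero] at this
    rw [this]
    exact (hφF i ⟨x, h.perp i x hx⟩).2 hx

/-- Every valid configuration is isometric to the configuration of an oriented flag. -/
theorem Config.Valid.exists_isOriented
    (hc : c * c * betaForm (k + 1) (fixedVec (k + 1)) (fixedVec (k + 1)) = 1) {C : Config}
    (h : C.Valid k) : ∃ E, IsOriented E ∧ C.Iso (stdConfig k c E) := by
  have hc0 : c ≠ 0 := by rintro rfl; simp at hc
  obtain ⟨E, hE, hi⟩ : ∃ E, IsFlag (betaForm (k + 1)) E ((k + 1) / 2) ∧ C.Iso (stdConfig k c E) := by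
    obtain ⟨Ψ, h1, h2, h3⟩ := h.exists_isometry
      (valid_stdConfig hc (isFlag_stdFlag (n := k + 1) (l := (k + 1) / 2) (by omega)))
    let Ψ' : C.V ≃ₗ[ℂ] (Fin (k + 1) → ℂ) := Ψ
    refine ⟨fun i => (C.E i).comap (Ψ'.symm : (Fin (k + 1) → ℂ) →ₗ[ℂ] C.V),
      ⟨fun i j hij => Submodule.comap_mono (h.flagE.mono hij), fun i x hx y hy => ?_, fun i => ?_⟩,
      Ψ', h1, h2, h3, fun i x => ?_⟩
    · obtain ⟨x, rfl⟩ := Ψ'.surjective x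
      obtain ⟨y, rfl⟩ := Ψ'.surjective y
      rw [Submodule.mem_comap, LinearEquiv.coe_coe, LinearEquiv.symm_apply_apply] at hx hy
      exact (h1 x y).trans (h.flagE.iso i x hx y hy)
    · rw [← h.flagE.dim, Submodule.comap_equiv_eq_map_symm, LinearEquiv.symm_symm]
      exact LinearEquiv.finrank_map_eq Ψ' _
    · exact iff_of_eq (congrArg (· ∈ C.E i) (Ψ'.symm_apply_apply x))
  obtain ⟨φ, hφ, hφE⟩ := hE.exists_orth
  rcases det_eq_one_or hφ with hd | hd
  · exact ⟨E, ⟨φ, hφ, hd, hφE⟩, hi⟩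
  obtain ⟨ρ, hρ, hρd, hρf⟩ := exists_reflection (Nat.succ_pos k)
  have hρi : ∀ m, 2 * m < k + 1 → ∀ x ∈ coordSub (k + 1) m, ρ x = x := fun m hm x hx => by
    rw [hρf, betaForm_fixedVec_eq_zero hm hx, mul_zero, zero_div, zero_smul, sub_zero]
  -- In even dimension -ρ fixes the vector, acts as -1 on `F` and has determinant -1, so it may be
  -- used to move `E`. In odd dimension ρ fixes every step of the standard flag, so `E` was already
  -- oriented.
  rcases (k + 1).even_or_odd with hk | hk
  · have hσd : LinearEquiv.det (ρ ≪≫ₗ LinearEquiv.neg ℂ) = -1 := by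
      have h1 : ((ρ ≪≫ₗ LinearEquiv.neg ℂ : (Fin (k + 1) → ℂ) ≃ₗ[ℂ] (Fin (k + 1) → ℂ)) :
          (Fin (k + 1) → ℂ) →ₗ[ℂ] (Fin (k + 1) → ℂ)) = (-1 : ℂ) • (ρ : _ →ₗ[ℂ] _) :=
        LinearMap.ext fun x => by simp
      refine Units.ext ?_
      rw [LinearEquiv.coe_det, h1, LinearMap.det_smul, finrank_fin_fun, hk.neg_one_pow, one_mul,
        ← LinearEquiv.coe_det, hρd]
    obtain ⟨σ, hσ⟩ : ∃ σ, σ = ρ ≪≫ₗ LinearEquiv.neg ℂ := ⟨_, rfl⟩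
    have hσρ : ∀ x, σ x = -ρ x := fun x => by simp [hσ]
    rw [← hσ] at hσd
    have hσo : σ ∈ orth (k + 1) := fun x y => by
      rw [hσρ, hσρ, map_neg, map_neg, LinearMap.neg_apply, neg_neg, hρ]
    refine ⟨fun i => (E i).comap (σ.symm : (Fin (k + 1) → ℂ) →ₗ[ℂ] (Fin (k + 1) → ℂ)),
      ⟨σ * φ, mul_mem hσo hφ, by rw [map_mul, hσd, hd]; norm_num, fun i x => ?_⟩,
      hi.trans ((iso_stdConfig_iff hc0).2 ⟨σ, hσo, ?_, fun m hm x hx => ?_, fun i x => ?_⟩)⟩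
    · rw [← hφE, LinearEquiv.mul_apply, Submodule.mem_comap, LinearEquiv.coe_coe,
        LinearEquiv.symm_apply_apply]
    · rw [hσρ, hρf, mul_div_cancel_right₀ _ (betaForm_fixedVec_self_ne_zero (Nat.succ_pos k)),
        two_smul, sub_add_cancel_left, neg_neg]
    · rw [hσρ, hρi m hm x hx]
      exact neg_mem hx
    · rw [Submodule.mem_comap, LinearEquiv.coe_coe, LinearEquiv.symm_apply_apply]
  · refine ⟨E, ⟨φ * ρ, mul_mem hφ hρ, by rw [map_mul, hd, hρd]; norm_num, fun i x => ?_⟩, hi⟩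
    rw [LinearEquiv.mul_apply, hφE]
    have := Nat.odd_iff.1 hk
    exact mem_iff_of_finrank_eq ρ (fun x hx => by
      rwa [hρi (min i ((k + 1) / 2)) (by omega) x hx]) rfl x

/-- An isometry of determinant one that preserves the standard flag and the fixed vector lies in
the Borel subgroup of `SO(n - 1)`. -/
theorem exists_BorelSOPred {φ : (Fin n → ℂ) ≃ₗ[ℂ] (Fin n → ℂ)} (hφ : φ ∈ orth n)
    (hd : LinearEquiv.det φ = 1) (hv : φ (fixedVec n) = fixedVec n)
    (h : ∀ m, 2 * m < n → ∀ x ∈ coordSub n m, φ x ∈ coordSub n m) :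
    ∃ g ∈ BorelSOPred n, ∀ x, mat g *ᵥ x = φ x := by
  obtain ⟨g, hg⟩ := exists_SO hφ hd
  refine ⟨g, ⟨(hg _).trans hv, ?_⟩, hg⟩
  have hm : mat g = LinearMap.toMatrix' (φ : (Fin n → ℂ) →ₗ[ℂ] (Fin n → ℂ)) :=
    Matrix.toLin'.injective (LinearMap.ext fun x => by
      rw [toLin'_apply, hg, Matrix.toLin'_toMatrix']
      rfl)
  change (mat g).BlockTriangular id
  rw [hm]
  exact toMatrix'_isUpperTriangular hφ (map_mem_coordSub_of_det_eq_one hφ hd h)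

theorem exists_orth_of_mem_BorelSOPred {g : SO n} (hg : g ∈ BorelSOPred n) :
    ∃ φ ∈ orth n, LinearEquiv.det φ = 1 ∧ (∀ x, mat g *ᵥ x = φ x) ∧
      φ (fixedVec n) = fixedVec n ∧ ∀ m, ∀ x ∈ coordSub n m, φ x ∈ coordSub n m := by
  obtain ⟨φ, hφ, hd, h⟩ := exists_orth g
  refine ⟨φ, hφ, hd, h, (h _).symm.trans hg.1, fun m x hx j hj => ?_⟩
  rw [← h, mulVec, dotProduct]
  refine Finset.sum_eq_zero fun i _ => ?_
  rcases lt_or_ge (i : ℕ) m with hi | hi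
  · rw [show mat g j i = 0 from hg.2 (Fin.lt_def.2 (lt_of_lt_of_le hi hj)), zero_mul]
  · rw [hx i hi, mul_zero]

theorem map_Ad_flagStab {g : SO n} {φ : (Fin n → ℂ) ≃ₗ[ℂ] (Fin n → ℂ)}
    (hg : ∀ x, mat g *ᵥ x = φ x) {E E' : ℕ → Submodule ℂ (Fin n → ℂ)}
    (hE : ∀ i x, φ x ∈ E' i ↔ x ∈ E i) : (flagStab E).map (Ad g) = flagStab E' := by
  have hg' : ∀ x, mat g⁻¹ *ᵥ φ x = x := fun x => by
    rw [← hg, mulVec_mulVec, mat_inv_mul, one_mulVec]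
  ext Z
  rw [LieSubalgebra.mem_map]
  constructor
  · rintro ⟨W, hW, rfl⟩ i y hy
    obtain ⟨x, rfl⟩ := φ.surjective y
    change (mat g * W.1 * mat g⁻¹) *ᵥ φ x ∈ E' i
    rw [← mulVec_mulVec, hg', ← mulVec_mulVec, hg, hE]
    exact hW i x ((hE i x).1 hy)
  · intro hZ
    refine ⟨Ad g⁻¹ Z, fun i x hx => ?_, by rw [← Ad_mul, mul_inv_cancel, Ad_one]⟩
    change (mat g⁻¹ * Z.1 * mat g⁻¹⁻¹) *ᵥ x ∈ E i
    obtain ⟨y, hy⟩ := φ.surjective (Z.1 *ᵥ φ x)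
    rw [inv_inv, ← mulVec_mulVec, hg, ← mulVec_mulVec, ← hy, hg', ← hE, hy]
    exact hZ i _ ((hE i x).2 hx)

/-- Isometric configurations of oriented flags are conjugate under the Borel subgroup of
`SO(n - 1)`. -/
theorem exists_BorelSOPred_of_iso (hc : c ≠ 0) {E E' : ℕ → Submodule ℂ (Fin (k + 1) → ℂ)}
    (hE : IsOriented E) (hE' : IsOriented E') (hi : (stdConfig k c E).Iso (stdConfig k c E')) :
    ∃ g ∈ BorelSOPred (k + 1), (flagStab E).map (Ad g) = flagStab E' := by
  obtain ⟨φ, hφ, hv, hF, hφE⟩ := (iso_stdConfig_iff hc).1 hi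
  -- In odd dimension φ is triangular and fixes the middle basis vector. In even dimension
  -- orientation of both flags is used: conjugation to the standard flag gives an isometry
  -- preserving all its steps.
  have hd : LinearEquiv.det φ = 1 := by
    rcases k.even_or_odd' with ⟨l, rfl | rfl⟩
    · refine det_eq_one_of_map_mem hφ (fun m hm => hF m (by omega)) fun i hr => ?_
      have h1 : i = ⟨l, by omega⟩ := by
        have := congrArg Fin.val hr
        rw [Fin.val_rev] at this
        ext
        dsimp only
        omega
      rw [fixedVec_odd, ← h1] at hv
      rw [hv, Pi.single_eq_same]
    · obtain ⟨ψ, hψ, hψd, hψE⟩ := hE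
      obtain ⟨ψ', hψ', hψd', hψE'⟩ := hE'
      have h1 := det_eq_one_of_map_mem (mul_mem (mul_mem (inv_mem hψ') hφ) hψ)
        (fun m hm x hx => by
          have h1 : stdFlag (2 * l + 1 + 1) ((2 * l + 1 + 1) / 2) m = coordSub _ m := by
            rw [stdFlag, min_eq_left (by omega)]
          rw [← h1] at hx ⊢
          rw [← hψE', mul_assoc, ← LinearEquiv.mul_apply, mul_inv_cancel_left,
            LinearEquiv.mul_apply, hφE, hψE]
          exact hx) (fun i hr => by
          have := congrArg Fin.val hr
          rw [Fin.val_rev] at this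
          omega)
      rwa [map_mul, map_mul, map_inv, hψd, hψd', inv_one, one_mul, mul_one] at h1
  obtain ⟨g, hg, hgφ⟩ := exists_BorelSOPred hφ hd hv hF
  exact ⟨g, hg, map_Ad_flagStab hgφ hφE⟩

/-- Equality of stabilizers gives equality only of the low steps of gE and E'. Both flags being
oriented, they coincide. -/
theorem iso_of_map_Ad_eq (hc : c ≠ 0) {E E' : ℕ → Submodule ℂ (Fin (k + 1) → ℂ)}
    (hE : IsOriented E) (hE' : IsOriented E') {g : SO (k + 1)} (hg : g ∈ BorelSOPred (k + 1))
    (h : (flagStab E).map (Ad g) = flagStab E') : (stdConfig k c E).Iso (stdConfig k c E') := by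
  obtain ⟨φ, hφ, hd, hgφ, hv, hF⟩ := exists_orth_of_mem_BorelSOPred hg
  have hφE : ∀ i x, φ x ∈ (E i).comap
      (φ.symm : (Fin (k + 1) → ℂ) →ₗ[ℂ] (Fin (k + 1) → ℂ)) ↔ x ∈ E i := fun i x => by
    rw [Submodule.mem_comap, LinearEquiv.coe_coe, LinearEquiv.symm_apply_apply]
  have ho := hE.comap_symm hφ hd
  rw [map_Ad_flagStab hgφ hφE] at h
  rw [← ho.eq_of_eq hE' ((flagStab_eq_iff ho.isFlag hE'.isFlag).1 h)]
  exact (iso_stdConfig_iff hc).2 ⟨φ, hφ, hv, fun m _ => hF m, hφE⟩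

end StdConfig

end OrientedFlags

end OrthoCount

namespace OrthoCount

/-! ### Counting orbits -/

theorem finite_and_card_code : ∀ k, Finite (Config.Code k) ∧
    Nat.card (Config.Code k) = orbitCount (k + 1)
  | 0 => ⟨inferInstanceAs (Finite Unit), Nat.card_unique (α := Unit)⟩
  | 1 => ⟨inferInstanceAs (Finite Unit), Nat.card_unique (α := Unit)⟩
  | k + 2 => by
    obtain ⟨h1, h1'⟩ := finite_and_card_code (k + 1)
    obtain ⟨h2, h2'⟩ := finite_and_card_code k
    refine ⟨inferInstanceAs (Finite (Config.Code (k + 1) ⊕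
      (Fin (k / 2 + 1) × Bool × Config.Code k))), ?_⟩
    change Nat.card (Config.Code (k + 1) ⊕ (Fin (k / 2 + 1) × Bool × Config.Code k)) = _
    rw [Nat.card_sum, Nat.card_prod, Nat.card_prod, h1', h2',
      show orbitCount (k + 2 + 1) = orbitCount (k + 1 + 1) +
        2 * ((k + 1 + 1) / 2) * orbitCount (k + 1) from rfl]
    simp only [Nat.card_eq_fintype_card, Fintype.card_fin, Fintype.card_bool]
    rw [show (k + 1 + 1) / 2 = k / 2 + 1 by omega]
    ring

/-- The Borel subalgebra `b` stabilizes an oriented flag whose configuration has the code `a`. -/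
def HasOrbitCode (k : ℕ) (c : ℂ) (b : FlagVariety (k + 1)) (a : Config.Code k) : Prop :=
  ∃ E, IsOriented E ∧ b.1 = flagStab E ∧ Config.HasCode k a (stdConfig k c E)

section HasOrbitCode

variable {k : ℕ} {c : ℂ}

theorem exists_hasOrbitCode
    (hc : c * c * betaForm (k + 1) (fixedVec (k + 1)) (fixedVec (k + 1)) = 1)
    (b : FlagVariety (k + 1)) : ∃ a, HasOrbitCode k c b a := by
  obtain ⟨E, hE, hb⟩ := b.2.exists_flag
  obtain ⟨E', hE', h⟩ := hE.exists_isOriented (Nat.succ_pos k)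
  obtain ⟨a, ha⟩ := Config.exists_hasCode (valid_stdConfig hc hE'.isFlag)
  exact ⟨a, E', hE', hb.trans ((flagStab_eq_iff hE hE'.isFlag).2 h), ha⟩

/-- Every code is realized by an abstract configuration, which can be moved into ℂᵏ⁺¹ with an
oriented flag; the code survives because it is an isometry invariant. -/
theorem exists_flagVariety_hasOrbitCode
    (hc : c * c * betaForm (k + 1) (fixedVec (k + 1)) (fixedVec (k + 1)) = 1)
    (a : Config.Code k) : ∃ b, HasOrbitCode k c b a := by
  obtain ⟨C, hC⟩ := Config.exists_config a
  obtain ⟨E, hE, hi⟩ := hC.valid.exists_isOriented hc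
  obtain ⟨a', ha'⟩ := Config.exists_hasCode (valid_stdConfig hc hE.isFlag)
  rw [hC.code_eq ha' hi]
  exact ⟨⟨flagStab E, isBorel_flagStab hE.isFlag⟩, E, hE, rfl, ha'⟩

theorem HasOrbitCode.eq_iff (hc : c ≠ 0) {b b' : FlagVariety (k + 1)} {a a' : Config.Code k}
    (h : HasOrbitCode k c b a) (h' : HasOrbitCode k c b' a') :
    a = a' ↔ MulAction.orbitRel (BorelSOPred (k + 1)) (FlagVariety (k + 1)) b' b := by
  obtain ⟨E, hE, hb, ha⟩ := h
  obtain ⟨E', hE', hb', ha'⟩ := h'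
  rw [MulAction.orbitRel_apply]
  constructor
  · rintro rfl
    obtain ⟨g, hg, h⟩ := exists_BorelSOPred_of_iso hc hE hE' (ha.iso ha')
    refine ⟨⟨g, hg⟩, Subtype.ext ?_⟩
    rw [hb', ← h, ← hb]
    rfl
  · rintro ⟨g, hg⟩
    refine ha.code_eq ha' (iso_of_map_Ad_eq hc hE hE' g.2 ?_)
    rw [← hb', ← hg, ← hb]
    rfl

end HasOrbitCode

theorem nonempty_orbits_equiv_code (k : ℕ) : Nonempty (Orbits (k + 1) ≃ Config.Code k) := by
  obtain ⟨c, hc⟩ := exists_normalizer k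
  have hc0 : c ≠ 0 := by
    rintro rfl
    simp at hc
  choose f hf using exists_hasOrbitCode hc
  refine ⟨Equiv.ofBijective (Quotient.lift f fun b b' h =>
    ((hf b').eq_iff hc0 (hf b)).2 h |>.symm) ⟨?_, fun a => ?_⟩⟩
  · rintro ⟨b⟩ ⟨b'⟩ h
    exact Quotient.sound (((hf b').eq_iff hc0 (hf b)).1 h.symm)
  · obtain ⟨b, hb⟩ := exists_flagVariety_hasOrbitCode hc a
    exact ⟨Quotient.mk _ b, ((hf b).eq_iff hc0 hb).2 ((MulAction.orbitRel _ _).refl b)⟩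

/-- Dimension zero has no unit vector and hence no configuration, but so(0) = 0 has a single
subalgebra. -/
theorem nonempty_unique_orbits_zero : Nonempty (Unique (Orbits 0)) := by
  have hE : IsFlag (betaForm 0) (stdFlag 0 0) (0 / 2) := isFlag_stdFlag (by omega)
  have hs : Subsingleton (so 0) := ⟨fun Z W => Subtype.ext (Subsingleton.elim _ _)⟩
  have hb : ∀ b b' : LieSubalgebra ℂ (so 0), b = b' := fun b b' => by
    ext Z
    rw [Subsingleton.elim Z 0]
    exact ⟨fun _ => zero_mem _, fun _ => zero_mem _⟩
  refine ⟨⟨⟨Quotient.mk _ ⟨_, isBorel_flagStab hE⟩⟩, ?_⟩⟩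
  rintro ⟨b⟩
  exact congrArg (Quotient.mk _) (Subtype.ext (hb _ _))

theorem finite_and_card_orbits : ∀ n, Finite (Orbits n) ∧ Nat.card (Orbits n) = orbitCount n
  | 0 => by
    obtain ⟨h⟩ := nonempty_unique_orbits_zero
    exact ⟨inferInstance, Nat.card_unique⟩
  | k + 1 => by
    obtain ⟨e⟩ := nonempty_orbits_equiv_code k
    obtain ⟨h1, h2⟩ := finite_and_card_code k
    exact ⟨Finite.of_equiv _ e.symm, (Nat.card_congr e).trans h2⟩

end OrthoCount

theorem mainTheorem4 :
    (∀ l : ℕ,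
      Finite (OrthoCount.Orbits (2 * l)) ∧ (OrthoCount.SPIL (Finset.Icc 1 l)).Finite ∧
        Nat.card (OrthoCount.Orbits (2 * l)) = (OrthoCount.SPIL (Finset.Icc 1 l)).ncard) ∧
    (∀ l : ℕ,
      Finite (OrthoCount.Orbits (2 * l + 1)) ∧ (OrthoCount.SPIL (Finset.Icc 0 l)).Finite ∧
        Nat.card (OrthoCount.Orbits (2 * l + 1)) = (OrthoCount.SPIL (Finset.Icc 0 l)).ncard) := by
  have h0 : ∀ l : ℕ, 0 ∉ Finset.Icc 1 l := fun l => by simp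
  have hl : ∀ l : ℕ, (Finset.Icc 1 l).card = l := fun l => by simp
  refine ⟨fun l => ?_, fun l => ?_⟩
  · obtain ⟨h1, h2⟩ := OrthoCount.finite_and_card_orbits (2 * l)
    obtain ⟨h3, h4⟩ := OrthoCount.card_SPIL (h0 l) (hl l)
    exact ⟨h1, h3, h2.trans h4.symm⟩
  · obtain ⟨h1, h2⟩ := OrthoCount.finite_and_card_orbits (2 * l + 1)
    obtain ⟨h3, h4⟩ := OrthoCount.card_SPIL_insert_zero (h0 l) (hl l)
    rw [show insert 0 (Finset.Icc 1 l) = Finset.Icc 0 l by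
      ext a
      simp only [Finset.mem_insert, Finset.mem_Icc]
      omega] at h3 h4
    exact ⟨h1, h3, h2.trans h4.symm⟩
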